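/- **Model.** A team has $n\ge 2$ players. There are two stage games $g\in\{G,B\}$ with actions $\{C,N\}$. Payoffs $\pi_g(a_i,\mathbf a_{-i})$ satisfy, for each $g$: (1) they depend only on one's own action and, anonymously, on the others' actions; (2) $C^n$ uniquely maximizes aggregate payoffs; (3) $N$ is strictly dominant; (4) $N^{n-1}$ minimizes $\max_{a_i}\pi_g(a_i,\mathbf a_{-i})$; (5) $N^n$ gives a strictly larger aggregate payoff than every profile other than $C^n$ and $N^n$; (6) $\pi_g(N,\mathbf a_{-i})-\pi_g(C,\mathbf a_{-i})$ is smallest at $\mathbf a_{-i}=C^{n-1}$. Put $c_g=\pi_g(C,C^{n-1})-\pi_g(N,N^{n-1})$ and $d_g=\pi_g(N,C^{n-1})-\pi_g(C,C^{n-1})$. There are two tasks: in each period spent on $t_G$ the game $G$ arrives with probability $a_G\in(0,1]$, on $t_B$ the game $B$ arrives with probability $a_B\in(0,1]$, and otherwise no game ($\emptyset$) occurs, with payoff $0$. The discount factor is $\delta\in(0,1)$. The social values of cooperation are $V_G>0>V_B$. A *reactive assignment* is a map $m:\mathcal S\to\Delta(\{t_G,t_B\})$ on states $s\in\mathcal S=(\{t_G,t_B\}\times\{G,B,\emptyset\})^K$,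 for some integer $K\ge1$ that may differ across assignments. A state lists the tasks and games of the last $K$ periods, the last entry being the current one, and $m(s)$ is the law of the next task; thus $m$ may react to good-game arrivals. It induces a Markov chain on $\mathcal S$. A *reactive team structure* is a finitely supported probability measure $\lambda$ on reactive assignments together with, for each $m\in\mathrm{supp}(\lambda)$, a reshuffling rate $r_m\in[0,1]$ and a steady state $\overline m$ of the chain. It is feasible if $\sum_m\lambda(m)\,\overline m(\text{current task}=t)=q_t$ for each task $t$, where $q_t\ge0$ and $q_{t_G}+q_{t_B}=1$ are given. The team starts in a state drawn from $\overline m$. Players observe the initial state and all tasks, games and actions since then, use behavior strategies, and discount by $(1-r_m)\delta$. A player-optimal equilibrium is a subgame-perfect equilibrium that maximizes the sum of the players' expected discounted payoffs among all of them. There is *cooperation in state* $s$ if in player-optimal equilibrium all players cooperate for sure whenever $s$ is reached on path. Players in $m$ are *fully cooperative* (*fully non-cooperative*) if in player-optimal equilibrium all players cooperate (do not cooperate) in every game on path. The social value of $\lambda$ is $\sum_m\lambda(m)\sum_s\overline m(s)V_{g(s)}$, where the inner sum is over the states $s$ with cooperation whose current game $g(s)$ is not $\emptyset$. A feasible reactive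 team structure is *designer-optimal* if it maximizes the social value among feasible ones. **Proposition.** Suppose that $d_G>\frac{\delta}{1-\delta}a_Gc_G$, $\max\{d_G,d_B\}<\frac{\delta}{1-\delta}a_Bc_B$ and $d_B<\frac{\delta}{1-\delta}a_Gc_G$. Then there is an integer $N_B\ge0$ such that every designer-optimal reactive team structure $\lambda$ has the following properties. For each $m\in\mathrm{supp}(\lambda)$ in which players are fully cooperative, and at states of positive mass under $\overline m$: 1. Whenever a good game is played on the path of a player-optimal equilibrium, each player is indifferent between cooperating and not cooperating. 2. After playing a good game, the team is assigned the bad task in each of the next $N_B$ periods. Given the state in which the good game was played, it is assigned the good task in the period after that with positive probability. If it is not assigned the good task in that period, it is assigned the good task with probability $1$ in the next one. 3. If the team is on the good task and no good game occurs, it is assigned the good task again in the next period with probability $1$. Furthermore, unless there is a designer-optimal reactive team structure in which players are fully non-cooperative in all assignments of its support, there is one task $t$ such that every $m'\in\mathrm{supp}(\lambda)$ in which players are fully non-cooperative always assigns teams to $t$ (that is, $\overline m'$ gives mass $1$ to states with current task $t$). -/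

import Mathlib

namespace ReactiveTeams

/-- The two labels: `G` for good, `B` for bad. -/
inductive Kind where
  | G
  | B
  deriving DecidableEq

instance : Fintype Kind := ⟨{Kind.G, Kind.B}, fun k => by cases k <;> simp⟩

/-- The tasks `t_G` and `t_B`. -/
abbrev Task := Kind

/-- The stage games `G` and `B`; "no game" is `none : Option Game`. -/
abbrev Game := Kind

/-- The stage actions: cooperate (`C`) or not (`N`). -/
inductive Act where
  | C
  | N
  deriving DecidableEq

instance : Fintype Act := ⟨{Act.C, Act.N}, fun x => by cases x <;> simp⟩

/-- Everybody cooperates. -/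
def allC {n : ℕ} : Fin n → Act := fun _ => Act.C

/-- Nobody cooperates. -/
def allN {n : ℕ} : Fin n → Act := fun _ => Act.N

/-- The standing assumptions on a stage game with payoffs `u i a` (player `i`, action profile `a`). -/
structure IsCooperationGame {n : ℕ} (u : Fin n → (Fin n → Act) → ℝ) : Prop where
  /-- Payoffs depend only on one's own action and, anonymously, on those of the others. -/
  symmetric : ∀ (e : Equiv.Perm (Fin n)) (i : Fin n) (a : Fin n → Act),
    u (e i) (a ∘ e.symm) = u i a
  /-- Aggregate payoffs are uniquely maximized by full cooperation. -/
  allC_max : ∀ a : Fin n → Act, a ≠ allC → ∑ i, u i a < ∑ i, u i allC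
  /-- Not cooperating is strictly dominant. -/
  dominant : ∀ (i : Fin n) (a : Fin n → Act),
    u i (Function.update a i Act.N) > u i (Function.update a i Act.C)
  /-- A player's best-reply payoff is minimized by non-cooperation of all others. -/
  minmax : ∀ (i : Fin n) (a : Fin n → Act),
    max (u i (Function.update allN i Act.C)) (u i (Function.update allN i Act.N)) ≤
      max (u i (Function.update a i Act.C)) (u i (Function.update a i Act.N))
  /-- Complete non-cooperation is strictly better in aggregate than any asymmetric play. -/
  allN_max : ∀ a : Fin n → Act, a ≠ allC → a ≠ allN → ∑ i, u i a < ∑ i, u i allN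
  /-- The gain from not cooperating is smallest when all others cooperate. -/
  gain_min : ∀ (i : Fin n) (a : Fin n → Act),
    u i (Function.update allC i Act.N) - u i (Function.update allC i Act.C) ≤
      u i (Function.update a i Act.N) - u i (Function.update a i Act.C)

/-- The primitives of the model. -/
structure Model where
  /-- number of players of a team -/
  n : ℕ
  two_le : 2 ≤ n
  /-- stage payoffs -/
  payoff : Game → Fin n → (Fin n → Act) → ℝ
  payoff_game : ∀ g, IsCooperationGame (payoff g)
  /-- discount factor -/
  δ : ℝ
  δ_pos : 0 < δ
  δ_lt_one : δ < 1
  /-- `a G` (`a B`) is the arrival probability of game `G` (`B`) on task `t_G` (`t_B`) -/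
  a : Kind → ℝ
  a_pos : ∀ k, 0 < a k
  a_le_one : ∀ k, a k ≤ 1
  /-- social value of cooperation in each game -/
  V : Game → ℝ
  V_G_pos : 0 < V Kind.G
  V_B_neg : V Kind.B < 0
  /-- fraction of teams that must be on each task at any instant -/
  q : Task → ℝ
  q_nonneg : ∀ t, 0 ≤ q t
  q_sum : ∑ t, q t = 1

/-- States with memory `K`: tasks and games of the last `K` periods, the last entry being the
current period. -/
abbrev State (K : ℕ) := Fin K → Task × Option Game

/-- The state in the next period: the oldest entry is dropped and the new entry is added. -/
def State.push {K : ℕ} (s : State K) (e : Task × Option Game) : State K :=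
  fun j => if h : (j : ℕ) + 1 < K then s ⟨(j : ℕ) + 1, h⟩ else e

/-- A reactive assignment, with a memory `K` of its own: a (random) next task as a function of the
state. -/
structure Assignment where
  K : ℕ
  K_pos : 0 < K
  rule : State K → Task → ℝ
  rule_mem : ∀ s, rule s ∈ stdSimplex ℝ Task

namespace Assignment

/-- The current period's entry. -/
def last (m : Assignment) (s : State m.K) : Task × Option Game :=
  s ⟨m.K - 1, Nat.sub_lt m.K_pos Nat.one_pos⟩

/-- The current task. -/
def task (m : Assignment) (s : State m.K) : Task := (m.last s).1

/-- The current game, if any. -/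
def game (m : Assignment) (s : State m.K) : Option Game := (m.last s).2

end Assignment

namespace Model

variable (M : Model)

/-- Some player. -/
def player : Fin M.n := ⟨0, lt_of_lt_of_le Nat.two_pos M.two_le⟩

/-- The cooperation benefit `c_g`. -/
def c (g : Game) : ℝ := M.payoff g M.player allC - M.payoff g M.player allN

/-- The deviation temptation `d_g`. -/
def d (g : Game) : ℝ :=
  M.payoff g M.player (Function.update allC M.player Act.N) - M.payoff g M.player allC

/-- Probability that the game (or no game) `o` occurs on task `t`. -/
def arrival (t : Task) : Option Game → ℝ
  | none => 1 - M.a t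
  | some g => if g = t then M.a t else 0

/-- Probability that the next period's entry is `e`, given the state `s`. -/
def nextProb (m : Assignment) (s : State m.K) (e : Task × Option Game) : ℝ :=
  m.rule s e.1 * M.arrival e.1 e.2

/-- Transition matrix of the Markov chain of states; row `s`, column `s'` holds the probability of
moving from `s` to `s'`. -/
def trans (m : Assignment) : Matrix (State m.K) (State m.K) ℝ :=
  Matrix.of fun s s' => ∑ e, if s.push e = s' then M.nextProb m s e else 0

/-- `μ` is a steady-state distribution of `m`. -/
def IsSteady (m : Assignment) (μ : State m.K → ℝ) : Prop :=
  μ ∈ stdSimplex ℝ (State m.K) ∧ ∀ s', μ s' = ∑ s, M.trans m s s' * μ s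

/-- Probability of being assigned task `t` in period `τ + k + 1`, given the state `s` in
period `τ`. -/
def taskProb (m : Assignment) (s : State m.K) (k : ℕ) (t : Task) : ℝ :=
  ∑ s', (M.trans m ^ k) s s' * m.rule s' t

/-- Team histories up to and including the current task and game: the state in which the team
starts and, for each period that has passed since (newest first), the action profile played and the
entry of the period that followed. -/
abbrev Hist (m : Assignment) :=
  State m.K × List ((Fin M.n → Act) × (Task × Option Game))

variable {M} in
/-- One more period: profile `a` is played and the next period's entry is `e`. -/
def Hist.extend {m : Assignment} (h : M.Hist m) (a : Fin M.n → Act) (e : Task × Option Game) :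
    M.Hist m :=
  (h.1, (a, e) :: h.2)

variable {M} in
/-- The state at the end of a history. -/
def Hist.state {m : Assignment} (h : M.Hist m) : State m.K :=
  h.2.foldr (fun x s => s.push x.2) h.1

variable {M} in
/-- The game currently faced, if any. -/
def Hist.game {m : Assignment} (h : M.Hist m) : Option Game := m.game h.state

/-- A behavior strategy of a player: the probability of cooperating after each history. Its values
at histories where there is currently no game are never used. -/
abbrev Strategy (m : Assignment) := M.Hist m → unitInterval

/-- A strategy for each player. -/
abbrev Profile (m : Assignment) := Fin M.n → M.Strategy m

/-- Probability that the profile `a` is played at `h`. When there is no game, no actions are taken,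
and the record is `allN` for sure. -/
def playProb {m : Assignment} (σ : M.Profile m) (h : M.Hist m) (a : Fin M.n → Act) : ℝ :=
  match h.game with
  | none => if a = allN then 1 else 0
  | some _ => ∏ i, if a i = Act.C then (σ i h : ℝ) else 1 - (σ i h : ℝ)

/-- Stage payoff of player `i` at `h` when `a` is played; it is 0 when there is no game. -/
def stagePayoff {m : Assignment} (h : M.Hist m) (i : Fin M.n) (a : Fin M.n → Act) : ℝ :=
  match h.game with
  | none => 0
  | some g => M.payoff g i a

/-- Expected stage payoff of player `i`, `k` periods after the history `h`. -/
def expPayoff {m : Assignment} (σ : M.Profile m) (i : Fin M.n) : ℕ → M.Hist m → ℝ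
  | 0, h => ∑ a, M.playProb σ h a * M.stagePayoff h i a
  | k + 1, h => ∑ a, M.playProb σ h a *
      ∑ e, M.nextProb m h.state e * expPayoff σ i k (h.extend a e)

/-- Expected discounted payoff of player `i` from the history `h` on, at reshuffling rate `r`,
i.e. with discount factor `(1 - r) δ`. The series converges, since stage payoffs are bounded. -/
noncomputable def value {m : Assignment} (r : ℝ) (σ : M.Profile m) (i : Fin M.n)
    (h : M.Hist m) : ℝ :=
  ∑' k, ((1 - r) * M.δ) ^ k * M.expPayoff σ i k h

/-- Subgame-perfect equilibrium. -/
def IsSPE {m : Assignment} (r : ℝ) (σ : M.Profile m) : Prop :=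
  ∀ (h : M.Hist m) (i : Fin M.n) (ρ : M.Strategy m),
    M.value r (Function.update σ i ρ) i h ≤ M.value r σ i h

/-- Sum of the players' expected discounted payoffs when the team starts in a state drawn from
`μ`. -/
noncomputable def welfare {m : Assignment} (r : ℝ) (μ : State m.K → ℝ) (σ : M.Profile m) : ℝ :=
  ∑ s, μ s * ∑ i, M.value r σ i (s, [])

/-- Player-optimal (subgame-perfect) equilibrium. -/
def IsPlayerOptimal {m : Assignment} (r : ℝ) (μ : State m.K → ℝ) (σ : M.Profile m) : Prop :=
  M.IsSPE r σ ∧ ∀ σ' : M.Profile m, M.IsSPE r σ' → M.welfare r μ σ' ≤ M.welfare r μ σ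

/-- The history `(s, l)` is reached with positive probability when the profile `σ` is played and the
team starts in a state of positive mass. -/
def OnPathAux {m : Assignment} (μ : State m.K → ℝ) (σ : M.Profile m) (s : State m.K) :
    List ((Fin M.n → Act) × (Task × Option Game)) → Prop
  | [] => 0 < μ s
  | x :: l => OnPathAux μ σ s l ∧ 0 < M.playProb σ ((s, l) : M.Hist m) x.1 ∧
      0 < M.nextProb m (Hist.state ((s, l) : M.Hist m)) x.2

/-- The history `h` is on path. -/
def OnPath {m : Assignment} (μ : State m.K → ℝ) (σ : M.Profile m) (h : M.Hist m) : Prop :=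
  M.OnPathAux μ σ h.1 h.2

/-- There is cooperation in the state `s`: player-optimal equilibria exist, and in each of them all
players cooperate for sure whenever `s` is reached on path. -/
def CooperationIn (m : Assignment) (r : ℝ) (μ : State m.K → ℝ) (s : State m.K) : Prop :=
  (∃ σ : M.Profile m, M.IsPlayerOptimal r μ σ) ∧
    ∀ σ : M.Profile m, M.IsPlayerOptimal r μ σ →
      ∀ h, M.OnPath μ σ h → h.state = s → ∀ i, σ i h = 1

/-- Players are fully cooperative: player-optimal equilibria exist, and in each of them all players
cooperate for sure in every game on path. -/
def FullyCooperative (m : Assignment) (r : ℝ) (μ : State m.K → ℝ) : Prop :=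
  (∃ σ : M.Profile m, M.IsPlayerOptimal r μ σ) ∧
    ∀ σ : M.Profile m, M.IsPlayerOptimal r μ σ →
      ∀ h, M.OnPath μ σ h → h.game ≠ none → ∀ i, σ i h = 1

/-- Players are fully non-cooperative: player-optimal equilibria exist, and in each of them no
player ever cooperates on path. -/
def FullyNonCooperative (m : Assignment) (r : ℝ) (μ : State m.K → ℝ) : Prop :=
  (∃ σ : M.Profile m, M.IsPlayerOptimal r μ σ) ∧
    ∀ σ : M.Profile m, M.IsPlayerOptimal r μ σ →
      ∀ h, M.OnPath μ σ h → h.game ≠ none → ∀ i, σ i h = 0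

/-- In every player-optimal equilibrium, whenever a good game is played on path, every player gets
the same payoff from cooperating now as from not cooperating now. -/
def IndifferentInGood (m : Assignment) (r : ℝ) (μ : State m.K → ℝ) : Prop :=
  ∀ σ : M.Profile m, M.IsPlayerOptimal r μ σ →
    ∀ h, M.OnPath μ σ h → h.game = some Kind.G → ∀ i,
      M.value r (Function.update σ i (Function.update (σ i) h 1)) i h =
        M.value r (Function.update σ i (Function.update (σ i) h 0)) i h

open Classical in
/-- Social value of a team with the reactive assignment `m`. -/
noncomputable def socialValue (m : Assignment) (r : ℝ) (μ : State m.K → ℝ) : ℝ :=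
  ∑ s, match m.game s with
    | none => 0
    | some g => if M.CooperationIn m r μ s then μ s * M.V g else 0

/-- A reactive team structure: a probability measure with finite support on reactive assignments,
with a reshuffling rate and a steady state for each assignment in the support (values off the
support are never used). -/
structure TeamStructure where
  support : Finset Assignment
  weight : Assignment → ℝ
  weight_pos : ∀ m ∈ support, 0 < weight m
  weight_sum : ∑ m ∈ support, weight m = 1
  rate : Assignment → ℝ
  rate_mem : ∀ m ∈ support, rate m ∈ Set.Icc (0 : ℝ) 1
  steady : (m : Assignment) → State m.K → ℝ
  steady_isSteady : ∀ m ∈ support, M.IsSteady m (steady m)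

variable {M}

namespace TeamStructure

/-- The task-assignment constraint. -/
def IsFeasible (L : M.TeamStructure) : Prop :=
  ∀ t : Task, ∑ m ∈ L.support, L.weight m * ∑ s with m.task s = t, L.steady m s = M.q t

/-- The social value of a reactive team structure. -/
noncomputable def socialValue (L : M.TeamStructure) : ℝ :=
  ∑ m ∈ L.support, L.weight m * M.socialValue m (L.rate m) (L.steady m)

/-- Designer-optimal reactive team structures. -/
def IsOptimal (L : M.TeamStructure) : Prop :=
  L.IsFeasible ∧ ∀ L' : M.TeamStructure, L'.IsFeasible → L'.socialValue ≤ L.socialValue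

end TeamStructure

end Model

end ReactiveTeams

open ReactiveTeams

namespace ReactiveTeams

/-! Call the promise of a state the continuation value of full cooperation in excess of autarky.
Autarky is the worst threat, so cooperation in a good game requires a promise of at least `d_G`
(`IsSPE.temptation_le`). Conversely, promises that cover the temptation in every state make grim
trigger an equilibrium and full cooperation the only player-optimal outcome
(`fullyCooperative_of_willing`). The social value of a fully cooperative team depends only on its
shares of time on the two tasks, so the question is how little bad time can sustain a given amount
of good time.

Waiting on the good task, with `d_G` promised after the next good game, is worth `goodValue`. Under
the hypotheses `goodValue` is below `d_G`, so bad periods are needed to fill the difference; it is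
above `d_B`, so bad games need no further incentives. Preceding the wait by `k` bad periods raises
the promise to `threshold k`. The convex, piecewise affine `potential` interpolates this count of
bad periods and vanishes up to `goodValue`. Along any promise, a bad period lowers its expectation
by at most one (`potential_badPromise_le`), and a good period raises it on average by at least `a_G`
times its value at `d_G` (`potential_goodPromise_le`). In a steady state the potential terms cancel
(`sum_net_sub`), which leaves the bound `share_le` on good time in terms of bad time.

If the bound is attained, every one-step inequality is an equality on the support. The promise is
then exactly `d_G` in good games, and it descends one affine piece of the potential with each bad
period. Slack from discounting on the lowest piece forces the potential to zero after one more bad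
period, and zero potential forces the good task. This gives all three structural claims.

The bound is attained by an explicit cyclic assignment (`exists_efficient`). In an optimal
structure, a fully cooperative assignment with slack could be replaced by a mixture of that
assignment and an idle team on the bad task: good time is unchanged and cooperation in bad games
falls (`share_bad_le`). If idle teams occupy both tasks and the optimal value is positive, some of
their weight can be moved to an assignment of positive value and pure idle teams; if the value is
not positive, full idleness is itself optimal (`idle_task`). -/

theorem Kind.sum_univ (f : Kind → ℝ) : ∑ k, f k = f Kind.G + f Kind.B := by
  have : (Finset.univ : Finset Kind) = {Kind.G, Kind.B} := rfl
  rw [this, Finset.sum_pair (by decide)]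

theorem Act.sum_univ (f : Act → ℝ) : ∑ x, f x = f Act.C + f Act.N := by
  have : (Finset.univ : Finset Act) = {Act.C, Act.N} := rfl
  rw [this, Finset.sum_pair (by decide)]

theorem Act.eq_N_of_ne_C {x : Act} (h : x ≠ Act.C) : x = Act.N := by
  cases x <;> simp_all

/-! ### Stage payoffs, play probabilities and discounted values. -/

namespace Model

variable (M : Model)

/-- Excess of full cooperation over full non-cooperation in the current game, if any. -/
def gain (o : Option Game) : ℝ := o.elim 0 M.c

/-- Payoff of full non-cooperation in the current game, if any. -/
def autarky (o : Option Game) : ℝ := o.elim 0 fun g => M.payoff g M.player allN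

@[simp] theorem gain_none : M.gain none = 0 := rfl
@[simp] theorem gain_some (g : Game) : M.gain (some g) = M.c g := rfl
@[simp] theorem autarky_none : M.autarky none = 0 := rfl
@[simp] theorem autarky_some (g : Game) :
    M.autarky (some g) = M.payoff g M.player allN := rfl

theorem payoff_const (g : Game) (i j : Fin M.n) (x : Act) :
    M.payoff g i (fun _ => x) = M.payoff g j (fun _ => x) := by
  have := (M.payoff_game g).symmetric (Equiv.swap j i) j (fun _ => x)
  simpa [Function.comp_def] using this

theorem payoff_allN (g : Game) (i : Fin M.n) :
    M.payoff g i allN = M.payoff g M.player allN := M.payoff_const g i _ _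

theorem payoff_allC (g : Game) (i : Fin M.n) :
    M.payoff g i allC = M.payoff g M.player allN + M.c g := by
  have : M.payoff g i allC = M.payoff g M.player allC := M.payoff_const g i _ _
  rw [this, c]; ring

/-- Anonymity, applied to the transposition of `player` and `i`, carries the temptation defined at
`player` over to every player. -/
theorem payoff_deviation (g : Game) (i : Fin M.n) :
    M.payoff g i (Function.update allC i Act.N) =
      M.payoff g M.player allN + M.c g + M.d g := by
  have h := (M.payoff_game g).symmetric (Equiv.swap M.player i) M.player
    (Function.update allC M.player Act.N)
  have e : (Function.update allC M.player Act.N) ∘ (Equiv.swap M.player i).symm =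
      Function.update (allC : Fin M.n → Act) i Act.N := by
    funext j
    simp only [Function.comp, Function.update_apply, Equiv.symm_swap, allC]
    congr 1
    rw [Equiv.swap_apply_eq_iff, Equiv.swap_apply_left]
  rw [e, Equiv.swap_apply_left] at h
  rw [h, d, c]; ring

/-- By dominance both best-reply maxima are attained at `N`, so the minmax assumption compares the
payoffs of `N` directly. -/
theorem payoff_N_ge (g : Game) (i : Fin M.n) (a : Fin M.n → Act) (ha : a i = Act.N) :
    M.payoff g M.player allN ≤ M.payoff g i a := by
  have h1 := (M.payoff_game g).minmax i a
  have h2 := (M.payoff_game g).dominant i a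
  have e1 : Function.update (allN : Fin M.n → Act) i Act.N = allN := by
    funext j; by_cases hj : j = i <;> simp [Function.update_apply, allN]
  have e2 : Function.update a i Act.N = a := by rw [← ha, Function.update_eq_self]
  rw [e2] at h1 h2
  rw [max_eq_right h2.le, e1] at h1
  rw [← M.payoff_allN g i]
  exact (le_max_right _ _).trans h1

theorem c_pos (g : Game) : 0 < M.c g := by
  have hne : (allN : Fin M.n → Act) ≠ allC := fun h => by
    have := congrFun h M.player
    simp [allN, allC] at this
  have h := (M.payoff_game g).allC_max allN hne
  simp only [payoff_allN, payoff_allC, Finset.sum_const, Finset.card_univ, Fintype.card_fin,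
    nsmul_eq_mul] at h
  have hn : (0 : ℝ) < M.n := by exact_mod_cast lt_of_lt_of_le Nat.two_pos M.two_le
  have := lt_of_mul_lt_mul_left h hn.le
  linarith

theorem d_pos (g : Game) : 0 < M.d g := by
  have h := (M.payoff_game g).dominant M.player allC
  have e : Function.update (allC : Fin M.n → Act) M.player Act.C = allC :=
    Function.update_eq_self M.player allC
  rw [M.payoff_deviation, e, M.payoff_allC] at h
  linarith

theorem arrival_nonneg (t : Task) (o : Option Game) : 0 ≤ M.arrival t o := by
  cases o with
  | none => simpa [arrival] using M.a_le_one t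
  | some g => simp only [arrival]; split_ifs; exacts [(M.a_pos t).le, le_rfl]

variable {m : Assignment}

theorem rule_nonneg (s : State m.K) (t : Task) : 0 ≤ m.rule s t := (m.rule_mem s).1 t

theorem rule_sum (s : State m.K) : m.rule s Kind.G + m.rule s Kind.B = 1 := by
  have := (m.rule_mem s).2
  rwa [Kind.sum_univ] at this

theorem nextProb_nonneg (s : State m.K) (e : Task × Option Game) : 0 ≤ M.nextProb m s e :=
  mul_nonneg (rule_nonneg s _) (M.arrival_nonneg _ _)

theorem sum_nextProb_mul (s : State m.K) (f : Task × Option Game → ℝ) :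
    ∑ e, M.nextProb m s e * f e =
      m.rule s Kind.G * (M.a Kind.G * f (Kind.G, some Kind.G) +
        (1 - M.a Kind.G) * f (Kind.G, none)) +
      m.rule s Kind.B * (M.a Kind.B * f (Kind.B, some Kind.B) +
        (1 - M.a Kind.B) * f (Kind.B, none)) := by
  rw [Fintype.sum_prod_type, Kind.sum_univ]
  simp only [Fintype.sum_option, Kind.sum_univ, nextProb, arrival]
  simp
  ring

theorem sum_nextProb (s : State m.K) : ∑ e, M.nextProb m s e = 1 := by
  have := M.sum_nextProb_mul s (fun _ => 1)
  simp only [mul_one] at this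
  rw [this]
  linear_combination rule_sum s

theorem playProb_nonneg (σ : M.Profile m) (h : M.Hist m) (a : Fin M.n → Act) :
    0 ≤ M.playProb σ h a := by
  unfold playProb
  split
  · split_ifs <;> norm_num
  · refine Finset.prod_nonneg fun i _ => ?_
    split_ifs
    · exact (σ i h).2.1
    · linarith [(σ i h).2.2]

theorem playProb_none {σ : M.Profile m} {h : M.Hist m} (hg : h.game = none)
    (a : Fin M.n → Act) : M.playProb σ h a = if a = allN then 1 else 0 := by
  simp [playProb, hg]

theorem playProb_some {σ : M.Profile m} {h : M.Hist m} {g : Game} (hg : h.game = some g)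
    (a : Fin M.n → Act) : M.playProb σ h a =
      ∏ i, if a i = Act.C then (σ i h : ℝ) else 1 - (σ i h : ℝ) := by
  simp [playProb, hg]

theorem stagePayoff_none {h : M.Hist m} (hg : h.game = none) (i : Fin M.n)
    (a : Fin M.n → Act) : M.stagePayoff h i a = 0 := by
  simp [stagePayoff, hg]

theorem stagePayoff_some {h : M.Hist m} {g : Game} (hg : h.game = some g) (i : Fin M.n)
    (a : Fin M.n → Act) : M.stagePayoff h i a = M.payoff g i a := by
  simp [stagePayoff, hg]

theorem sum_playProb (σ : M.Profile m) (h : M.Hist m) : ∑ a, M.playProb σ h a = 1 := by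
  cases hg : h.game with
  | none => simp [M.playProb_none hg]
  | some g =>
    simp only [M.playProb_some hg]
    have := Finset.prod_univ_sum (fun _ : Fin M.n => (Finset.univ : Finset Act))
      (fun i x => if x = Act.C then (σ i h : ℝ) else 1 - (σ i h : ℝ))
    simp only [Fintype.piFinset_univ] at this
    rw [← this]
    refine Finset.prod_eq_one fun i _ => ?_
    simp [Act.sum_univ]

/-- Conditioning on the action of player `i`, when `σ` and `τ` agree for the other players. -/
theorem sum_playProb_split {σ τ : M.Profile m} {h : M.Hist m} {g : Game} (hg : h.game = some g)
    (i : Fin M.n) (hστ : ∀ j, j ≠ i → τ j h = σ j h) (φ : (Fin M.n → Act) → ℝ) :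
    ∑ a, M.playProb τ h a * φ a =
      (τ i h : ℝ) * ∑ a, M.playProb σ h a * φ (Function.update a i Act.C) +
      (1 - (τ i h : ℝ)) * ∑ a, M.playProb σ h a * φ (Function.update a i Act.N) := by
  simp only [M.playProb_some hg]
  set q : Fin M.n → Act → ℝ := fun j x => if x = Act.C then (σ j h : ℝ) else 1 - (σ j h : ℝ)
    with hq
  set q' : Fin M.n → Act → ℝ := fun j x => if x = Act.C then (τ j h : ℝ) else 1 - (τ j h : ℝ)
    with hq'
  have hqs : ∑ x, q i x = 1 := by simp [Act.sum_univ, hq]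
  have hw : ∀ (a : Fin M.n → Act) (x : Act),
      q' i x * ∏ j, q j (a j) = q i (a i) * ∏ j, q' j (Function.update a i x j) := by
    intro a x
    rw [← Finset.mul_prod_erase _ _ (Finset.mem_univ i),
      ← Finset.mul_prod_erase (a := i) Finset.univ (fun j => q' j (Function.update a i x j))
        (Finset.mem_univ i)]
    have : ∏ j ∈ Finset.univ.erase i, q' j (Function.update a i x j) =
        ∏ j ∈ Finset.univ.erase i, q j (a j) :=
      Finset.prod_congr rfl fun j hj => by
        have hne := Finset.ne_of_mem_erase hj
        rw [Function.update_of_ne hne]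
        simp only [hq, hq', hστ j hne]
    rw [this, Function.update_self]; ring
  -- Exchanging the `i`-th coordinate with an independent auxiliary action is an involution; by `hw`
  -- it turns weights under `τ` into weights under `σ`.
  let T : ((Fin M.n → Act) × Act) ≃ ((Fin M.n → Act) × Act) :=
    { toFun := fun p => (Function.update p.1 i p.2, p.1 i)
      invFun := fun p => (Function.update p.1 i p.2, p.1 i)
      left_inv := fun p => by simp
      right_inv := fun p => by simp }
  have key : ∑ p : (Fin M.n → Act) × Act, q i p.2 * ((∏ j, q' j (p.1 j)) * φ p.1) =
      ∑ p : (Fin M.n → Act) × Act, q' i p.2 *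
        ((∏ j, q j (p.1 j)) * φ (Function.update p.1 i p.2)) := by
    rw [← Equiv.sum_comp T]
    refine Finset.sum_congr rfl fun p _ => ?_
    have := hw p.1 p.2
    simp only [T, Equiv.coe_fn_mk]
    rw [← mul_assoc, ← this, mul_assoc]
  rw [Fintype.sum_prod_type, Fintype.sum_prod_type_right] at key
  simp only [← Finset.sum_mul, hqs, one_mul, Act.sum_univ, ← Finset.mul_sum] at key
  rw [key]
  simp [hq, hq']

/-- Expectation, at the history `h`, of a function of the next period's history. -/
def nextExp (σ : M.Profile m) (h : M.Hist m) (f : M.Hist m → ℝ) : ℝ :=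
  ∑ a, M.playProb σ h a * ∑ e, M.nextProb m h.state e * f (h.extend a e)

theorem exists_stagePayoff_bound (m : Assignment) : ∃ C : ℝ, 0 ≤ C ∧
    ∀ (h : M.Hist m) (i : Fin M.n) (a : Fin M.n → Act), |M.stagePayoff h i a| ≤ C := by
  refine ⟨∑ g, ∑ i, ∑ a, |M.payoff g i a|, by positivity, fun h i a => ?_⟩
  cases hg : h.game with
  | none => rw [M.stagePayoff_none hg, abs_zero]; positivity
  | some g =>
    rw [M.stagePayoff_some hg]
    calc |M.payoff g i a| ≤ ∑ a, |M.payoff g i a| :=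
          Finset.single_le_sum (f := fun a => |M.payoff g i a|)
            (fun _ _ => abs_nonneg _) (Finset.mem_univ a)
      _ ≤ ∑ i, ∑ a, |M.payoff g i a| :=
          Finset.single_le_sum (f := fun i => ∑ a, |M.payoff g i a|)
            (fun _ _ => by positivity) (Finset.mem_univ i)
      _ ≤ _ := Finset.single_le_sum (f := fun g => ∑ i, ∑ a, |M.payoff g i a|)
            (fun _ _ => by positivity) (Finset.mem_univ g)

theorem abs_weighted_sum_le {ι : Type*} (t : Finset ι) (p f : ι → ℝ) {C : ℝ}
    (hp : ∀ i ∈ t, 0 ≤ p i) (hs : ∑ i ∈ t, p i = 1) (hf : ∀ i ∈ t, |f i| ≤ C) :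
    |∑ i ∈ t, p i * f i| ≤ C := by
  calc |∑ i ∈ t, p i * f i| ≤ ∑ i ∈ t, |p i * f i| := Finset.abs_sum_le_sum_abs _ _
    _ ≤ ∑ i ∈ t, p i * C := Finset.sum_le_sum fun i hi => by
        rw [abs_mul, abs_of_nonneg (hp i hi)]
        exact mul_le_mul_of_nonneg_left (hf i hi) (hp i hi)
    _ = C := by rw [← Finset.sum_mul, hs, one_mul]

theorem abs_nextExp_le (σ : M.Profile m) (h : M.Hist m) (f : M.Hist m → ℝ) {C : ℝ}
    (hf : ∀ h, |f h| ≤ C) : |M.nextExp σ h f| ≤ C :=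
  abs_weighted_sum_le _ _ _ (fun _ _ => M.playProb_nonneg _ _ _) (M.sum_playProb σ h) fun _ _ =>
    abs_weighted_sum_le _ _ _ (fun _ _ => M.nextProb_nonneg _ _) (M.sum_nextProb _) fun _ _ =>
      hf _

theorem abs_expPayoff_le {C : ℝ}
    (hC : ∀ (h : M.Hist m) (i : Fin M.n) (a : Fin M.n → Act), |M.stagePayoff h i a| ≤ C)
    (σ : M.Profile m) (i : Fin M.n) (k : ℕ) : ∀ h, |M.expPayoff σ i k h| ≤ C := by
  induction k with
  | zero =>
    exact fun h => abs_weighted_sum_le _ _ _ (fun _ _ => M.playProb_nonneg _ _ _)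
      (M.sum_playProb σ h) fun _ _ => hC _ _ _
  | succ k ih => exact fun h => M.abs_nextExp_le σ h _ ih

theorem discount_nonneg {r : ℝ} (hr : r ∈ Set.Icc (0 : ℝ) 1) : 0 ≤ (1 - r) * M.δ :=
  mul_nonneg (by linarith [hr.2]) M.δ_pos.le

theorem discount_le {r : ℝ} (hr : r ∈ Set.Icc (0 : ℝ) 1) : (1 - r) * M.δ ≤ M.δ := by
  nlinarith [hr.1, M.δ_pos]

theorem discount_lt_one {r : ℝ} (hr : r ∈ Set.Icc (0 : ℝ) 1) : (1 - r) * M.δ < 1 :=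
  (M.discount_le hr).trans_lt M.δ_lt_one

theorem summable_value {r : ℝ} (hr : r ∈ Set.Icc (0 : ℝ) 1) (σ : M.Profile m) (i : Fin M.n)
    (h : M.Hist m) : Summable fun k => ((1 - r) * M.δ) ^ k * M.expPayoff σ i k h := by
  obtain ⟨C, -, hC⟩ := M.exists_stagePayoff_bound m
  refine Summable.of_norm_bounded
    ((summable_geometric_of_lt_one (M.discount_nonneg hr) (M.discount_lt_one hr)).mul_right C) ?_
  intro k
  rw [norm_mul, Real.norm_eq_abs, Real.norm_eq_abs,
    abs_of_nonneg (pow_nonneg (M.discount_nonneg hr) k)]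
  exact mul_le_mul_of_nonneg_left (M.abs_expPayoff_le hC σ i k h)
    (pow_nonneg (M.discount_nonneg hr) k)

theorem exists_value_bound {r : ℝ} (hr : r ∈ Set.Icc (0 : ℝ) 1) (σ : M.Profile m)
    (i : Fin M.n) : ∃ C : ℝ, ∀ h, |M.value r σ i h| ≤ C := by
  obtain ⟨C, -, hC⟩ := M.exists_stagePayoff_bound m
  refine ⟨(1 - (1 - r) * M.δ)⁻¹ * C, fun h => ?_⟩
  refine tsum_of_norm_bounded (f := fun k => ((1 - r) * M.δ) ^ k * M.expPayoff σ i k h)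
    ((hasSum_geometric_of_lt_one (M.discount_nonneg hr) (M.discount_lt_one hr)).mul_right C) ?_
  intro k
  rw [norm_mul, Real.norm_eq_abs, Real.norm_eq_abs,
    abs_of_nonneg (pow_nonneg (M.discount_nonneg hr) k)]
  exact mul_le_mul_of_nonneg_left (M.abs_expPayoff_le hC σ i k h)
    (pow_nonneg (M.discount_nonneg hr) k)

/-- The Bellman equation. -/
theorem value_eq {r : ℝ} (hr : r ∈ Set.Icc (0 : ℝ) 1) (σ : M.Profile m) (i : Fin M.n)
    (h : M.Hist m) : M.value r σ i h =
      ∑ a, M.playProb σ h a * M.stagePayoff h i a +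
        (1 - r) * M.δ * M.nextExp σ h (M.value r σ i) := by
  have hs : ∀ h, HasSum (fun k => ((1 - r) * M.δ) ^ k * M.expPayoff σ i k h)
      (M.value r σ i h) := fun h => (M.summable_value hr σ i h).hasSum
  have h0 : HasSum (fun k => ∑ a, M.playProb σ h a * ∑ e, M.nextProb m h.state e *
      (((1 - r) * M.δ) ^ k * M.expPayoff σ i k (h.extend a e)))
      (M.nextExp σ h (M.value r σ i)) :=
    hasSum_sum fun a _ => (hasSum_sum fun e _ => (hs _).mul_left _).mul_left _
  have h1 : HasSum (fun k => ((1 - r) * M.δ) ^ (k + 1) * M.expPayoff σ i (k + 1) h)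
      ((1 - r) * M.δ * M.nextExp σ h (M.value r σ i)) := by
    have e : (fun k => ((1 - r) * M.δ) ^ (k + 1) * M.expPayoff σ i (k + 1) h) = fun k =>
        (1 - r) * M.δ * ∑ a, M.playProb σ h a * ∑ e, M.nextProb m h.state e *
          (((1 - r) * M.δ) ^ k * M.expPayoff σ i k (h.extend a e)) := by
      funext k
      simp only [expPayoff, Finset.mul_sum]
      refine Finset.sum_congr rfl fun a _ => Finset.sum_congr rfl fun e _ => ?_
      ring
    rw [e]
    exact h0.mul_left _
  have h2 : M.value r σ i h = _ := (M.summable_value hr σ i h).tsum_eq_zero_add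
  rw [h2, h1.tsum_eq, pow_zero, one_mul, expPayoff]

theorem nextExp_mono_on {σ : M.Profile m} {h : M.Hist m} {f f' : M.Hist m → ℝ}
    (hff : ∀ a e, 0 < M.playProb σ h a → 0 < M.nextProb m h.state e →
      f (h.extend a e) ≤ f' (h.extend a e)) : M.nextExp σ h f ≤ M.nextExp σ h f' := by
  refine Finset.sum_le_sum fun a _ => ?_
  rcases (M.playProb_nonneg σ h a).eq_or_lt with ha | ha
  · simp [← ha]
  refine mul_le_mul_of_nonneg_left (Finset.sum_le_sum fun e _ => ?_) ha.le
  rcases (M.nextProb_nonneg (m := m) h.state e).eq_or_lt with he | he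
  · simp [← he]
  exact mul_le_mul_of_nonneg_left (hff a e ha he) he.le

theorem nextExp_const (σ : M.Profile m) (h : M.Hist m) (C : ℝ) :
    M.nextExp σ h (fun _ => C) = C := by
  simp [nextExp, ← Finset.sum_mul, M.sum_nextProb, M.sum_playProb]

theorem nextExp_sub (σ : M.Profile m) (h : M.Hist m) (f f' : M.Hist m → ℝ) :
    M.nextExp σ h (fun h => f h - f' h) = M.nextExp σ h f - M.nextExp σ h f' := by
  simp [nextExp, mul_sub, Finset.sum_sub_distrib]

theorem nextExp_sum {ι : Type*} (t : Finset ι) (σ : M.Profile m) (h : M.Hist m)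
    (f : ι → M.Hist m → ℝ) :
    M.nextExp σ h (fun h => ∑ i ∈ t, f i h) = ∑ i ∈ t, M.nextExp σ h (f i) := by
  simp only [nextExp, Finset.mul_sum]
  rw [Finset.sum_comm]
  conv_rhs => rw [Finset.sum_comm]
  rw [Finset.sum_comm]
  refine Finset.sum_congr rfl fun a _ => ?_
  rw [Finset.sum_comm]

theorem nextExp_of_pure {σ : M.Profile m} {h : M.Hist m} {a₀ : Fin M.n → Act}
    (hp : ∀ a, M.playProb σ h a = if a = a₀ then 1 else 0) (f : M.Hist m → ℝ) :
    M.nextExp σ h f = ∑ e, M.nextProb m h.state e * f (h.extend a₀ e) := by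
  simp [nextExp, hp]

theorem stage_of_pure {σ : M.Profile m} {h : M.Hist m} {a₀ : Fin M.n → Act}
    (hp : ∀ a, M.playProb σ h a = if a = a₀ then 1 else 0) (i : Fin M.n) :
    ∑ a, M.playProb σ h a * M.stagePayoff h i a = M.stagePayoff h i a₀ := by
  simp [hp]

/-- A bounded function that is at most its discounted expectation is nonpositive. -/
theorem nonpos_of_le_discount_nextExp {β : ℝ} (hβ : 0 ≤ β) (hβ1 : β < 1) {σ : M.Profile m}
    {P : M.Hist m → Prop}
    (hP : ∀ h a e, P h → 0 < M.playProb σ h a → 0 < M.nextProb m h.state e → P (h.extend a e))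
    {f : M.Hist m → ℝ} {C : ℝ} (hC : ∀ h, P h → f h ≤ C)
    (hf : ∀ h, P h → f h ≤ β * M.nextExp σ h f) : ∀ h, P h → f h ≤ 0 := by
  have key : ∀ k : ℕ, ∀ h, P h → f h ≤ β ^ k * C := by
    intro k
    induction k with
    | zero => simpa using hC
    | succ k ih =>
      intro h hh
      refine (hf h hh).trans ?_
      rw [pow_succ', mul_assoc]
      refine mul_le_mul_of_nonneg_left ?_ hβ
      rw [← M.nextExp_const σ h (β ^ k * C)]
      exact M.nextExp_mono_on fun a e ha he => ih _ (hP h a e hh ha he)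
  intro h hh
  have ht : Filter.Tendsto (fun k : ℕ => β ^ k * C) Filter.atTop (nhds 0) := by
    simpa using (tendsto_pow_atTop_nhds_zero_of_lt_one hβ hβ1).mul_const C
  exact ge_of_tendsto' ht fun k => key k h hh

/-- Existence of discounted values for a flow payoff that depends on the state. -/
theorem exists_discounted (m : Assignment) {β : ℝ} (hβ : 0 ≤ β) (hβ1 : β < 1)
    (u : State m.K → ℝ) : ∃ w : State m.K → ℝ,
      ∀ s, w s = u s + β * ∑ e, M.nextProb m s e * w (s.push e) := by
  let T : (State m.K → ℝ) → (State m.K → ℝ) := fun w s =>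
    u s + β * ∑ e, M.nextProb m s e * w (s.push e)
  have hT : ContractingWith ⟨β, hβ⟩ T := by
    refine ⟨by exact_mod_cast hβ1, LipschitzWith.of_dist_le_mul fun w w' => ?_⟩
    refine (dist_pi_le_iff (mul_nonneg hβ dist_nonneg)).2 fun s => ?_
    have : T w s - T w' s = β * ∑ e, M.nextProb m s e * (w (s.push e) - w' (s.push e)) := by
      simp only [T, mul_sub, Finset.sum_sub_distrib]; ring
    rw [Real.dist_eq, this, abs_mul, abs_of_nonneg hβ]
    refine mul_le_mul_of_nonneg_left ?_ hβ
    refine abs_weighted_sum_le _ _ _ (fun _ _ => M.nextProb_nonneg _ _) (M.sum_nextProb _)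
      fun e _ => ?_
    rw [← Real.dist_eq]
    exact dist_le_pi_dist w w' _
  refine ⟨hT.fixedPoint, fun s => ?_⟩
  exact (congrFun hT.fixedPoint_isFixedPt s).symm

end Model

/-! ### Autarky, full cooperation and incentive constraints. -/

namespace Model

variable (M : Model) {m : Assignment}

/-- `w` is the discounted value of the flow payoff `u`. -/
def IsDiscounted (m : Assignment) (β : ℝ) (u w : State m.K → ℝ) : Prop :=
  ∀ s, w s = u s + β * ∑ e, M.nextProb m s e * w (s.push e)

theorem playProb_pure {σ : M.Profile m} {h : M.Hist m} {g : Game} (hg : h.game = some g)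
    {a₀ : Fin M.n → Act} (hσ : ∀ i, (σ i h : ℝ) = if a₀ i = Act.C then 1 else 0)
    (a : Fin M.n → Act) : M.playProb σ h a = if a = a₀ then 1 else 0 := by
  rw [M.playProb_some hg]
  split_ifs with ha
  · subst ha
    refine Finset.prod_eq_one fun i _ => ?_
    rw [hσ i]
    split_ifs <;> norm_num
  · obtain ⟨i, hi⟩ := Function.ne_iff.1 ha
    refine Finset.prod_eq_zero (Finset.mem_univ i) ?_
    rw [hσ i]
    cases h1 : a i <;> cases h2 : a₀ i <;> simp_all

theorem playProb_of_none {σ : M.Profile m} {h : M.Hist m} (hg : h.game = none) :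
    ∀ a, M.playProb σ h a = if a = allN then 1 else 0 :=
  M.playProb_none hg

theorem playProb_of_allC {σ : M.Profile m} {h : M.Hist m} {g : Game} (hg : h.game = some g)
    (hσ : ∀ i, σ i h = 1) : ∀ a, M.playProb σ h a = if a = allC then 1 else 0 :=
  M.playProb_pure hg fun i => by simp [hσ i, allC]

theorem playProb_update_pos {σ : M.Profile m} {h : M.Hist m} {g : Game} (hg : h.game = some g)
    {i : Fin M.n} (hσ : σ i h = 0) {a : Fin M.n → Act} (ha : 0 < M.playProb σ h a) :
    a i = Act.N := by
  by_contra hne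
  have hC : a i = Act.C := by
    by_contra h'; exact hne (Act.eq_N_of_ne_C h')
  rw [M.playProb_some hg] at ha
  refine ha.ne' (Finset.prod_eq_zero (Finset.mem_univ i) ?_)
  simp [hC, hσ]

theorem nextExp_state (σ : M.Profile m) (h : M.Hist m) (W : State m.K → ℝ) :
    M.nextExp σ h (fun h => W h.state) = ∑ e, M.nextProb m h.state e * W (h.state.push e) := by
  change ∑ a, M.playProb σ h a * ∑ e, M.nextProb m h.state e * W (h.state.push e) = _
  rw [← Finset.sum_mul, M.sum_playProb, one_mul]

/-- A player who never cooperates gets at least the payoff of full non-cooperation. -/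
theorem autarky_le_value {r : ℝ} (hr : r ∈ Set.Icc (0 : ℝ) 1) {A : State m.K → ℝ}
    (hA : M.IsDiscounted m ((1 - r) * M.δ) (fun s => M.autarky (m.game s)) A)
    {σ : M.Profile m} {i : Fin M.n} (hσ : ∀ h, σ i h = 0) (h : M.Hist m) :
    A h.state ≤ M.value r σ i h := by
  obtain ⟨C, hC⟩ := M.exists_value_bound hr σ i
  obtain ⟨C', hC'⟩ := (Set.finite_range A).bddAbove
  have key := M.nonpos_of_le_discount_nextExp (M.discount_nonneg hr) (M.discount_lt_one hr)
    (σ := σ) (P := fun _ => True) (fun _ _ _ _ _ _ => trivial)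
    (f := fun h => A h.state - M.value r σ i h) (C := C' + C) ?_ ?_ h trivial
  · linarith
  · intro h _
    have h1 := hC' ⟨h.state, rfl⟩
    have h2 := neg_le_of_abs_le (hC h)
    linarith
  · intro h _
    rw [M.nextExp_sub, M.value_eq hr σ i h, hA h.state]
    have e1 := M.nextExp_state σ h A
    rw [e1]
    have e2 : M.autarky (m.game h.state) ≤ ∑ a, M.playProb σ h a * M.stagePayoff h i a := by
      rw [← one_mul (M.autarky _), ← M.sum_playProb σ h, Finset.sum_mul]
      refine Finset.sum_le_sum fun a _ => ?_
      rcases (M.playProb_nonneg σ h a).eq_or_lt with ha | ha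
      · simp [← ha]
      refine mul_le_mul_of_nonneg_left ?_ ha.le
      cases hg : h.game with
      | none =>
        rw [M.stagePayoff_none hg]
        change M.autarky h.game ≤ 0
        rw [hg]; rfl
      | some g =>
        rw [M.stagePayoff_some hg]
        change M.autarky h.game ≤ _
        rw [hg]
        exact M.payoff_N_ge g i a (M.playProb_update_pos hg (hσ h) ha)
    linarith

theorem OnPath.extend {μ : State m.K → ℝ} {σ : M.Profile m} {h : M.Hist m}
    (hh : M.OnPath μ σ h) {a : Fin M.n → Act} {e : Task × Option Game}
    (ha : 0 < M.playProb σ h a) (he : 0 < M.nextProb m h.state e) :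
    M.OnPath μ σ (h.extend a e) :=
  ⟨hh, ha, he⟩

/-- If expected stage payoffs depend only on the state, then so do values. -/
theorem value_of_stage {r : ℝ} (hr : r ∈ Set.Icc (0 : ℝ) 1) {u W : State m.K → ℝ}
    (hW : M.IsDiscounted m ((1 - r) * M.δ) u W) {σ : M.Profile m} {P : M.Hist m → Prop}
    (hP : ∀ h a e, P h → 0 < M.playProb σ h a → 0 < M.nextProb m h.state e → P (h.extend a e))
    {i : Fin M.n}
    (hu : ∀ h, P h → ∑ a, M.playProb σ h a * M.stagePayoff h i a = u h.state) {h : M.Hist m}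
    (hh : P h) : M.value r σ i h = W h.state := by
  obtain ⟨C, hC⟩ := M.exists_value_bound hr σ i
  obtain ⟨C₁, hC₁⟩ := (Set.finite_range fun s => |W s|).bddAbove
  -- The error solves the Bellman equation with zero flow, so the discounting argument bounds both
  -- it and its negative.
  have hstep : ∀ h, P h → M.value r σ i h - W h.state =
      (1 - r) * M.δ * M.nextExp σ h (fun h => M.value r σ i h - W h.state) := by
    intro h hh
    rw [M.nextExp_sub, M.value_eq hr σ i h, hW h.state, M.nextExp_state, hu h hh]
    ring
  have bound : ∀ h, |M.value r σ i h - W h.state| ≤ C + C₁ := by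
    intro h
    have h1 := hC₁ ⟨h.state, rfl⟩
    exact (abs_sub _ _).trans (add_le_add (hC h) h1)
  have up := M.nonpos_of_le_discount_nextExp (M.discount_nonneg hr) (M.discount_lt_one hr) hP
    (fun h _ => (le_abs_self _).trans (bound h)) (fun h hh => (hstep h hh).le) h hh
  have lo := M.nonpos_of_le_discount_nextExp (M.discount_nonneg hr) (M.discount_lt_one hr) hP
    (f := fun h => W h.state - M.value r σ i h)
    (fun h _ => ((le_abs_self _).trans (abs_sub_comm _ _).le).trans (bound h)) (fun h hh => by
      have := hstep h hh
      rw [M.nextExp_sub] at this ⊢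
      linarith) h hh
  linarith

theorem IsDiscounted.add {β : ℝ} {u u' W W' : State m.K → ℝ} (h : M.IsDiscounted m β u W)
    (h' : M.IsDiscounted m β u' W') :
    M.IsDiscounted m β (fun s => u s + u' s) (fun s => W s + W' s) := by
  intro s
  simp only [mul_add, Finset.sum_add_distrib]
  linear_combination h s + h' s

/-- Along full cooperation, payoffs are those of autarky plus the gains from cooperation. -/
theorem value_of_cooperation {r : ℝ} (hr : r ∈ Set.Icc (0 : ℝ) 1) {A J : State m.K → ℝ}
    (hA : M.IsDiscounted m ((1 - r) * M.δ) (fun s => M.autarky (m.game s)) A)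
    (hJ : M.IsDiscounted m ((1 - r) * M.δ) (fun s => M.gain (m.game s)) J)
    {σ : M.Profile m} {P : M.Hist m → Prop}
    (hP : ∀ h a e, P h → 0 < M.playProb σ h a → 0 < M.nextProb m h.state e → P (h.extend a e))
    (hσ : ∀ h, P h → h.game ≠ none → ∀ i, σ i h = 1) (i : Fin M.n) {h : M.Hist m} (hh : P h) :
    M.value r σ i h = A h.state + J h.state := by
  refine M.value_of_stage hr (hA.add M hJ) hP (fun h hh => ?_) hh
  change _ = M.autarky h.game + M.gain h.game
  cases hg : h.game with
  | none => rw [M.stage_of_pure (M.playProb_of_none hg), M.stagePayoff_none hg]; simp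
  | some g =>
    rw [M.stage_of_pure (M.playProb_of_allC hg (hσ h hh (by simp [hg]))),
      M.stagePayoff_some hg, M.payoff_allC]; rfl

/-- Continuation excess value of full cooperation. -/
def continuation (m : Assignment) (β : ℝ) (J : State m.K → ℝ) (s : State m.K) : ℝ :=
  β * ∑ e, M.nextProb m s e * J (s.push e)

theorem value_deviation {r : ℝ} (hr : r ∈ Set.Icc (0 : ℝ) 1)
    {τ : M.Profile m} {i : Fin M.n} {h : M.Hist m} {g : Game} (hg : h.game = some g)
    (hτ : τ i h = 0) (hτ' : ∀ j, j ≠ i → τ j h = 1) :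
    M.value r τ i h = M.payoff g M.player allN + M.c g + M.d g +
      (1 - r) * M.δ * ∑ e, M.nextProb m h.state e *
        M.value r τ i (h.extend (Function.update allC i Act.N) e) := by
  have hp : ∀ a, M.playProb τ h a = if a = Function.update allC i Act.N then 1 else 0 := by
    refine M.playProb_pure hg fun j => ?_
    by_cases hj : j = i
    · subst hj; simp [hτ]
    · simp [hτ' j hj, hj, allC]
  rw [M.value_eq hr, M.stage_of_pure hp, M.nextExp_of_pure hp, M.stagePayoff_some hg,
    M.payoff_deviation]

/-- Incentive compatibility of cooperation in a subgame-perfect equilibrium that prescribes it. -/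
theorem IsSPE.temptation_le {r : ℝ} (hr : r ∈ Set.Icc (0 : ℝ) 1) {A J : State m.K → ℝ}
    (hA : M.IsDiscounted m ((1 - r) * M.δ) (fun s => M.autarky (m.game s)) A)
    (hJ : M.IsDiscounted m ((1 - r) * M.δ) (fun s => M.gain (m.game s)) J)
    {μ : State m.K → ℝ} {σ : M.Profile m} (hσ : M.IsSPE r σ)
    (hc : ∀ h, M.OnPath μ σ h → h.game ≠ none → ∀ i, σ i h = 1)
    {h : M.Hist m} (hh : M.OnPath μ σ h) {g : Game} (hg : h.game = some g) :
    M.d g ≤ M.continuation m ((1 - r) * M.δ) J h.state := by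
  set i := M.player
  -- The deviation is to stop cooperating forever: it collects the temptation now and at least
  -- autarky afterwards.
  have h1 := hσ h i (fun _ => 0)
  rw [M.value_of_cooperation hr hA hJ (P := M.OnPath μ σ)
    (fun h a e hh ha he => OnPath.extend M hh ha he) hc i hh] at h1
  rw [M.value_deviation hr hg (by simp) (fun j hj => by
    rw [Function.update_of_ne hj]; exact hc h hh (by simp [hg]) j)] at h1
  have h2 : ∑ e, M.nextProb m h.state e * A (h.state.push e) ≤
      ∑ e, M.nextProb m h.state e * M.value r (Function.update σ i fun _ => 0) i
        (h.extend (Function.update allC i Act.N) e) :=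
    Finset.sum_le_sum fun e _ => mul_le_mul_of_nonneg_left
      (M.autarky_le_value hr hA (σ := Function.update σ i fun _ => 0) (i := i) (fun _ => by simp)
        (h.extend _ e)) (M.nextProb_nonneg _ _)
  have h3 := mul_le_mul_of_nonneg_left h2 (M.discount_nonneg hr)
  have hA' := hA h.state
  have hJ' := hJ h.state
  change _ = M.autarky h.game + _ at hA'
  change _ = M.gain h.game + _ at hJ'
  rw [hg, autarky_some] at hA'
  rw [hg, gain_some] at hJ'
  unfold continuation
  linarith

/-- Values depend only on the play that lies ahead. -/
theorem value_congr_of_length {r : ℝ} (hr : r ∈ Set.Icc (0 : ℝ) 1) {σ τ : M.Profile m} {L : ℕ}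
    (hστ : ∀ h : M.Hist m, L ≤ h.2.length → ∀ j, σ j h = τ j h) (i : Fin M.n) :
    ∀ h : M.Hist m, L ≤ h.2.length → M.value r σ i h ≤ M.value r τ i h := by
  intro h hh
  obtain ⟨C, hC⟩ := M.exists_value_bound hr σ i
  obtain ⟨C', hC'⟩ := M.exists_value_bound hr τ i
  have hplay : ∀ h : M.Hist m, L ≤ h.2.length → M.playProb σ h = M.playProb τ h := by
    intro h hh
    funext a
    simp only [playProb, hστ h hh]
  have := M.nonpos_of_le_discount_nextExp (M.discount_nonneg hr) (M.discount_lt_one hr)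
    (σ := σ) (P := fun h : M.Hist m => L ≤ h.2.length)
    (fun h a e hh _ _ => hh.trans (Nat.le_succ _))
    (f := fun h => M.value r σ i h - M.value r τ i h) (C := C + C')
    (fun h _ => (le_abs_self _).trans ((abs_sub _ _).trans (add_le_add (hC h) (hC' h))))
    (fun h hh => by
      rw [M.nextExp_sub, M.value_eq hr σ i h, M.value_eq hr τ i h]
      simp only [nextExp, hplay h hh]
      linarith) h hh
  linarith

/-- If the incentive constraint of cooperation binds at all good games, players are indifferent
there. -/
theorem indifferentInGood_of_binding {r : ℝ} (hr : r ∈ Set.Icc (0 : ℝ) 1) {A J : State m.K → ℝ}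
    (hA : M.IsDiscounted m ((1 - r) * M.δ) (fun s => M.autarky (m.game s)) A)
    (hJ : M.IsDiscounted m ((1 - r) * M.δ) (fun s => M.gain (m.game s)) J)
    {μ : State m.K → ℝ} (hm : M.FullyCooperative m r μ)
    (hbind : ∀ σ : M.Profile m, ∀ h, M.OnPath μ σ h → h.game = some Kind.G →
      M.continuation m ((1 - r) * M.δ) J h.state = M.d Kind.G) :
    M.IndifferentInGood m r μ := by
  intro σ hσ h hh hg i
  have hc := hm.2 σ hσ
  have hone : Function.update (σ i) h 1 = σ i := by
    rw [← hc h hh (by simp [hg]) i, Function.update_eq_self]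
  rw [hone, Function.update_eq_self]
  set τ := Function.update σ i (Function.update (σ i) h 0) with hτ
  refine le_antisymm ?_ (hσ.1 h i _)
  have hA' := hA h.state
  have hJ' := hJ h.state
  change _ = M.autarky h.game + _ at hA'
  change _ = M.gain h.game + _ at hJ'
  rw [hg, autarky_some] at hA'
  rw [hg, gain_some] at hJ'
  have hb := hbind σ h hh hg
  unfold continuation at hb
  rw [M.value_of_cooperation hr hA hJ (P := M.OnPath μ σ)
    (fun h a e hh ha he => OnPath.extend M hh ha he) hc i hh,
    M.value_deviation hr hg (τ := τ) (i := i) (by simp [hτ]) (fun j hj => by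
      rw [hτ, Function.update_of_ne hj]; exact hc h hh (by simp [hg]) j)]
  -- After the one-shot deviation play returns to `σ`, which is worth at least autarky by subgame
  -- perfection. The modification at `h` does not matter there, since all later histories are longer
  -- than `h`.
  have h2 : ∑ e, M.nextProb m h.state e * A (h.state.push e) ≤
      ∑ e, M.nextProb m h.state e * M.value r τ i
        (h.extend (Function.update allC i Act.N) e) := by
    refine Finset.sum_le_sum fun e _ => mul_le_mul_of_nonneg_left ?_ (M.nextProb_nonneg _ _)
    set h' := h.extend (Function.update allC i Act.N) e with hh'
    calc A (h.state.push e) ≤ M.value r (Function.update σ i fun _ => 0) i h' :=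
          M.autarky_le_value hr hA (fun _ => by simp) h'
      _ ≤ M.value r σ i h' := hσ.1 h' i _
      _ ≤ M.value r τ i h' := by
          refine M.value_congr_of_length hr (L := h.2.length + 1) ?_ i h' le_rfl
          intro h'' hlen j
          by_cases hj : j = i
          · subst hj
            have : h'' ≠ h := fun e => by subst e; omega
            simp [hτ, this]
          · simp [hτ, hj]
  have h3 := mul_le_mul_of_nonneg_left h2 (M.discount_nonneg hr)
  linarith

/-- Teams that are reshuffled in every period do not cooperate. -/
theorem fullyNonCooperative_one (m : Assignment) (μ : State m.K → ℝ) :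
    M.FullyNonCooperative m 1 μ := by
  have hr : (1 : ℝ) ∈ Set.Icc (0 : ℝ) 1 := ⟨zero_le_one, le_rfl⟩
  -- At rate 1 the discount factor is zero, so each game is effectively one-shot and dominance
  -- settles it.
  have hval : ∀ (σ : M.Profile m) i h, M.value 1 σ i h =
      ∑ a, M.playProb σ h a * M.stagePayoff h i a := by
    intro σ i h; rw [M.value_eq hr]; ring
  have hzero : ∀ σ : M.Profile m, (∀ h : M.Hist m, h.game ≠ none → ∀ i, σ i h = 0) →
      ∀ i h, M.value 1 σ i h = M.autarky h.game := by
    intro σ hσ i h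
    rw [hval]
    cases hg : h.game with
    | none => rw [M.stage_of_pure (M.playProb_of_none hg), M.stagePayoff_none hg]; rfl
    | some g =>
      rw [M.stage_of_pure (M.playProb_pure hg (a₀ := allN) fun i => by
        simp [hσ h (by simp [hg]) i, allN]), M.stagePayoff_some hg, M.payoff_allN]; rfl
  have hSPE : ∀ σ : M.Profile m, M.IsSPE 1 σ →
      ∀ h : M.Hist m, h.game ≠ none → ∀ i, σ i h = 0 := by
    intro σ hσ h hne i
    obtain ⟨g, hg⟩ := Option.ne_none_iff_exists'.1 hne
    have h1 := hσ h i (Function.update (σ i) h 0)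
    have e1 := M.sum_playProb_split (σ := σ)
      (τ := Function.update σ i (Function.update (σ i) h 0)) hg i
      (fun j hj => by rw [Function.update_of_ne hj]) (M.payoff g i)
    have e2 := M.sum_playProb_split (σ := σ) (τ := σ) hg i (fun _ _ => rfl) (M.payoff g i)
    rw [hval, hval] at h1
    simp only [M.stagePayoff_some hg] at h1
    rw [e1, e2] at h1
    simp only [Function.update_self] at h1
    have hlt : ∑ a, M.playProb σ h a * M.payoff g i (Function.update a i Act.C) <
        ∑ a, M.playProb σ h a * M.payoff g i (Function.update a i Act.N) := by
      refine Finset.sum_lt_sum (fun a _ => mul_le_mul_of_nonneg_left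
        ((M.payoff_game g).dominant i a).le (M.playProb_nonneg _ _ _)) ?_
      by_contra! hcon
      have : ∑ a, M.playProb σ h a = 0 := Finset.sum_eq_zero fun a ha => by
        have h2 := hcon a ha
        have h3 := (M.payoff_game g).dominant i a
        have h4 := M.playProb_nonneg σ h a
        nlinarith
      rw [M.sum_playProb] at this
      exact one_ne_zero this
    have h0 := (σ i h).2.1
    have : ((σ i h : unitInterval) : ℝ) = 0 := by
      rw [Set.Icc.coe_zero] at h1
      nlinarith
    exact Subtype.ext this
  have hex : M.IsPlayerOptimal 1 μ (fun (_ : Fin M.n) (_ : M.Hist m) => 0) := by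
    refine ⟨fun h i ρ => ?_, fun σ' hσ' => le_of_eq ?_⟩
    · rw [hzero _ (fun _ _ _ => rfl), hval]
      cases hg : h.game with
      | none => rw [M.stage_of_pure (M.playProb_of_none hg), M.stagePayoff_none hg]; rfl
      | some g =>
        have hp := M.playProb_pure (σ := fun (_ : Fin M.n) (_ : M.Hist m) => 0) hg (a₀ := allN)
          fun i => by simp [allN]
        rw [M.sum_playProb_split (σ := fun (_ : Fin M.n) (_ : M.Hist m) => 0) hg i
          (fun j hj => by rw [Function.update_of_ne hj])]
        simp only [hp, M.stagePayoff_some hg, ite_mul, one_mul, zero_mul, Finset.sum_ite_eq',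
          Finset.mem_univ, if_true, Function.update_self, autarky_some]
        have h1 := (M.payoff_game g).dominant i allN
        have h2 : Function.update (allN : Fin M.n → Act) i Act.N = allN :=
          Function.update_eq_self i allN
        rw [h2, M.payoff_allN] at h1
        rw [h2, M.payoff_allN]
        nlinarith [(ρ h).2.1]
    · unfold welfare
      simp only [hzero σ' (hSPE σ' hσ')]
      simp only [hzero (fun (_ : Fin M.n) (_ : M.Hist m) => 0) (fun _ _ _ => rfl)]
  exact ⟨⟨_, hex⟩, fun σ hσ h _ hne i => hSPE σ hσ.1 h hne i⟩

end Model

/-! ### Thresholds and the potential. -/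

namespace Model

variable (M : Model)

/-- Continuation value of a team that stays on the good task until a good game is played and whose
continuation value after the good game is `d_G`. -/
noncomputable def goodValue : ℝ :=
  M.δ * M.a Kind.G * (M.c Kind.G + M.d Kind.G) / (1 - M.δ * (1 - M.a Kind.G))

/-- Continuation value of `k` periods on the bad task before the good task. -/
noncomputable def threshold : ℕ → ℝ
  | 0 => M.goodValue
  | k + 1 => M.δ * (M.a Kind.B * M.c Kind.B + threshold k)

/-- Length of the first linearity interval of the potential. -/
noncomputable def gap : ℝ := M.threshold 1 - M.threshold 0

/-- The affine function that is `k` at the `k`-th threshold and `k + 1` at the next one. -/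
noncomputable def chord (k : ℕ) (w : ℝ) : ℝ := k + (w - M.threshold k) / (M.gap * M.δ ^ k)

/-- Least expected number of periods on the bad task by which a team with continuation value `w`
reaches the continuation value `M.goodValue`, for `w` up to the threshold `N + 1`. -/
noncomputable def potential : ℕ → ℝ → ℝ
  | 0, w => max 0 (M.chord 0 w)
  | k + 1, w => max (potential k w) (M.chord (k + 1) w)

theorem goodValue_denom_pos : 0 < 1 - M.δ * (1 - M.a Kind.G) := by
  nlinarith [M.δ_pos, M.δ_lt_one, M.a_pos Kind.G, M.a_le_one Kind.G,
    mul_pos M.δ_pos (M.a_pos Kind.G)]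

theorem goodValue_eq : M.goodValue =
    M.δ * (M.a Kind.G * (M.c Kind.G + M.d Kind.G) + (1 - M.a Kind.G) * M.goodValue) := by
  have h := M.goodValue_denom_pos
  have : M.goodValue * (1 - M.δ * (1 - M.a Kind.G)) =
      M.δ * M.a Kind.G * (M.c Kind.G + M.d Kind.G) := by
    unfold goodValue; field_simp
  linarith

/-- Waiting for a promise of `d_G` is worth less than `d_G` exactly when `d_G` exceeds the value of
permanent cooperation on the good task. -/
theorem goodValue_lt
    (hG : M.d Kind.G > M.δ / (1 - M.δ) * M.a Kind.G * M.c Kind.G) :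
    M.goodValue < M.d Kind.G := by
  have h1 : 0 < 1 - M.δ := by linarith [M.δ_lt_one]
  rw [goodValue, div_lt_iff₀ M.goodValue_denom_pos]
  have : M.δ / (1 - M.δ) * M.a Kind.G * M.c Kind.G * (1 - M.δ) =
      M.δ * M.a Kind.G * M.c Kind.G := by field_simp
  nlinarith

/-- As `d_G` exceeds the value of permanent cooperation on the good task, so does a wait that ends
with the promise `d_G`. The bound is needed for `y = d_B`. -/
theorem lt_goodValue {y : ℝ}
    (hG : M.d Kind.G > M.δ / (1 - M.δ) * M.a Kind.G * M.c Kind.G)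
    (hB : y < M.δ / (1 - M.δ) * M.a Kind.G * M.c Kind.G) :
    y < M.goodValue := by
  have h1 : 0 < 1 - M.δ := by linarith [M.δ_lt_one]
  rw [goodValue, lt_div_iff₀ M.goodValue_denom_pos]
  have : M.δ / (1 - M.δ) * M.a Kind.G * M.c Kind.G * (1 - M.δ) =
      M.δ * M.a Kind.G * M.c Kind.G := by field_simp
  have h2 := mul_pos M.δ_pos (M.a_pos Kind.G)
  have h3 : y < M.d Kind.G := hB.trans hG
  nlinarith

/-- The bad-task step `x ↦ δ (a_B c_B + x)` raises every `x` below its fixed point `δ a_B c_B / (1 -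
δ)`. -/
theorem gap_pos (hx : M.goodValue < M.δ / (1 - M.δ) * M.a Kind.B * M.c Kind.B) : 0 < M.gap := by
  have h1 : 0 < 1 - M.δ := by linarith [M.δ_lt_one]
  have : M.δ / (1 - M.δ) * M.a Kind.B * M.c Kind.B * (1 - M.δ) =
      M.δ * M.a Kind.B * M.c Kind.B := by field_simp
  simp only [gap, threshold]
  nlinarith

theorem threshold_succ_sub (k : ℕ) :
    M.threshold (k + 1) - M.threshold k = M.gap * M.δ ^ k := by
  induction k with
  | zero => simp [gap]
  | succ k ih =>
    have : M.threshold (k + 2) - M.threshold (k + 1) =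
      M.δ * (M.threshold (k + 1) - M.threshold k) := by simp only [threshold]; ring
    rw [this, ih]; ring

theorem threshold_strictMono (hD : 0 < M.gap) : StrictMono M.threshold :=
  strictMono_nat_of_lt_succ fun k => by
    have := M.threshold_succ_sub k
    have := mul_pos hD (pow_pos M.δ_pos k)
    linarith

/-- The thresholds converge geometrically to the fixed point of the bad-task step, which exceeds
`d_G`. The first threshold above `d_G` is not the zeroth. -/
theorem exists_threshold (hx : M.goodValue < M.d Kind.G)
    (hB : M.d Kind.G < M.δ / (1 - M.δ) * M.a Kind.B * M.c Kind.B) :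
    ∃ N : ℕ, M.threshold N ≤ M.d Kind.G ∧ M.d Kind.G < M.threshold (N + 1) := by
  set S := M.δ / (1 - M.δ) * M.a Kind.B * M.c Kind.B with hS
  have h1 : 1 - M.δ ≠ 0 := by linarith [M.δ_lt_one]
  have hfix : S = M.δ * (M.a Kind.B * M.c Kind.B + S) := by
    rw [hS]; field_simp; ring
  have hform : ∀ k, M.threshold k = S - M.δ ^ k * (S - M.goodValue) := by
    intro k
    induction k with
    | zero => simp [threshold]
    | succ k ih =>
      simp only [threshold, ih]
      linear_combination -hfix
  have ht : Filter.Tendsto M.threshold Filter.atTop (nhds S) := by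
    have := ((tendsto_pow_atTop_nhds_zero_of_lt_one M.δ_pos.le M.δ_lt_one).mul_const
      (S - M.goodValue)).const_sub S
    simp only [zero_mul, sub_zero] at this
    exact this.congr fun k => (hform k).symm
  have hex : ∃ k, M.d Kind.G < M.threshold k := (ht.eventually_const_lt hB).exists
  classical
  obtain ⟨N, hN⟩ : ∃ N, Nat.find hex = N + 1 := by
    refine Nat.exists_eq_succ_of_ne_zero fun h0 => ?_
    have := Nat.find_spec hex
    rw [h0] at this
    exact absurd hx this.le.not_gt
  refine ⟨N, ?_, hN ▸ Nat.find_spec hex⟩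
  exact not_lt.1 (Nat.find_min hex (by omega))

/-- Consecutive chords cross at `threshold (k + 1)` and get steeper, so these thresholds are the
kinks of the maximum of the chords. -/
theorem chord_succ_sub (hD : 0 < M.gap) (k : ℕ) (w : ℝ) :
    M.chord (k + 1) w - M.chord k w =
      (w - M.threshold (k + 1)) * ((1 - M.δ) / (M.gap * M.δ ^ (k + 1))) := by
  have h := M.threshold_succ_sub k
  have h1 := M.δ_pos.ne'
  have h2 := hD.ne'
  have h3 : M.threshold k = M.threshold (k + 1) - M.gap * M.δ ^ k := by linarith
  simp only [chord, h3]
  push_cast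
  field_simp
  ring

theorem chord_slope_pos (hD : 0 < M.gap) (k : ℕ) :
    0 < (1 - M.δ) / (M.gap * M.δ ^ (k + 1)) :=
  div_pos (by linarith [M.δ_lt_one]) (mul_pos hD (pow_pos M.δ_pos _))

/-- The bad-task step is affine and shifts every threshold to the next one, so it lifts one chord to
the next at a cost of exactly one. -/
theorem chord_succ_step (hD : 0 < M.gap) (k : ℕ) (u : ℝ) :
    M.chord (k + 1) (M.δ * (M.a Kind.B * M.c Kind.B + u)) = 1 + M.chord k u := by
  have h1 := M.δ_pos.ne'
  have h2 := hD.ne'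
  simp only [chord, threshold]
  push_cast
  field_simp
  ring

/-- The lowest chord has no predecessor. The factor `δ` is slack, and it is why at most one bad
period can follow a promise on this chord. -/
theorem chord_zero_step (hD : 0 < M.gap) (u : ℝ) :
    M.chord 0 (M.δ * (M.a Kind.B * M.c Kind.B + u)) = 1 + M.δ * M.chord 0 u := by
  have h2 := hD.ne'
  have h3 : M.gap = M.δ * (M.a Kind.B * M.c Kind.B + M.threshold 0) - M.threshold 0 := rfl
  simp only [chord]
  field_simp
  push_cast
  linear_combination -h3

theorem chord_zero_goodValue : M.chord 0 M.goodValue = 0 := by simp [chord, threshold]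

theorem chord_mono (hD : 0 < M.gap) (k : ℕ) : StrictMono (M.chord k) := by
  intro w w' h
  have := mul_pos hD (pow_pos M.δ_pos k)
  unfold chord
  gcongr

theorem chord_affine (k : ℕ) (s t u v : ℝ) (h : s + t = 1) :
    M.chord k (s * u + t * v) = s * M.chord k u + t * M.chord k v := by
  unfold chord
  obtain rfl : s = 1 - t := by linarith
  ring

/-- To the left of its crossing point each chord lies below its predecessor, and the chord of index
0 vanishes at `goodValue`. -/
theorem chord_succ_goodValue_neg (hD : 0 < M.gap) (k : ℕ) :
    M.chord (k + 1) M.goodValue < 0 := by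
  have hneg : ∀ k, M.chord (k + 1) M.goodValue < M.chord k M.goodValue := by
    intro k
    have h1 := M.chord_succ_sub hD k M.goodValue
    have h2 : M.goodValue < M.threshold (k + 1) := M.threshold_strictMono hD (Nat.succ_pos k)
    nlinarith [M.chord_slope_pos hD k]
  induction k with
  | zero => rw [← M.chord_zero_goodValue]; exact hneg 0
  | succ k ih => exact (hneg _).trans ih

theorem potential_nonneg (N : ℕ) (w : ℝ) : 0 ≤ M.potential N w := by
  induction N with
  | zero => exact le_max_left _ _
  | succ N ih => exact ih.trans (le_max_left _ _)

theorem chord_le_potential {k N : ℕ} (h : k ≤ N) (w : ℝ) : M.chord k w ≤ M.potential N w := by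
  induction N with
  | zero => obtain rfl : k = 0 := by omega
            exact le_max_right _ _
  | succ N ih =>
    rcases Nat.lt_or_ge k (N + 1) with h' | h'
    · exact (ih (by omega)).trans (le_max_left _ _)
    · obtain rfl : k = N + 1 := by omega
      exact le_max_right _ _

theorem potential_le {N : ℕ} {w y : ℝ} (h0 : 0 ≤ y) (h : ∀ k ≤ N, M.chord k w ≤ y) :
    M.potential N w ≤ y := by
  induction N with
  | zero => exact max_le h0 (h 0 le_rfl)
  | succ N ih => exact max_le (ih fun k hk => h k (by omega)) (h _ le_rfl)

theorem potential_mono (hD : 0 < M.gap) (N : ℕ) : Monotone (M.potential N) := fun _ _ h =>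
  M.potential_le (M.potential_nonneg N _) fun k hk =>
    ((M.chord_mono hD k).monotone h).trans (M.chord_le_potential hk _)

theorem potential_convex (N : ℕ) {s t u v : ℝ} (hs : 0 ≤ s) (ht : 0 ≤ t) (hst : s + t = 1) :
    M.potential N (s * u + t * v) ≤ s * M.potential N u + t * M.potential N v := by
  refine M.potential_le (add_nonneg (mul_nonneg hs (M.potential_nonneg N _))
    (mul_nonneg ht (M.potential_nonneg N _))) fun k hk => ?_
  rw [M.chord_affine k s t u v hst]
  exact add_le_add (mul_le_mul_of_nonneg_left (M.chord_le_potential hk _) hs)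
    (mul_le_mul_of_nonneg_left (M.chord_le_potential hk _) ht)

theorem potential_goodValue (hD : 0 < M.gap) (N : ℕ) : M.potential N M.goodValue = 0 := by
  refine le_antisymm (M.potential_le le_rfl fun k _ => ?_) (M.potential_nonneg N _)
  cases k with
  | zero => exact M.chord_zero_goodValue.le
  | succ k => exact (M.chord_succ_goodValue_neg hD k).le

theorem potential_eq_zero_iff (hD : 0 < M.gap) {N : ℕ} {w : ℝ} :
    M.potential N w = 0 ↔ w ≤ M.goodValue := by
  constructor
  · intro h
    by_contra! hw
    have h1 := M.chord_mono hD 0 hw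
    rw [M.chord_zero_goodValue] at h1
    exact absurd (M.chord_le_potential (Nat.zero_le N) w) (by linarith)
  · intro h
    exact le_antisymm ((M.potential_mono hD N h).trans (M.potential_goodValue hD N).le)
      (M.potential_nonneg N _)

theorem potential_pos (hD : 0 < M.gap) {N : ℕ} {w : ℝ} (hw : M.goodValue < w) :
    0 < M.potential N w :=
  (M.potential_nonneg N w).lt_of_ne fun h => ((M.potential_eq_zero_iff hD).1 h.symm).not_gt hw

/-- A convex function that vanishes at `goodValue` and is positive beyond it increases strictly from
there on. -/
theorem potential_lt (hD : 0 < M.gap) {N : ℕ} {w w' : ℝ} (hw : M.goodValue ≤ w) (h : w < w') :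
    M.potential N w < M.potential N w' := by
  have hpos := M.potential_pos (N := N) hD (hw.trans_lt h)
  have hd : 0 < w' - M.goodValue := by linarith
  set t := (w - M.goodValue) / (w' - M.goodValue) with ht
  have ht0 : 0 ≤ t := div_nonneg (by linarith) hd.le
  have ht1 : t < 1 := (div_lt_one hd).2 (by linarith)
  have hw' : w = (1 - t) * M.goodValue + t * w' := by
    have : t * (w' - M.goodValue) = w - M.goodValue := div_mul_cancel₀ _ hd.ne'
    linarith
  have := M.potential_convex N (u := M.goodValue) (v := w') (sub_nonneg.2 ht1.le) ht0 (by ring)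
  rw [← hw', M.potential_goodValue hD] at this
  nlinarith

/-- It suffices to check each chord: positive indices descend by one, and index 0 has the slack of
`δ < 1`. -/
theorem potential_bad_step (hD : 0 < M.gap) (N : ℕ) (u : ℝ) :
    M.potential N (M.δ * (M.a Kind.B * M.c Kind.B + u)) ≤ 1 + M.potential N u := by
  refine M.potential_le (by linarith [M.potential_nonneg N u]) fun k hk => ?_
  cases k with
  | zero =>
    rw [M.chord_zero_step hD]
    have h1 := M.chord_le_potential (Nat.zero_le N) u
    have h2 := M.potential_nonneg N u
    nlinarith [M.δ_pos, M.δ_lt_one]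
  | succ k =>
    rw [M.chord_succ_step hD]
    linarith [M.chord_le_potential (show k ≤ N by omega) u]

/-- To the right of a crossing point the steeper chord is the larger one, and `d_G` lies to the
right of the crossing points up to index `N`. -/
theorem potential_d (hD : 0 < M.gap) {N : ℕ}
    (hN : M.threshold N ≤ M.d Kind.G) : M.potential N (M.d Kind.G) = M.chord N (M.d Kind.G) := by
  refine le_antisymm (M.potential_le ?_ ?_) (M.chord_le_potential le_rfl _)
  · have := (M.chord_mono hD N).monotone hN
    have h2 : M.chord N (M.threshold N) = N := by simp [chord]
    rw [h2] at this
    exact (Nat.cast_nonneg N).trans this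
  · intro k hk
    induction N with
    | zero => obtain rfl : k = 0 := by omega
              exact le_rfl
    | succ N ih =>
      rcases Nat.lt_or_ge k (N + 1) with h' | h'
      · refine (ih ((M.threshold_strictMono hD (Nat.lt_succ_self N)).le.trans hN)
          (by omega)).trans ?_
        have h1 := M.chord_succ_sub hD N (M.d Kind.G)
        have h2 := mul_nonneg (sub_nonneg.2 hN) (M.chord_slope_pos hD N).le
        linarith
      · obtain rfl : k = N + 1 := by omega
        exact le_rfl

/-- Convexity: raising the promise by `t` adds at least as much potential at `d_G` as at
`goodValue`, where the potential is zero. -/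
theorem potential_increment (hD : 0 < M.gap) (N : ℕ) (hx : M.goodValue < M.d Kind.G) {t : ℝ}
    (ht : 0 ≤ t) :
    M.potential N (M.goodValue + t) ≤ M.potential N (M.d Kind.G + t) -
      M.potential N (M.d Kind.G) := by
  set D := M.d Kind.G - M.goodValue with hDd
  have hD0 : 0 < D + t := by linarith
  -- With swapped weights, `goodValue + t` and `d_G` are mixtures of the same endpoints `goodValue`
  -- and `d_G + t`.
  set s := t / (D + t) with hs
  have hs0 : 0 ≤ s := div_nonneg ht hD0.le
  have hs1 : s ≤ 1 := (div_le_one hD0).2 (by linarith)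
  have hst : s * (D + t) = t := div_mul_cancel₀ _ hD0.ne'
  have h1 := M.potential_convex N (u := M.goodValue) (v := M.d Kind.G + t)
    (sub_nonneg.2 hs1) hs0 (by ring)
  have h2 := M.potential_convex N (u := M.goodValue) (v := M.d Kind.G + t)
    hs0 (sub_nonneg.2 hs1) (by ring)
  have e1 : (1 - s) * M.goodValue + s * (M.d Kind.G + t) = M.goodValue + t := by linarith
  have e2 : s * M.goodValue + (1 - s) * (M.d Kind.G + t) = M.d Kind.G := by linarith
  rw [e1, M.potential_goodValue hD] at h1
  rw [e2, M.potential_goodValue hD] at h2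
  linarith

/-- Promise of a period on the good task, given the continuation values after it. -/
def goodPromise (u v : ℝ) : ℝ :=
  M.δ * (M.a Kind.G * (M.c Kind.G + u) + (1 - M.a Kind.G) * v)

/-- Promise of a period on the bad task, given the continuation values after it. -/
def badPromise (u v : ℝ) : ℝ :=
  M.δ * (M.a Kind.B * (M.c Kind.B + u) + (1 - M.a Kind.B) * v)

theorem badPromise_eq (u v : ℝ) : M.badPromise u v =
    M.δ * (M.a Kind.B * M.c Kind.B + (M.a Kind.B * u + (1 - M.a Kind.B) * v)) := by
  unfold badPromise; ring

theorem potential_badPromise_le (hD : 0 < M.gap) (N : ℕ) (u v : ℝ) :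
    M.potential N (M.badPromise u v) ≤
      1 + (M.a Kind.B * M.potential N u + (1 - M.a Kind.B) * M.potential N v) := by
  rw [badPromise_eq]
  refine (M.potential_bad_step hD N _).trans ?_
  have := M.potential_convex N (u := u) (v := v) (M.a_pos Kind.B).le
    (sub_nonneg.2 (M.a_le_one Kind.B)) (by ring)
  linarith

/-- By the fixed-point equation of `goodValue`, the good promise mixes `goodValue`, with weight `1 -
δ`, and the average of `goodValue + (u - d_G)` and `v`. Convexity produces the factor `δ`;
`potential_increment` then charges the good game. The middle term is kept for the equality case. -/
theorem potential_goodPromise_aux (hD : 0 < M.gap) (N : ℕ) (hx : M.goodValue < M.d Kind.G)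
    {u v : ℝ} (hu : M.d Kind.G ≤ u) :
    M.potential N (M.goodPromise u v) ≤ M.δ *
        (M.a Kind.G * M.potential N (M.goodValue + (u - M.d Kind.G)) +
          (1 - M.a Kind.G) * M.potential N v) ∧
      M.a Kind.G * M.potential N (M.goodValue + (u - M.d Kind.G)) +
          (1 - M.a Kind.G) * M.potential N v ≤
        M.a Kind.G * (M.potential N u - M.potential N (M.d Kind.G)) +
          (1 - M.a Kind.G) * M.potential N v := by
  have h1 := M.potential_convex N (u := M.goodValue + (u - M.d Kind.G)) (v := v)
    (M.a_pos Kind.G).le (sub_nonneg.2 (M.a_le_one Kind.G)) (by ring)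
  have h2 := M.potential_convex N (u := M.goodValue)
    (v := M.a Kind.G * (M.goodValue + (u - M.d Kind.G)) + (1 - M.a Kind.G) * v)
    (sub_nonneg.2 M.δ_lt_one.le) M.δ_pos.le (by ring)
  have e : (1 - M.δ) * M.goodValue +
      M.δ * (M.a Kind.G * (M.goodValue + (u - M.d Kind.G)) + (1 - M.a Kind.G) * v) =
      M.goodPromise u v := by
    unfold goodPromise
    linear_combination M.goodValue_eq
  rw [e, M.potential_goodValue hD] at h2
  refine ⟨?_, ?_⟩
  · have := mul_le_mul_of_nonneg_left h1 M.δ_pos.le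
    linarith
  · have h3 := M.potential_increment hD N hx (sub_nonneg.2 hu)
    have e2 : M.d Kind.G + (u - M.d Kind.G) = u := by ring
    rw [e2] at h3
    have := mul_le_mul_of_nonneg_left h3 (M.a_pos Kind.G).le
    linarith

theorem potential_goodPromise_le (hD : 0 < M.gap) (N : ℕ) (hx : M.goodValue < M.d Kind.G)
    {u v : ℝ} (hu : M.d Kind.G ≤ u) :
    M.potential N (M.goodPromise u v) ≤
        M.a Kind.G * (M.potential N u - M.potential N (M.d Kind.G)) +
          (1 - M.a Kind.G) * M.potential N v := by
  obtain ⟨h1, h2⟩ := M.potential_goodPromise_aux hD N hx (v := v) hu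
  have h3 : 0 ≤ M.a Kind.G * M.potential N (M.goodValue + (u - M.d Kind.G)) +
      (1 - M.a Kind.G) * M.potential N v :=
    add_nonneg (mul_nonneg (M.a_pos _).le (M.potential_nonneg _ _))
      (mul_nonneg (sub_nonneg.2 (M.a_le_one _)) (M.potential_nonneg _ _))
  nlinarith [M.δ_pos, M.δ_lt_one]

/-- Equality leaves no room for the factor `δ < 1`, so the nonnegative middle term of
`potential_goodPromise_aux` vanishes. Nothing follows for `v` when `a_G = 1`, as its weight is then
zero. -/
theorem eq_of_potential_goodPromise (hD : 0 < M.gap) (N : ℕ) (hx : M.goodValue < M.d Kind.G)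
    {u v : ℝ} (hu : M.d Kind.G ≤ u)
    (h : M.a Kind.G * (M.potential N u - M.potential N (M.d Kind.G)) +
          (1 - M.a Kind.G) * M.potential N v ≤ M.potential N (M.goodPromise u v)) :
    u = M.d Kind.G ∧ (M.a Kind.G < 1 → v ≤ M.goodValue) := by
  obtain ⟨h1, h2⟩ := M.potential_goodPromise_aux hD N hx (v := v) hu
  have h3 : 0 ≤ M.a Kind.G * M.potential N (M.goodValue + (u - M.d Kind.G)) :=
    mul_nonneg (M.a_pos _).le (M.potential_nonneg _ _)
  have h4 : 0 ≤ (1 - M.a Kind.G) * M.potential N v :=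
    mul_nonneg (sub_nonneg.2 (M.a_le_one _)) (M.potential_nonneg _ _)
  have h5 : M.a Kind.G * M.potential N (M.goodValue + (u - M.d Kind.G)) +
      (1 - M.a Kind.G) * M.potential N v ≤ 0 := by
    nlinarith [M.δ_pos, M.δ_lt_one]
  have h6 : M.potential N (M.goodValue + (u - M.d Kind.G)) = 0 := by
    have : M.a Kind.G * M.potential N (M.goodValue + (u - M.d Kind.G)) = 0 := by linarith
    exact (mul_eq_zero.1 this).resolve_left (M.a_pos _).ne'
  refine ⟨?_, fun ha => ?_⟩
  · have := (M.potential_eq_zero_iff hD).1 h6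
    linarith
  · have : (1 - M.a Kind.G) * M.potential N v = 0 := by linarith
    exact (M.potential_eq_zero_iff hD).1
      ((mul_eq_zero.1 this).resolve_left (by linarith))

theorem goodPromise_le {u v : ℝ} (hu : u = M.d Kind.G)
    (hv : M.a Kind.G < 1 → v ≤ M.goodValue) : M.goodPromise u v ≤ M.goodValue := by
  rw [M.goodValue_eq, goodPromise, hu]
  refine mul_le_mul_of_nonneg_left ?_ M.δ_pos.le
  rcases (M.a_le_one Kind.G).eq_or_lt with h | h
  · rw [h]; simp
  · have := mul_le_mul_of_nonneg_left (hv h) (sub_nonneg.2 h.le)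
    linarith

end Model

theorem Assignment.last_push (m : Assignment) (s : State m.K) (e : Task × Option Game) :
    m.last (s.push e) = e := by
  have := m.K_pos
  simp only [Assignment.last, State.push]
  rw [dif_neg (by omega)]

theorem Assignment.task_push (m : Assignment) (s : State m.K) (e : Task × Option Game) :
    m.task (s.push e) = e.1 := by rw [Assignment.task, m.last_push]

theorem Assignment.game_push (m : Assignment) (s : State m.K) (e : Task × Option Game) :
    m.game (s.push e) = e.2 := by rw [Assignment.game, m.last_push]

/-! ### One-step inequalities for mixed assignments and their equality cases. -/

namespace Model

variable (M : Model)

section Step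

variable {N : ℕ} {g b uG uN vB vN : ℝ}

/-- Expected potential, net of the cost of bad periods and of the reward of good games, after a
period spent on the good task with probability `g` and on the bad task with probability `b`. -/
noncomputable def netPotential (M : Model) (N : ℕ) (g b uG uN vB vN : ℝ) : ℝ :=
  g * (M.a Kind.G * (M.potential N uG - M.potential N (M.d Kind.G)) +
      (1 - M.a Kind.G) * M.potential N uN) +
    b * (1 + (M.a Kind.B * M.potential N vB + (1 - M.a Kind.B) * M.potential N vN))

/-- Every term other than the cost of the bad period is nonnegative. Hence, in the tight case, zero
potential rules out the bad task. -/
theorem le_netPotential (hD : 0 < M.gap) (hg : 0 ≤ g) (hb : 0 ≤ b)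
    (hu : 0 < g → M.d Kind.G ≤ uG) : b ≤ M.netPotential N g b uG uN vB vN := by
  have h1 : 0 ≤ g * (M.a Kind.G * (M.potential N uG - M.potential N (M.d Kind.G)) +
      (1 - M.a Kind.G) * M.potential N uN) := by
    rcases hg.eq_or_lt with h | h
    · rw [← h, zero_mul]
    · have := M.potential_mono hD N (hu h)
      exact mul_nonneg hg (add_nonneg (mul_nonneg (M.a_pos _).le (by linarith))
        (mul_nonneg (sub_nonneg.2 (M.a_le_one _)) (M.potential_nonneg _ _)))
  have h2 : 0 ≤ M.a Kind.B * M.potential N vB + (1 - M.a Kind.B) * M.potential N vN :=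
    add_nonneg (mul_nonneg (M.a_pos _).le (M.potential_nonneg _ _))
        (mul_nonneg (sub_nonneg.2 (M.a_le_one _)) (M.potential_nonneg _ _))
  have h3 := mul_nonneg hb h2
  unfold netPotential
  linarith

theorem potential_mix_le (hD : 0 < M.gap) (hx : M.goodValue < M.d Kind.G) (hg : 0 ≤ g)
    (hb : 0 ≤ b) (hgb : g + b = 1) (hu : 0 < g → M.d Kind.G ≤ uG) :
    M.potential N (g * M.goodPromise uG uN + b * M.badPromise vB vN) ≤
        g * M.potential N (M.goodPromise uG uN) + b * M.potential N (M.badPromise vB vN) ∧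
      g * M.potential N (M.goodPromise uG uN) + b * M.potential N (M.badPromise vB vN) ≤
        M.netPotential N g b uG uN vB vN := by
  refine ⟨M.potential_convex N hg hb hgb, add_le_add ?_ ?_⟩
  · rcases hg.eq_or_lt with h | h
    · simp [← h]
    · exact mul_le_mul_of_nonneg_left (M.potential_goodPromise_le hD N hx (hu h)) hg
  · exact mul_le_mul_of_nonneg_left (M.potential_badPromise_le hD N _ _) hb

variable (hD : 0 < M.gap) (hx : M.goodValue < M.d Kind.G) (hg : 0 ≤ g) (hb : 0 ≤ b)
  (hgb : g + b = 1) (hu : 0 < g → M.d Kind.G ≤ uG)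
  (heq : M.netPotential N g b uG uN vB vN ≤
    M.potential N (g * M.goodPromise uG uN + b * M.badPromise vB vN))

include hD hx hg hb hgb hu heq

theorem good_of_netPotential_eq (hg0 : 0 < g) :
    uG = M.d Kind.G ∧ (M.a Kind.G < 1 → uN ≤ M.goodValue) := by
  obtain ⟨h1, h2⟩ := M.potential_mix_le (N := N) hD hx hg hb hgb hu (uN := uN) (vB := vB) (vN := vN)
  refine M.eq_of_potential_goodPromise hD N hx (hu hg0) ?_
  have h3 := mul_le_mul_of_nonneg_left (M.potential_badPromise_le hD N vB vN) hb
  have h4 := heq.trans h1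
  unfold netPotential at h4
  refine le_of_mul_le_mul_left ?_ hg0
  linarith

/-- Positive weight on the good task would bring in a promise of at most `goodValue`, where this
chord is negative and so strictly below the potential. With the bad task certain, `chord_succ_step`
turns equality into equality with the chord of index `k` at each successor. -/
theorem bad_of_netPotential_eq_chord_succ {k : ℕ} (hk : k + 1 ≤ N)
    (hc : M.potential N (g * M.goodPromise uG uN + b * M.badPromise vB vN) =
      M.chord (k + 1) (g * M.goodPromise uG uN + b * M.badPromise vB vN)) :
    b = 1 ∧ M.potential N vB = M.chord k vB ∧
      (M.a Kind.B < 1 → M.potential N vN = M.chord k vN) := by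
  obtain ⟨h1, h2⟩ := M.potential_mix_le (N := N) hD hx hg hb hgb hu (uN := uN) (vB := vB) (vN := vN)
  have hg0 : g = 0 := by
    by_contra hne
    have hgp : 0 < g := hg.lt_of_ne (Ne.symm hne)
    obtain ⟨e1, e2⟩ := M.good_of_netPotential_eq hD hx hg hb hgb hu heq hgp
    have h3 := (M.chord_mono hD (k + 1)).monotone (M.goodPromise_le e1 e2)
    have h4 := M.chord_succ_goodValue_neg hD k
    rw [M.chord_affine _ _ _ _ _ hgb] at hc
    have h5 := M.potential_nonneg N (M.goodPromise uG uN)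
    have h6 := mul_le_mul_of_nonneg_left (M.chord_le_potential hk (M.badPromise vB vN)) hb
    have h7 : g * M.chord (k + 1) (M.goodPromise uG uN) <
        g * M.potential N (M.goodPromise uG uN) := mul_lt_mul_of_pos_left (by linarith) hgp
    linarith
  obtain rfl : b = 1 := by linarith
  subst hg0
  simp only [zero_mul, zero_add, one_mul, netPotential] at hc heq
  rw [hc, badPromise_eq, M.chord_succ_step hD, M.chord_affine _ _ _ _ _ (by ring)] at heq
  have h3 := M.chord_le_potential (show k ≤ N by omega) vB
  have h4 := M.chord_le_potential (show k ≤ N by omega) vN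
  have ha := M.a_pos Kind.B
  have ha' := M.a_le_one Kind.B
  refine ⟨rfl, le_antisymm ?_ h3, fun h => le_antisymm ?_ h4⟩
  · have := mul_le_mul_of_nonneg_left h4 (sub_nonneg.2 ha')
    exact le_of_mul_le_mul_left (by linarith) ha
  · have := mul_le_mul_of_nonneg_left h3 ha.le
    exact le_of_mul_le_mul_left (by linarith) (sub_pos.2 h)

/-- The good branch cannot compensate, so the bad branch is tight on its own. By `chord_zero_step`
the expected potential after it is then at most `δ` times itself. -/
theorem succ_of_netPotential_eq_chord_zero (hb0 : 0 < b)
    (hc : M.potential N (g * M.goodPromise uG uN + b * M.badPromise vB vN) =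
      M.chord 0 (g * M.goodPromise uG uN + b * M.badPromise vB vN)) :
    M.potential N vB = 0 ∧ (M.a Kind.B < 1 → M.potential N vN = 0) := by
  obtain ⟨h1, h2⟩ := M.potential_mix_le (N := N) hD hx hg hb hgb hu (uN := uN) (vB := vB) (vN := vN)
  have h0 := M.chord_le_potential (Nat.zero_le N) (M.goodPromise uG uN)
  have h3 := mul_le_mul_of_nonneg_left h0 hg
  have h4 : g * M.potential N (M.goodPromise uG uN) ≤
      g * (M.a Kind.G * (M.potential N uG - M.potential N (M.d Kind.G)) +
      (1 - M.a Kind.G) * M.potential N uN) := by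
    rcases hg.eq_or_lt with h | h
    · simp [← h]
    · exact mul_le_mul_of_nonneg_left (M.potential_goodPromise_le hD N hx (hu h)) hg
  rw [M.chord_affine _ _ _ _ _ hgb] at hc
  have h5 : 1 + (M.a Kind.B * M.potential N vB + (1 - M.a Kind.B) * M.potential N vN) ≤
      M.chord 0 (M.badPromise vB vN) := by
    unfold netPotential at heq
    exact le_of_mul_le_mul_left (by linarith) hb0
  rw [badPromise_eq, M.chord_zero_step hD, M.chord_affine _ _ _ _ _ (by ring)] at h5
  have ha := M.a_pos Kind.B
  have ha' := M.a_le_one Kind.B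
  have h6 := mul_le_mul_of_nonneg_left (M.chord_le_potential (Nat.zero_le N) vB) ha.le
  have h7 := mul_le_mul_of_nonneg_left (M.chord_le_potential (Nat.zero_le N) vN)
    (sub_nonneg.2 ha')
  have h8 := mul_nonneg ha.le (M.potential_nonneg N vB)
  have h9 := mul_nonneg (sub_nonneg.2 ha') (M.potential_nonneg N vN)
  have h10 : M.a Kind.B * M.potential N vB + (1 - M.a Kind.B) * M.potential N vN ≤ 0 := by
    nlinarith [M.δ_pos, M.δ_lt_one]
  refine ⟨?_, fun h => ?_⟩
  · exact (mul_eq_zero.1 (show M.a Kind.B * M.potential N vB = 0 by linarith)).resolve_left ha.ne'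
  · exact (mul_eq_zero.1 (show (1 - M.a Kind.B) * M.potential N vN = 0 by
      linarith)).resolve_left (by linarith)

end Step

/-! ### The Markov chain of states and its steady states. -/

section Chain

variable {m : Assignment}

theorem sum_trans_mul (s : State m.K) (f : State m.K → ℝ) :
    ∑ s', M.trans m s s' * f s' = ∑ e, M.nextProb m s e * f (s.push e) := by
  simp only [trans, Matrix.of_apply, Finset.sum_mul]
  rw [Finset.sum_comm]
  refine Finset.sum_congr rfl fun e _ => ?_
  simp

theorem trans_nonneg (s s' : State m.K) : 0 ≤ M.trans m s s' := by
  simp only [trans, Matrix.of_apply]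
  refine Finset.sum_nonneg fun e _ => ?_
  split_ifs
  exacts [M.nextProb_nonneg _ _, le_rfl]

theorem exists_of_trans_pos {s s' : State m.K} (h : 0 < M.trans m s s') :
    ∃ e, s.push e = s' ∧ 0 < M.nextProb m s e := by
  simp only [trans, Matrix.of_apply] at h
  obtain ⟨e, -, he⟩ := Finset.exists_lt_of_sum_lt (s := Finset.univ) (f := fun _ => (0 : ℝ))
    (by simpa using h)
  by_cases hs : s.push e = s'
  · exact ⟨e, hs, by simpa [hs] using he⟩
  · simp [hs] at he

theorem trans_push_pos {s : State m.K} {e : Task × Option Game} (h : 0 < M.nextProb m s e) :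
    0 < M.trans m s (s.push e) := by
  simp only [trans, Matrix.of_apply]
  refine Finset.sum_pos' (fun e' _ => ?_) ⟨e, Finset.mem_univ e, by simpa using h⟩
  split_ifs
  exacts [M.nextProb_nonneg _ _, le_rfl]

/-- Entries that occur with positive probability. -/
theorem nextProb_pos_iff {s : State m.K} {e : Task × Option Game} :
    0 < M.nextProb m s e ↔ 0 < m.rule s e.1 ∧
      (e.2 = some e.1 ∨ e.2 = none ∧ M.a e.1 < 1) := by
  have h1 := rule_nonneg s e.1
  have h2 := M.arrival_nonneg e.1 e.2
  have h3 : 0 < M.arrival e.1 e.2 ↔ (e.2 = some e.1 ∨ e.2 = none ∧ M.a e.1 < 1) := by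
    cases e.2 with
    | none => simp [arrival]
    | some g =>
      by_cases hg : g = e.1
      · simp [arrival, hg, M.a_pos]
      · simp [arrival, hg]
  rw [← h3, nextProb]
  exact ⟨fun h => ⟨pos_of_mul_pos_left h h2, pos_of_mul_pos_right h h1⟩,
    fun h => mul_pos h.1 h.2⟩

/-- Stationarity tested against `f`. It is applied to indicators of tasks and games and to
potentials. -/
theorem IsSteady.sum_mul {μ : State m.K → ℝ} (hμ : M.IsSteady m μ) (f : State m.K → ℝ) :
    ∑ s, μ s * f s = ∑ s, μ s * ∑ e, M.nextProb m s e * f (s.push e) := by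
  simp only [← M.sum_trans_mul]
  calc ∑ s', μ s' * f s' = ∑ s', (∑ s, M.trans m s s' * μ s) * f s' :=
        Finset.sum_congr rfl fun s' _ => by rw [← hμ.2 s']
    _ = _ := by
        simp only [Finset.sum_mul, Finset.mul_sum]
        rw [Finset.sum_comm]
        exact Finset.sum_congr rfl fun s _ => Finset.sum_congr rfl fun s' _ => by ring

theorem IsSteady.pos_of_trans_pos {μ : State m.K → ℝ} (hμ : M.IsSteady m μ) {s s' : State m.K}
    (hs : 0 < μ s) (h : 0 < M.trans m s s') : 0 < μ s' := by
  rw [hμ.2 s']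
  exact Finset.sum_pos' (fun s _ => mul_nonneg (M.trans_nonneg _ _) (hμ.1.1 s))
    ⟨s, Finset.mem_univ s, mul_pos h hs⟩

theorem IsSteady.exists_pred {μ : State m.K → ℝ} (hμ : M.IsSteady m μ) {s' : State m.K}
    (hs : 0 < μ s') : ∃ s e, 0 < μ s ∧ 0 < M.nextProb m s e ∧ s.push e = s' := by
  rw [hμ.2 s'] at hs
  obtain ⟨s, -, h⟩ := Finset.exists_lt_of_sum_lt (s := Finset.univ) (f := fun _ => (0 : ℝ))
    (by simpa using hs)
  have h1 := hμ.1.1 s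
  have h2 := M.trans_nonneg s s'
  obtain ⟨e, he, hp⟩ := M.exists_of_trans_pos (pos_of_mul_pos_left h h1)
  exact ⟨s, e, pos_of_mul_pos_right h h2, hp, he⟩

/-- Mass of the states with a given current task. -/
def share (m : Assignment) (μ : State m.K → ℝ) (t : Task) : ℝ := ∑ s with m.task s = t, μ s

theorem share_nonneg {μ : State m.K → ℝ} (hμ : μ ∈ stdSimplex ℝ (State m.K)) (t : Task) :
    0 ≤ share m μ t := Finset.sum_nonneg fun s _ => hμ.1 s

theorem share_sum {μ : State m.K → ℝ} (hμ : μ ∈ stdSimplex ℝ (State m.K)) :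
    share m μ Kind.G + share m μ Kind.B = 1 := by
  have h1 : ∀ t, share m μ t = ∑ s, if m.task s = t then μ s else 0 := fun t =>
    Finset.sum_filter _ _
  rw [h1, h1, ← Finset.sum_add_distrib, ← hμ.2]
  refine Finset.sum_congr rfl fun s _ => ?_
  cases m.task s <;> simp

theorem share_eq_sum_rule {μ : State m.K → ℝ} (hμ : M.IsSteady m μ) (t : Task) :
    share m μ t = ∑ s, μ s * m.rule s t := by
  have h1 := hμ.sum_mul M (fun s => if m.task s = t then 1 else 0)
  simp only [m.task_push, M.sum_nextProb_mul] at h1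
  rw [share, Finset.sum_filter]
  simp only [mul_ite, mul_one, mul_zero] at h1
  rw [h1]
  refine Finset.sum_congr rfl fun s _ => ?_
  cases t <;> simp

theorem sum_game_eq {μ : State m.K → ℝ} (hμ : M.IsSteady m μ) (g : Game) :
    ∑ s, (if m.game s = some g then μ s else 0) = M.a g * share m μ g := by
  have h1 := hμ.sum_mul M (fun s => if m.game s = some g then 1 else 0)
  simp only [m.game_push, M.sum_nextProb_mul] at h1
  simp only [mul_ite, mul_one, mul_zero] at h1
  rw [h1, M.share_eq_sum_rule hμ, Finset.mul_sum]
  refine Finset.sum_congr rfl fun s _ => ?_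
  cases g <;> simp <;> ring

theorem trans_pow_nonneg (k : ℕ) (s s' : State m.K) : 0 ≤ (M.trans m ^ k) s s' := by
  induction k generalizing s' with
  | zero => rw [pow_zero, Matrix.one_apply]; split_ifs <;> norm_num
  | succ k ih =>
    rw [pow_succ, Matrix.mul_apply]
    exact Finset.sum_nonneg fun s'' _ => mul_nonneg (ih _) (M.trans_nonneg _ _)

theorem sum_trans_pow_succ_mul (k : ℕ) (s : State m.K) (f : State m.K → ℝ) :
    ∑ s', (M.trans m ^ (k + 1)) s s' * f s' =
      ∑ s', (M.trans m ^ k) s s' * ∑ e, M.nextProb m s' e * f (s'.push e) := by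
  simp only [pow_succ, Matrix.mul_apply, ← M.sum_trans_mul, Finset.sum_mul, Finset.mul_sum]
  rw [Finset.sum_comm]
  exact Finset.sum_congr rfl fun s _ => Finset.sum_congr rfl fun s' _ => by ring

theorem sum_trans_pow (k : ℕ) (s : State m.K) : ∑ s', (M.trans m ^ k) s s' = 1 := by
  induction k with
  | zero => simp [Matrix.one_apply]
  | succ k ih =>
    have := M.sum_trans_pow_succ_mul k s (fun _ => 1)
    simpa [M.sum_nextProb, ih] using this

theorem exists_of_trans_pow_succ_pos {k : ℕ} {s s' : State m.K}
    (h : 0 < (M.trans m ^ (k + 1)) s s') :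
    ∃ s'', 0 < (M.trans m ^ k) s s'' ∧ 0 < M.trans m s'' s' := by
  rw [pow_succ, Matrix.mul_apply] at h
  obtain ⟨s'', -, h⟩ := Finset.exists_lt_of_sum_lt (s := Finset.univ) (f := fun _ => (0 : ℝ))
    (by simpa using h)
  have h1 := M.trans_pow_nonneg k s s''
  have h2 := M.trans_nonneg s'' s'
  exact ⟨s'', pos_of_mul_pos_left h h2, pos_of_mul_pos_right h h1⟩

end Chain

end Model

/-! ### Promises: the steady-state bound and the structure in the tight case. -/

namespace Model

variable (M : Model) {m : Assignment}

/-- Continuation values, at discount factor `β`, of a team that always cooperates and that, at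
states in the support of the steady state `μ`, is willing to do so in good games. -/
structure IsPromise (m : Assignment) (β : ℝ) (μ w : State m.K → ℝ) : Prop where
  steady : M.IsSteady m μ
  discount_nonneg : 0 ≤ β
  discount_le : β ≤ M.δ
  eq : ∀ s, w s = β * ∑ e, M.nextProb m s e * (M.gain e.2 + w (s.push e))
  nonneg : ∀ s, 0 ≤ w s
  willing : ∀ s, 0 < μ s → m.game s = some Kind.G → M.d Kind.G ≤ w s

namespace IsPromise

variable {M} {β : ℝ} {μ w : State m.K → ℝ} {N : ℕ}

/-- The net potential after the state `s`. -/
noncomputable def net (N : ℕ) (w : State m.K → ℝ) (s : State m.K) : ℝ :=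
  M.netPotential N (m.rule s Kind.G) (m.rule s Kind.B) (w (s.push (Kind.G, some Kind.G)))
    (w (s.push (Kind.G, none))) (w (s.push (Kind.B, some Kind.B))) (w (s.push (Kind.B, none)))

/-- The promise at discount factor `δ` with the continuation values `w`. -/
noncomputable def mix (w : State m.K → ℝ) (s : State m.K) : ℝ :=
  m.rule s Kind.G * M.goodPromise (w (s.push (Kind.G, some Kind.G))) (w (s.push (Kind.G, none))) +
    m.rule s Kind.B *
      M.badPromise (w (s.push (Kind.B, some Kind.B))) (w (s.push (Kind.B, none)))

theorem mix_eq (w : State m.K → ℝ) (s : State m.K) :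
    mix (M := M) w s = M.δ * ∑ e, M.nextProb m s e * (M.gain e.2 + w (s.push e)) := by
  rw [M.sum_nextProb_mul]
  simp only [mix, goodPromise, badPromise, gain_some, gain_none]
  ring

variable (hw : M.IsPromise m β μ w)

include hw

/-- Reshuffling only lowers the discount factor, and the discounted terms are nonnegative. -/
theorem le_mix (s : State m.K) : w s ≤ mix (M := M) w s := by
  rw [mix_eq, hw.eq s]
  refine mul_le_mul_of_nonneg_right hw.discount_le (Finset.sum_nonneg fun e _ =>
    mul_nonneg (M.nextProb_nonneg _ _) (add_nonneg ?_ (hw.nonneg _)))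
  cases e.2 with
  | none => exact le_rfl
  | some g => exact (M.c_pos g).le

theorem d_le {s : State m.K} (hs : 0 < μ s) (hg : 0 < m.rule s Kind.G) :
    M.d Kind.G ≤ w (s.push (Kind.G, some Kind.G)) := by
  refine hw.willing _ ?_ (m.game_push _ _)
  exact hw.steady.pos_of_trans_pos M hs (M.trans_push_pos
    (M.nextProb_pos_iff.2 ⟨hg, Or.inl rfl⟩))

theorem potential_le_net (hD : 0 < M.gap) (hx : M.goodValue < M.d Kind.G) {s : State m.K}
    (hs : 0 < μ s) : M.potential N (w s) ≤ M.potential N (mix (M := M) w s) ∧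
      M.potential N (mix (M := M) w s) ≤ net (M := M) N w s := by
  refine ⟨M.potential_mono hD N (hw.le_mix s), ?_⟩
  obtain ⟨h1, h2⟩ := M.potential_mix_le (N := N) hD hx (rule_nonneg s Kind.G)
    (rule_nonneg s Kind.B) (rule_sum s) (hw.d_le hs) (uN := w (s.push (Kind.G, none)))
    (vB := w (s.push (Kind.B, some Kind.B))) (vN := w (s.push (Kind.B, none)))
  exact h1.trans h2

/-- In a steady state the mean potential now and one period later coincide. Only the cost of bad
periods and the credit for good games survive. -/
theorem sum_net_sub : ∑ s, μ s * (net (M := M) N w s - M.potential N (w s)) =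
    share m μ Kind.B - M.potential N (M.d Kind.G) * M.a Kind.G * share m μ Kind.G := by
  have h1 := hw.steady.sum_mul M (fun s => M.potential N (w s))
  simp only [mul_sub, Finset.sum_sub_distrib]
  rw [h1, M.share_eq_sum_rule hw.steady, M.share_eq_sum_rule hw.steady, Finset.mul_sum,
    ← Finset.sum_sub_distrib, ← Finset.sum_sub_distrib]
  refine Finset.sum_congr rfl fun s _ => ?_
  rw [M.sum_nextProb_mul, net, netPotential]
  ring

/-- The time on the good task is bounded in terms of the time on the bad task. -/
theorem share_le (hD : 0 < M.gap) (hx : M.goodValue < M.d Kind.G) (N : ℕ) :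
    M.potential N (M.d Kind.G) * M.a Kind.G * share m μ Kind.G ≤ share m μ Kind.B := by
  have h : 0 ≤ ∑ s, μ s * (net (M := M) N w s - M.potential N (w s)) := by
    refine Finset.sum_nonneg fun s _ => ?_
    rcases (hw.steady.1.1 s).eq_or_lt with hs | hs
    · rw [← hs, zero_mul]
    · obtain ⟨h1, h2⟩ := hw.potential_le_net (N := N) hD hx hs
      exact mul_nonneg hs.le (by linarith)
  rw [hw.sum_net_sub] at h
  linarith

section Tight

variable (hD : 0 < M.gap) (hx : M.goodValue < M.d Kind.G)
  (ht : share m μ Kind.B ≤ M.potential N (M.d Kind.G) * M.a Kind.G * share m μ Kind.G)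

include hD hx ht

/-- When the bound is attained, the nonnegative terms summed in `share_le` have sum zero, so each of
them vanishes. -/
theorem net_eq {s : State m.K} (hs : 0 < μ s) :
    net (M := M) N w s = M.potential N (w s) := by
  have h : ∀ s ∈ Finset.univ, 0 ≤ μ s * (net (M := M) N w s - M.potential N (w s)) := by
    intro s _
    rcases (hw.steady.1.1 s).eq_or_lt with hs | hs
    · rw [← hs, zero_mul]
    · obtain ⟨h1, h2⟩ := hw.potential_le_net (N := N) hD hx hs
      exact mul_nonneg hs.le (by linarith)
  have h0 : ∑ s, μ s * (net (M := M) N w s - M.potential N (w s)) = 0 :=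
    le_antisymm (by rw [hw.sum_net_sub]; linarith) (Finset.sum_nonneg h)
  have := (Finset.sum_eq_zero_iff_of_nonneg h).1 h0 s (Finset.mem_univ s)
  have := (mul_eq_zero.1 this).resolve_left hs.ne'
  linarith

/-- There is no reshuffling. A good game occurs somewhere in the support; its promise is at least
`d_G`, where the potential is strictly increasing, so tightness forbids any loss from `β < δ`. -/
theorem mix_eq_self (s : State m.K) : mix (M := M) w s = w s := by
  suffices h : β = M.δ by rw [mix_eq, hw.eq s, h]
  have hG : 0 < share m μ Kind.G := by
    have h1 := share_sum hw.steady.1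
    have h2 := share_nonneg hw.steady.1 Kind.G
    rcases h2.eq_or_lt with h | h
    · rw [← h] at ht h1; linarith
    · exact h
  have h1 := M.sum_game_eq hw.steady Kind.G
  have h2 := mul_pos (M.a_pos Kind.G) hG
  rw [← h1] at h2
  obtain ⟨s', -, h⟩ := Finset.exists_lt_of_sum_lt (s := Finset.univ) (f := fun _ => (0 : ℝ))
    (by simpa using h2)
  split_ifs at h with hg
  · have hd := hw.willing s' h hg
    obtain ⟨h3, h4⟩ := hw.potential_le_net (N := N) hD hx h
    rw [hw.net_eq hD hx ht h] at h4
    have h5 : ¬ w s' < mix (M := M) w s' := fun hlt =>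
      absurd (M.potential_lt (N := N) hD (hx.le.trans hd) hlt) h4.not_gt
    have h6 : w s' = mix (M := M) w s' := le_antisymm (hw.le_mix s') (not_lt.1 h5)
    have h7 : 0 < w s' := (M.d_pos Kind.G).trans_le hd
    rw [mix_eq] at h6
    have h8 := hw.eq s'
    rw [h6] at h8 h7
    have h9 : ∑ e, M.nextProb m s' e * (M.gain e.2 + w (s'.push e)) ≠ 0 := by
      intro h0; rw [h0] at h7; simp at h7
    exact (mul_right_cancel₀ h9 h8).symm
  · exact absurd h (lt_irrefl _)

theorem heq_of_tight {s : State m.K} (hs : 0 < μ s) :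
    net (M := M) N w s ≤ M.potential N (mix (M := M) w s) := by
  rw [hw.mix_eq_self hD hx ht, hw.net_eq hD hx ht hs]

theorem good_succ {s : State m.K} (hs : 0 < μ s) (hg : 0 < m.rule s Kind.G) :
    w (s.push (Kind.G, some Kind.G)) = M.d Kind.G ∧
      (M.a Kind.G < 1 → w (s.push (Kind.G, none)) ≤ M.goodValue) :=
  M.good_of_netPotential_eq hD hx (rule_nonneg s _) (rule_nonneg s _) (rule_sum s)
    (hw.d_le hs) (hw.heq_of_tight hD hx ht hs) hg

/-- The incentive constraint binds in good games. -/
theorem binding {s : State m.K} (hs : 0 < μ s) (hg : m.game s = some Kind.G) :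
    w s = M.d Kind.G := by
  obtain ⟨s', ⟨t, o⟩, h1, h2, rfl⟩ := hw.steady.exists_pred M hs
  rw [m.game_push] at hg
  obtain ⟨h3, h4⟩ := M.nextProb_pos_iff.1 h2
  simp only at hg h3 h4
  subst hg
  obtain rfl : Kind.G = t := by simpa using h4
  exact (hw.good_succ hD hx ht h1 h3).1

theorem rule_bad_le {s : State m.K} (hs : 0 < μ s) :
    m.rule s Kind.B ≤ M.potential N (w s) := by
  rw [← hw.net_eq hD hx ht hs]
  exact M.le_netPotential hD (rule_nonneg s _) (rule_nonneg s _) (hw.d_le hs)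

theorem rule_good_of_potential_zero {s : State m.K} (hs : 0 < μ s)
    (h : M.potential N (w s) = 0) : m.rule s Kind.G = 1 := by
  have h1 := hw.rule_bad_le hD hx ht hs
  have h2 := rule_nonneg s Kind.B
  have h3 := rule_sum s
  linarith

/-- Teams stay on the good task until a good game is played. -/
theorem stay {s : State m.K} (hs : 0 < μ s) (hk : m.task s = Kind.G)
    (hg : m.game s ≠ some Kind.G) : m.rule s Kind.G = 1 := by
  refine hw.rule_good_of_potential_zero hD hx ht hs ((M.potential_eq_zero_iff hD).2 ?_)
  obtain ⟨s', ⟨t, o⟩, h1, h2, rfl⟩ := hw.steady.exists_pred M hs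
  rw [m.game_push] at hg
  rw [m.task_push] at hk
  obtain ⟨h3, h4⟩ := M.nextProb_pos_iff.1 h2
  simp only at hk hg h3 h4
  subst hk
  obtain ⟨rfl, ha⟩ := h4.resolve_left hg
  exact (hw.good_succ hD hx ht h1 h3).2 ha

/-- One step of the descent after a good game: the bad task is certain and every possible successor
lies on the next lower chord. -/
theorem chord_succ {s s' : State m.K} (hs : 0 < μ s) {k : ℕ} (hk : k + 1 ≤ N)
    (hc : M.potential N (w s) = M.chord (k + 1) (w s)) :
    m.rule s Kind.B = 1 ∧
      (0 < M.trans m s s' → M.potential N (w s') = M.chord k (w s')) := by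
  obtain ⟨h1, h2, h3⟩ := M.bad_of_netPotential_eq_chord_succ hD hx (rule_nonneg s _)
    (rule_nonneg s _) (rule_sum s) (hw.d_le hs) (hw.heq_of_tight hD hx ht hs) hk
    (by have := hw.mix_eq_self hD hx ht s
        rw [← this] at hc; exact hc)
  refine ⟨h1, fun hp => ?_⟩
  obtain ⟨⟨t, o⟩, rfl, he⟩ := M.exists_of_trans_pos hp
  obtain ⟨h4, h5⟩ := M.nextProb_pos_iff.1 he
  simp only at h4 h5
  cases t with
  | G => have := rule_sum s; linarith
  | B =>
    rcases h5 with rfl | ⟨rfl, ha⟩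
    exacts [h2, h3 ha]

theorem chord_zero {s s' : State m.K} (hs : 0 < μ s)
    (hc : M.potential N (w s) = M.chord 0 (w s)) (hp : 0 < M.trans m s s')
    (hB : m.task s' = Kind.B) : M.potential N (w s') = 0 := by
  obtain ⟨⟨t, o⟩, rfl, he⟩ := M.exists_of_trans_pos hp
  obtain ⟨h4, h5⟩ := M.nextProb_pos_iff.1 he
  rw [m.task_push] at hB
  simp only at h4 h5 hB
  subst hB
  obtain ⟨h2, h3⟩ := M.succ_of_netPotential_eq_chord_zero hD hx (rule_nonneg s _)
    (rule_nonneg s _) (rule_sum s) (hw.d_le hs) (hw.heq_of_tight hD hx ht hs) h4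
    (by have := hw.mix_eq_self hD hx ht s
        rw [← this] at hc; exact hc)
  rcases h5 with rfl | ⟨rfl, ha⟩
  exacts [h2, h3 ha]

/-- The good game starts on the chord of index `N`, by `binding` and `potential_d`; each later
period descends by one chord. -/
theorem reach (hN : M.threshold N ≤ M.d Kind.G) {s : State m.K} (hs : 0 < μ s)
    (hg : m.game s = some Kind.G) {k : ℕ} (hk : k ≤ N) :
    ∀ s', 0 < (M.trans m ^ k) s s' →
      0 < μ s' ∧ M.potential N (w s') = M.chord (N - k) (w s') := by
  induction k with
  | zero =>
    intro s' h
    rw [pow_zero, Matrix.one_apply] at h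
    split_ifs at h with e
    · subst e
      refine ⟨hs, ?_⟩
      rw [hw.binding hD hx ht hs hg, Nat.sub_zero, M.potential_d hD hN]
    · exact absurd h (lt_irrefl _)
  | succ k ih =>
    intro s' h
    obtain ⟨s'', h1, h2⟩ := M.exists_of_trans_pow_succ_pos h
    obtain ⟨h3, h4⟩ := ih (by omega) s'' h1
    refine ⟨hw.steady.pos_of_trans_pos M h3 h2, ?_⟩
    have e : N - k = (N - (k + 1)) + 1 := by omega
    rw [e] at h4
    exact (hw.chord_succ hD hx ht h3 (by omega) h4).2 h2

theorem rule_bad_of_reach (hN : M.threshold N ≤ M.d Kind.G) {s : State m.K} (hs : 0 < μ s)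
    (hg : m.game s = some Kind.G) {k : ℕ} (hk : k < N) {s' : State m.K}
    (h : 0 < (M.trans m ^ k) s s') : m.rule s' Kind.B = 1 := by
  obtain ⟨h3, h4⟩ := hw.reach hD hx ht hN hs hg hk.le s' h
  have e : N - k = (N - (k + 1)) + 1 := by omega
  rw [e] at h4
  exact (hw.chord_succ hD hx ht (s' := s') h3 (by omega) h4).1

/-- The bad task is assigned in the `N` periods after a good game. -/
theorem taskProb_bad (hN : M.threshold N ≤ M.d Kind.G) {s : State m.K} (hs : 0 < μ s)
    (hg : m.game s = some Kind.G) {k : ℕ} (hk : k < N) : M.taskProb m s k Kind.B = 1 := by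
  rw [taskProb, ← M.sum_trans_pow k s]
  refine Finset.sum_congr rfl fun s' _ => ?_
  rcases (M.trans_pow_nonneg k s s').eq_or_lt with h | h
  · rw [← h, zero_mul]
  · rw [hw.rule_bad_of_reach hD hx ht hN hs hg hk h, mul_one]

/-- During the certain bad periods the net potential is one plus the expected potential, so
tightness makes each period cost exactly one. -/
theorem sum_potential (hN : M.threshold N ≤ M.d Kind.G) {s : State m.K} (hs : 0 < μ s)
    (hg : m.game s = some Kind.G) {k : ℕ} (hk : k ≤ N) :
    ∑ s', (M.trans m ^ k) s s' * M.potential N (w s') = M.potential N (M.d Kind.G) - k := by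
  induction k with
  | zero => simp [Matrix.one_apply, hw.binding hD hx ht hs hg]
  | succ k ih =>
    have h1 := ih (by omega)
    have h2 : ∑ s', (M.trans m ^ k) s s' * M.potential N (w s') =
        ∑ s', ((M.trans m ^ k) s s' + (M.trans m ^ k) s s' *
          ∑ e, M.nextProb m s' e * M.potential N (w (s'.push e))) := by
      refine Finset.sum_congr rfl fun s' _ => ?_
      rcases (M.trans_pow_nonneg k s s').eq_or_lt with h | h
      · rw [← h]; ring
      have hb := hw.rule_bad_of_reach hD hx ht hN hs hg (by omega) h
      have hr := rule_sum s'
      have hg0 : m.rule s' Kind.G = 0 := by linarith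
      obtain ⟨h3, -⟩ := hw.reach hD hx ht hN hs hg (by omega) s' h
      rw [← hw.net_eq hD hx ht h3, net, netPotential, M.sum_nextProb_mul, hb, hg0]
      ring
    rw [M.sum_trans_pow_succ_mul]
    rw [h2, Finset.sum_add_distrib, M.sum_trans_pow] at h1
    push_cast
    linarith

/-- The good task is assigned with positive probability after `N` periods on the bad task. -/
theorem taskProb_good_pos (hN : M.threshold N ≤ M.d Kind.G)
    (hN' : M.d Kind.G < M.threshold (N + 1)) {s : State m.K} (hs : 0 < μ s)
    (hg : m.game s = some Kind.G) : 0 < M.taskProb m s N Kind.G := by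
  have hnn : ∀ s' ∈ Finset.univ, 0 ≤ (M.trans m ^ N) s s' * m.rule s' Kind.G := fun s' _ =>
    mul_nonneg (M.trans_pow_nonneg _ _ _) (rule_nonneg _ _)
  refine (Finset.sum_nonneg hnn).lt_of_ne fun h0 => ?_
  have hz := (Finset.sum_eq_zero_iff_of_nonneg hnn).1 h0.symm
  have h1 := hw.sum_potential hD hx ht hN hs hg le_rfl
  -- If the good task were never assigned now, the bad task would be certain in each reachable
  -- state, and the potential there at least one.
  have h2 : 1 ≤ ∑ s', (M.trans m ^ N) s s' * M.potential N (w s') := by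
    rw [← M.sum_trans_pow N s]
    refine Finset.sum_le_sum fun s' _ => ?_
    rcases (M.trans_pow_nonneg N s s').eq_or_lt with h | h
    · rw [← h, zero_mul]
    · have hg0 := (mul_eq_zero.1 (hz s' (Finset.mem_univ s'))).resolve_left h.ne'
      obtain ⟨h3, -⟩ := hw.reach hD hx ht hN hs hg le_rfl s' h
      have h4 := hw.rule_bad_le hD hx ht h3
      have h5 := rule_sum s'
      exact le_mul_of_one_le_right h.le (by linarith)
  -- But `d_G` lies strictly below `threshold (N + 1)`, so less than one unit of potential is left.
  have h3 : M.chord N (M.d Kind.G) < N + 1 := by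
    have h4 : M.chord N (M.threshold (N + 1)) = N + 1 := by
      rw [chord, M.threshold_succ_sub, div_self (mul_pos hD (pow_pos M.δ_pos N)).ne']
    exact h4 ▸ M.chord_mono hD N hN'
  rw [M.potential_d hD hN] at h1
  linarith

/-- If the good task is not assigned then, it is assigned in the next period. -/
theorem rule_good_of_bad (hN : M.threshold N ≤ M.d Kind.G) {s s' : State m.K} (hs : 0 < μ s)
    (hg : m.game s = some Kind.G) (h : 0 < (M.trans m ^ (N + 1)) s s')
    (hB : m.task s' = Kind.B) : m.rule s' Kind.G = 1 := by
  obtain ⟨s'', h1, h2⟩ := M.exists_of_trans_pow_succ_pos h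
  obtain ⟨h3, h4⟩ := hw.reach hD hx ht hN hs hg le_rfl s'' h1
  rw [Nat.sub_self] at h4
  exact hw.rule_good_of_potential_zero hD hx ht (hw.steady.pos_of_trans_pos M h3 h2)
    (hw.chord_zero hD hx ht h3 h4 h2 hB)

end Tight

end IsPromise

end Model

/-! ### Grim trigger, full cooperation and existence of steady states. -/

namespace Model

variable (M : Model) {m : Assignment}

section Grim

/-- Everybody has always cooperated. -/
def Clean (s : State m.K) : List ((Fin M.n → Act) × (Task × Option Game)) → Prop
  | [] => True
  | x :: l => Clean s l ∧ (Hist.game ((s, l) : M.Hist m) ≠ none → x.1 = allC)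

open Classical in
/-- Grim-trigger strategies. -/
noncomputable def grim (m : Assignment) : M.Profile m := fun _ h =>
  if M.Clean h.1 h.2 then 1 else 0

open Classical in
/-- Values of grim-trigger strategies. -/
noncomputable def grimValue (A J : State m.K → ℝ) (h : M.Hist m) : ℝ :=
  A h.state + if M.Clean h.1 h.2 then J h.state else 0

variable {r : ℝ} (hr : r ∈ Set.Icc (0 : ℝ) 1) {A J : State m.K → ℝ}
  (hA : M.IsDiscounted m ((1 - r) * M.δ) (fun s => M.autarky (m.game s)) A)
  (hJ : M.IsDiscounted m ((1 - r) * M.δ) (fun s => M.gain (m.game s)) J)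

include hr hA hJ

/-- Clean histories persist under the prescribed play and unclean ones are absorbing, so each phase
has state-dependent stage payoffs. -/
theorem value_grim (i : Fin M.n) (h : M.Hist m) :
    M.value r (M.grim m) i h = M.grimValue A J h := by
  unfold grimValue
  by_cases hc : M.Clean h.1 h.2
  · rw [if_pos hc]
    refine M.value_of_cooperation hr hA hJ (P := fun h => M.Clean h.1 h.2) ?_ ?_ i hc
    · refine fun h a e hh ha _ => ⟨hh, fun hne => ?_⟩
      obtain ⟨g, hg⟩ := Option.ne_none_iff_exists'.1 hne
      by_contra hne'
      have hone : ∀ i, M.grim m i h = 1 := fun i => by simp [grim, hh]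
      rw [M.playProb_of_allC (h := h) hg hone, if_neg hne'] at ha
      exact lt_irrefl _ ha
    · intro h hh _ i
      simp [grim, hh]
  · rw [if_neg hc, add_zero]
    refine M.value_of_stage hr hA (P := fun h => ¬ M.Clean h.1 h.2)
      (fun h a e hh _ _ hcon => hh hcon.1) (fun h hh => ?_) hc
    change _ = M.autarky h.game
    cases hg : h.game with
    | none => rw [M.stage_of_pure (M.playProb_of_none hg), M.stagePayoff_none hg]; rfl
    | some g =>
      rw [M.stage_of_pure (M.playProb_pure hg (a₀ := allN) fun i => by simp [grim, hh, allN]),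
        M.stagePayoff_some hg, M.payoff_allN]; rfl

variable (hd : ∀ s g, m.game s = some g → M.d g ≤ M.continuation m ((1 - r) * M.δ) J s)

include hd

theorem isSPE_grim : M.IsSPE r (M.grim m) := by
  classical
  intro h i ρ
  rw [M.value_grim hr hA hJ]
  set τ := Function.update (M.grim m) i ρ with hτ
  obtain ⟨C, hC⟩ := M.exists_value_bound hr τ i
  obtain ⟨C', hC'⟩ := M.exists_value_bound hr (M.grim m) i
  simp only [M.value_grim hr hA hJ] at hC'
  refine sub_nonpos.1 (M.nonpos_of_le_discount_nextExp (M.discount_nonneg hr)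
    (M.discount_lt_one hr) (σ := τ) (P := fun _ => True) (fun _ _ _ _ _ _ => trivial)
    (f := fun h => M.value r τ i h - M.grimValue A J h) (C := C + C')
    (fun h _ => (le_abs_self _).trans ((abs_sub _ _).trans (add_le_add (hC h) (hC' h))))
    (fun h _ => ?_) h trivial)
  rw [M.nextExp_sub, M.value_eq hr τ i h]
  -- One-shot deviation principle: no gain from one period of `τ` followed by `grimValue` suffices,
  -- as discounting removes the rest.
  suffices hs : ∑ a, M.playProb τ h a * M.stagePayoff h i a +
      (1 - r) * M.δ * M.nextExp τ h (M.grimValue A J) ≤ M.grimValue A J h by linarith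
  set φ : (Fin M.n → Act) → ℝ := fun a => M.stagePayoff h i a +
    (1 - r) * M.δ * ∑ e, M.nextProb m h.state e * M.grimValue A J (h.extend a e) with hφ
  have e1 : ∑ a, M.playProb τ h a * M.stagePayoff h i a +
      (1 - r) * M.δ * M.nextExp τ h (M.grimValue A J) = ∑ a, M.playProb τ h a * φ a := by
    simp only [hφ, mul_add, Finset.sum_add_distrib, nextExp, Finset.mul_sum]
    congr 1
    exact Finset.sum_congr rfl fun a _ => Finset.sum_congr rfl fun e _ => by ring
  rw [e1]
  have hA' := hA h.state
  have hJ' := hJ h.state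
  change _ = M.autarky h.game + _ at hA'
  change _ = M.gain h.game + _ at hJ'
  have hpos : ∀ a e, (M.Clean h.1 h.2 ∧ (h.game ≠ none → a = allC)) →
      M.grimValue A J (h.extend a e) = A (h.state.push e) + J (h.state.push e) :=
    fun a e hc => congrArg _ (if_pos hc)
  have hneg : ∀ a e, ¬ (M.Clean h.1 h.2 ∧ (h.game ≠ none → a = allC)) →
      M.grimValue A J (h.extend a e) = A (h.state.push e) := fun a e hc =>
    (congrArg _ (if_neg hc)).trans (add_zero _)
  have hUc : M.Clean h.1 h.2 → M.grimValue A J h = A h.state + J h.state := fun hc =>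
    congrArg _ (if_pos hc)
  have hUn : ¬ M.Clean h.1 h.2 → M.grimValue A J h = A h.state := fun hc =>
    (congrArg _ (if_neg hc)).trans (add_zero _)
  cases hg : h.game with
  | none =>
    simp only [M.playProb_none hg, ite_mul, one_mul, zero_mul, Finset.sum_ite_eq',
      Finset.mem_univ, if_true, hφ, M.stagePayoff_none hg]
    rw [hg] at hA' hJ'
    simp only [autarky_none, gain_none, zero_add] at hA' hJ'
    by_cases hc : M.Clean h.1 h.2
    · simp only [hpos allN _ ⟨hc, fun hne => absurd hg hne⟩, hUc hc, mul_add,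
        Finset.sum_add_distrib]
      linarith
    · simp only [hneg allN _ (fun hcon => hc hcon.1), hUn hc]
      linarith
  | some g =>
    have hdg : M.d g ≤ M.continuation m ((1 - r) * M.δ) J h.state := hd h.state g hg
    unfold continuation at hdg
    rw [hg, autarky_some] at hA'
    rw [hg, gain_some] at hJ'
    -- The payoff is affine in the own probability of cooperating, so the two pure actions decide.
    rw [M.sum_playProb_split (σ := M.grim m) hg i
      (fun j hj => by rw [hτ, Function.update_of_ne hj])]
    have h0 := (τ i h).2.1
    have h1 := (τ i h).2.2
    have hne : (Function.update allC i Act.N : Fin M.n → Act) ≠ allC := fun e => by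
      have := congrFun e i
      simp [allC] at this
    by_cases hc : M.Clean h.1 h.2
    · have hp := M.playProb_of_allC hg (σ := M.grim m) (fun i => by simp [grim, hc])
      simp only [hp, ite_mul, one_mul, zero_mul, Finset.sum_ite_eq', Finset.mem_univ, if_true]
      have hC1 : φ (Function.update allC i Act.C) ≤ M.grimValue A J h := by
        have e : Function.update (allC : Fin M.n → Act) i Act.C = allC :=
          Function.update_eq_self i allC
        simp only [hφ, e, hpos allC _ ⟨hc, fun _ => rfl⟩, hUc hc, mul_add,
          Finset.sum_add_distrib, M.stagePayoff_some hg, M.payoff_allC]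
        linarith
      have hN1 : φ (Function.update allC i Act.N) ≤ M.grimValue A J h := by
        simp only [hφ, hneg _ _ (fun hcon => hne (hcon.2 (by simp [hg]))), hUc hc,
          M.stagePayoff_some hg, M.payoff_deviation]
        linarith
      nlinarith
    · have hp := M.playProb_pure hg (σ := M.grim m) (a₀ := allN)
        (fun i => by simp [grim, hc, allN])
      simp only [hp, ite_mul, one_mul, zero_mul, Finset.sum_ite_eq', Finset.mem_univ, if_true]
      have e : Function.update (allN : Fin M.n → Act) i Act.N = allN :=
        Function.update_eq_self i allN
      have hN1 : φ (Function.update allN i Act.N) ≤ M.grimValue A J h := by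
        simp only [hφ, e, hneg allN _ (fun hcon => hc hcon.1), hUn hc,
          M.stagePayoff_some hg, M.payoff_allN]
        linarith
      have hC1 : φ (Function.update allN i Act.C) ≤ M.grimValue A J h := by
        have hdom := (M.payoff_game g).dominant i allN
        rw [e, M.payoff_allN] at hdom
        simp only [hφ, hneg (Function.update allN i Act.C) _ (fun hcon => hc hcon.1), hUn hc, M.stagePayoff_some hg]
        linarith
      nlinarith

omit hd in
/-- Aggregate payoffs fall short of those of full cooperation by a nonnegative amount, which
satisfies a Bellman equation. -/
theorem shortfall_eq (σ : M.Profile m) (h : M.Hist m) :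
    ∑ i, (A h.state + J h.state - M.value r σ i h) =
      ∑ a, M.playProb σ h a * (∑ i, (M.autarky h.game + M.gain h.game - M.stagePayoff h i a)) +
      (1 - r) * M.δ * M.nextExp σ h
        (fun h => ∑ i, (A h.state + J h.state - M.value r σ i h)) := by
  rw [M.nextExp_sum, Finset.mul_sum]
  simp only [Finset.mul_sum (s := (Finset.univ : Finset (Fin M.n)))]
  rw [Finset.sum_comm, ← Finset.sum_add_distrib]
  refine Finset.sum_congr rfl fun i _ => ?_
  rw [M.nextExp_sub, M.value_eq hr σ i h]
  have hW : A h.state + J h.state = M.autarky h.game + M.gain h.game + (1 - r) * M.δ *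
      M.nextExp σ h (fun h => A h.state + J h.state) := by
    rw [M.nextExp_state σ h (fun s => A s + J s)]
    exact (hA.add M hJ) h.state
  simp only [mul_sub, Finset.sum_sub_distrib, ← Finset.sum_mul, M.sum_playProb]
  rw [hW]
  ring

omit hr hA hJ hd in
theorem stage_shortfall_nonneg (σ : M.Profile m) (h : M.Hist m) (a : Fin M.n → Act) :
    0 ≤ M.playProb σ h a *
      ∑ i, (M.autarky h.game + M.gain h.game - M.stagePayoff h i a) := by
  cases hg : h.game with
  | none => simp [M.stagePayoff_none hg]
  | some g =>
    refine mul_nonneg (M.playProb_nonneg σ h a) ?_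
    simp only [M.stagePayoff_some hg, autarky_some, gain_some, Finset.sum_sub_distrib, sub_nonneg]
    rw [← Finset.sum_congr rfl fun i _ => M.payoff_allC g i]
    by_cases ha : a = allC
    · rw [ha]
    · exact ((M.payoff_game g).allC_max a ha).le

omit hd in
theorem shortfall_nonneg (σ : M.Profile m) (h : M.Hist m) :
    0 ≤ ∑ i, (A h.state + J h.state - M.value r σ i h) := by
  choose C hC using fun i => M.exists_value_bound hr σ i
  obtain ⟨C', hC'⟩ := (Set.finite_range fun s => |A s + J s|).bddAbove
  refine neg_nonpos.1 (M.nonpos_of_le_discount_nextExp (M.discount_nonneg hr)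
    (M.discount_lt_one hr) (σ := σ) (P := fun _ => True) (fun _ _ _ _ _ _ => trivial)
    (f := fun h => -∑ i, (A h.state + J h.state - M.value r σ i h))
    (C := ∑ i, (C i + C')) (fun h _ => ?_) (fun h _ => ?_) h trivial)
  · rw [← Finset.sum_neg_distrib]
    refine Finset.sum_le_sum fun i _ => ?_
    have h1 := le_of_abs_le (hC i h)
    have h2 := neg_le_of_abs_le (hC' ⟨h.state, rfl⟩)
    linarith
  · rw [M.shortfall_eq hr hA hJ σ h]
    have h1 := Finset.sum_nonneg fun a (_ : a ∈ Finset.univ) => M.stage_shortfall_nonneg σ h a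
    have h2 := M.nextExp_sub σ h (fun _ => 0)
      (fun h => ∑ i, (A h.state + J h.state - M.value r σ i h))
    simp only [zero_sub] at h2
    rw [h2, M.nextExp_const]
    linarith

/-- If cooperation is incentive compatible in all states under the threat of autarky, then players
are fully cooperative. -/
theorem fullyCooperative_of_willing (hr1 : r < 1) {μ : State m.K → ℝ}
    (hμ : μ ∈ stdSimplex ℝ (State m.K)) : M.FullyCooperative m r μ := by
  have hβ : 0 < (1 - r) * M.δ := mul_pos (by linarith) M.δ_pos
  have hstart : ∀ s i, M.value r (M.grim m) i (s, []) = A s + J s := fun s i => by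
    rw [M.value_grim hr hA hJ, grimValue, if_pos (show M.Clean s [] from trivial)]; rfl
  have hwel : ∀ σ : M.Profile m, M.welfare r μ (M.grim m) - M.welfare r μ σ =
      ∑ s, μ s * ∑ i, (A s + J s - M.value r σ i (s, [])) := by
    intro σ
    simp only [welfare, hstart, ← Finset.sum_sub_distrib, ← mul_sub]
  have hterm : ∀ (σ : M.Profile m) s,
      0 ≤ μ s * ∑ i, (A s + J s - M.value r σ i (s, [])) := fun σ s =>
    mul_nonneg (hμ.1 s) (M.shortfall_nonneg hr hA hJ σ (s, []))
  refine ⟨⟨M.grim m, M.isSPE_grim hr hA hJ hd, fun σ _ => ?_⟩, fun σ hσ => ?_⟩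
  · have h1 := hwel σ
    have h2 := Finset.sum_nonneg fun s (_ : s ∈ Finset.univ) => hterm σ s
    linarith
  · have h1 := hwel σ
    have h2 := hσ.2 _ (M.isSPE_grim hr hA hJ hd)
    have h3 : ∑ s, μ s * ∑ i, (A s + J s - M.value r σ i (s, [])) = 0 :=
      le_antisymm (by linarith) (Finset.sum_nonneg fun s _ => hterm σ s)
    have h4 := (Finset.sum_eq_zero_iff_of_nonneg fun s _ => hterm σ s).1 h3
    -- A zero aggregate shortfall has only zero components. It passes to reachable successors
    -- because the discount factor is positive, which is where `r < 1` enters.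
    have hsplit : ∀ h : M.Hist m, ∑ i, (A h.state + J h.state - M.value r σ i h) = 0 →
        (∀ a, M.playProb σ h a *
          ∑ i, (M.autarky h.game + M.gain h.game - M.stagePayoff h i a) = 0) ∧
        ∀ a e, 0 < M.playProb σ h a → 0 < M.nextProb m h.state e →
          ∑ i, (A (h.extend a e).state + J (h.extend a e).state -
            M.value r σ i (h.extend a e)) = 0 := by
      intro h hz
      rw [M.shortfall_eq hr hA hJ σ h] at hz
      have hs1 := Finset.sum_nonneg fun a (_ : a ∈ Finset.univ) => M.stage_shortfall_nonneg σ h a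
      have hn : ∀ a e, 0 ≤ M.nextProb m h.state e * ∑ i, (A (h.extend a e).state +
          J (h.extend a e).state - M.value r σ i (h.extend a e)) := fun a e =>
        mul_nonneg (M.nextProb_nonneg _ _) (M.shortfall_nonneg hr hA hJ σ _)
      have hn2 : ∀ a ∈ Finset.univ, 0 ≤ M.playProb σ h a * ∑ e, M.nextProb m h.state e *
          ∑ i, (A (h.extend a e).state +
          J (h.extend a e).state - M.value r σ i (h.extend a e)) := fun a _ =>
        mul_nonneg (M.playProb_nonneg _ _ _) (Finset.sum_nonneg fun e _ => hn a e)
      have hs2 : 0 ≤ M.nextExp σ h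
          (fun h => ∑ i, (A h.state + J h.state - M.value r σ i h)) := Finset.sum_nonneg hn2
      have hs3 := mul_nonneg hβ.le hs2
      have z1 := (Finset.sum_eq_zero_iff_of_nonneg
        fun a (_ : a ∈ Finset.univ) => M.stage_shortfall_nonneg σ h a).1 (by linarith)
      have z2 : M.nextExp σ h
          (fun h => ∑ i, (A h.state + J h.state - M.value r σ i h)) = 0 :=
        (mul_eq_zero.1 (show (1 - r) * M.δ * _ = 0 by linarith)).resolve_left hβ.ne'
      refine ⟨fun a => z1 a (Finset.mem_univ a), fun a e ha he => ?_⟩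
      have z3 := (Finset.sum_eq_zero_iff_of_nonneg hn2).1 z2 a (Finset.mem_univ a)
      have z4 := (mul_eq_zero.1 z3).resolve_left ha.ne'
      have z5 := (Finset.sum_eq_zero_iff_of_nonneg fun e _ => hn a e).1 z4 e (Finset.mem_univ e)
      exact (mul_eq_zero.1 z5).resolve_left he.ne'
    have hpath : ∀ (s : State m.K) (l), M.OnPathAux μ σ s l →
        ∑ i, (A (Hist.state ((s, l) : M.Hist m)) + J (Hist.state ((s, l) : M.Hist m)) -
          M.value r σ i (s, l)) = 0 := by
      intro s l
      induction l with
      | nil => exact fun hs =>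
          (mul_eq_zero.1 (h4 s (Finset.mem_univ s))).resolve_left (ne_of_gt hs)
      | cons x l ih => exact fun hx => (hsplit (s, l) (ih hx.1)).2 x.1 x.2 hx.2.1 hx.2.2
    intro h hh hne i
    obtain ⟨g, hg⟩ := Option.ne_none_iff_exists'.1 hne
    have hz := (hsplit h (hpath h.1 h.2 hh)).1
    have honly : ∀ a, a ≠ allC → M.playProb σ h a = 0 := by
      intro a ha
      refine (mul_eq_zero.1 (hz a)).resolve_right (ne_of_gt ?_)
      have := (M.payoff_game g).allC_max a ha
      simp only [hg, M.stagePayoff_some hg, autarky_some, gain_some, Finset.sum_sub_distrib]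
      rw [sub_pos]
      refine this.trans_le (le_of_eq (Finset.sum_congr rfl fun i _ => M.payoff_allC g i))
    have hone : M.playProb σ h allC = 1 := by
      rw [← M.sum_playProb σ h]
      exact (Finset.sum_eq_single allC (fun a _ ha => honly a ha)
        (fun hn => absurd (Finset.mem_univ _) hn)).symm
    rw [M.playProb_some hg] at hone
    simp only [allC, if_true] at hone
    have hle : ∏ j, ((σ j h : unitInterval) : ℝ) ≤ (σ i h : ℝ) := by
      rw [← Finset.mul_prod_erase _ _ (Finset.mem_univ i)]
      exact mul_le_of_le_one_right (σ i h).2.1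
        (Finset.prod_le_one (fun j _ => (σ j h).2.1) (fun j _ => (σ j h).2.2))
    exact Subtype.ext (le_antisymm (σ i h).2.2 (hone.ge.trans hle))

end Grim

/-- Every reactive assignment has a steady state. -/
theorem exists_isSteady (m : Assignment) : ∃ μ, M.IsSteady m μ := by
  have hrow : ∀ s, ∑ s', M.trans m s s' = 1 := fun s => by
    have := M.sum_trans_pow (m := m) 1 s
    simpa using this
  -- The constant vector is fixed by the stochastic matrix, so there is also a nonzero left fixed
  -- vector, possibly with signs.
  have hdet : (M.trans m - 1).det = 0 := by
    refine Matrix.exists_mulVec_eq_zero_iff.1 ⟨fun _ => 1, fun h => ?_, ?_⟩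
    · exact one_ne_zero (congrFun h fun _ => (Kind.G, none))
    · funext s
      simp [Matrix.mulVec, dotProduct, Matrix.sub_apply, Finset.sum_sub_distrib, hrow,
        Matrix.one_apply]
  obtain ⟨v, hv0, hv⟩ := Matrix.exists_vecMul_eq_zero_iff.2 hdet
  have hv' : ∀ s', v s' = ∑ s, v s * M.trans m s s' := by
    intro s'
    have := congrFun hv s'
    rw [Matrix.vecMul_sub, Matrix.vecMul_one] at this
    exact (sub_eq_zero.1 this).symm
  -- Absolute values give a coordinatewise inequality between vectors of equal total, hence an
  -- equality; normalizing yields the steady state.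
  have hle : ∀ s' ∈ Finset.univ, |v s'| ≤ ∑ s, |v s| * M.trans m s s' := by
    intro s' _
    rw [hv' s']
    refine (Finset.abs_sum_le_sum_abs _ _).trans (le_of_eq (Finset.sum_congr rfl fun s _ => ?_))
    rw [abs_mul, abs_of_nonneg (M.trans_nonneg s s')]
  have hsum : ∑ s', |v s'| = ∑ s', ∑ s, |v s| * M.trans m s s' := by
    rw [Finset.sum_comm]
    simp only [← Finset.mul_sum, hrow, mul_one]
  have heq := (Finset.sum_eq_sum_iff_of_le hle).1 hsum
  have hS : 0 < ∑ s, |v s| := by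
    obtain ⟨s, hs⟩ := Function.ne_iff.1 hv0
    exact Finset.sum_pos' (fun _ _ => abs_nonneg _) ⟨s, Finset.mem_univ s, abs_pos.2 hs⟩
  refine ⟨fun s => |v s| / ∑ s, |v s|, ⟨fun s => div_nonneg (abs_nonneg _) hS.le, ?_⟩, ?_⟩
  · rw [← Finset.sum_div, div_self hS.ne']
  · intro s'
    change |v s'| / _ = _
    rw [heq s' (Finset.mem_univ s'), Finset.sum_div]
    exact Finset.sum_congr rfl fun s _ => by ring

end Model

/-! ### The cyclic assignment that attains the bound. -/

section Age

variable {K : ℕ}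

/-- The condition is vacuous at `K`, so the search always ends and a record without a good game has
age `K`. -/
theorem exists_age (s : State K) : ∃ j, ∀ h : j < K, (s ⟨K - 1 - j, by omega⟩).2 = some Kind.G :=
  ⟨K, fun h => absurd h (lt_irrefl K)⟩

open Classical in
/-- Number of periods since the last good game, or `K` if there is none in the record. -/
noncomputable def State.age (s : State K) : ℕ := Nat.find (exists_age s)

theorem State.age_push (hK : 0 < K) (s : State K) (e : Task × Option Game) :
    (s.push e).age = if e.2 = some Kind.G then 0 else min (s.age + 1) K := by
  have h0 : ∀ h : 0 < K, (s.push e ⟨K - 1 - 0, by omega⟩) = e := fun h => by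
    simp only [State.push]; rw [dif_neg (by omega)]
  have hs : ∀ j, ∀ h : j + 1 < K, (s.push e ⟨K - 1 - (j + 1), by omega⟩) =
      s ⟨K - 1 - j, by omega⟩ := fun j h => by
    simp only [State.push]
    rw [dif_pos (by omega)]
    congr 2
    omega
  classical
  unfold State.age
  split_ifs with he
  · exact (Nat.find_eq_zero _).2 fun h => by rw [h0 h, he]
  · refine (Nat.find_eq_iff _).2 ⟨fun h => ?_, fun j hj hcon => ?_⟩
    · have h2 : Nat.find (exists_age s) + 1 < K := by omega
      have h1 : min (Nat.find (exists_age s) + 1) K = Nat.find (exists_age s) + 1 := by omega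
      simp only [h1]
      rw [hs _ h2]
      exact Nat.find_spec (exists_age s) (by omega)
    · have hjK : j < K := by omega
      cases j with
      | zero => exact he (by rw [← h0 hK]; exact hcon hjK)
      | succ j =>
        refine Nat.find_min (exists_age s) (m := j) (by omega) fun h => ?_
        rw [← hs j hjK]
        exact hcon hjK

theorem Assignment.age_eq_zero {m : Assignment} {s : State m.K} (h : m.game s = some Kind.G) :
    s.age = 0 := by
  classical
  exact (Nat.find_eq_zero _).2 fun _ => h

end Age

namespace Model

variable (M : Model)

/-- Probability of the good task `j` periods after the last good game, if the bad task is assigned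
for `N` periods and then with probability `y` for one more. -/
noncomputable def goodProb (N : ℕ) (y : ℝ) (j : ℕ) : ℝ :=
  if j < N then 0 else if j = N then 1 - y else 1

/-- The reactive assignment, with memory `K`, that assigns the bad task for `N` periods after a
good game and then with probability `y` for one more period, and the good task otherwise. -/
noncomputable def cyclic (N : ℕ) (y : ℝ) (hy : y ∈ Set.Icc (0 : ℝ) 1) (K : ℕ) (hK : 0 < K) :
    Assignment where
  K := K
  K_pos := hK
  rule s t := if t = Kind.G then goodProb N y s.age else 1 - goodProb N y s.age
  rule_mem s := by
    have h : 0 ≤ goodProb N y s.age ∧ goodProb N y s.age ≤ 1 := by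
      unfold goodProb
      split_ifs
      exacts [⟨le_rfl, zero_le_one⟩, ⟨by linarith [hy.2], by linarith [hy.1]⟩,
        ⟨zero_le_one, le_rfl⟩]
    refine ⟨fun t => ?_, ?_⟩
    · dsimp only
      split_ifs
      exacts [h.1, by linarith [h.2]]
    · rw [Kind.sum_univ]; simp

/-- Continuation value `j` periods after the last good game. -/
noncomputable def ageValue (N : ℕ) (y : ℝ) (j : ℕ) : ℝ :=
  if j ≤ N then M.threshold (N - j) + M.gap * M.δ ^ (N - j) * y else M.goodValue

/-- Expected number of periods on the bad task still to come, `j` periods after the last good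
game. -/
noncomputable def agePotential (N : ℕ) (y : ℝ) (j : ℕ) : ℝ :=
  if j ≤ N then (N : ℝ) - j + y else 0

/-- Only good games reset the age, so both outcomes of a bad period continue at `j + 1`. The promise
after a good game is entered as `d_G`, which `ageValue` at 0 equals once `y` is calibrated. -/
theorem ageValue_eq (N : ℕ) (y : ℝ) (j : ℕ) : M.ageValue N y j =
    goodProb N y j * M.goodPromise (M.d Kind.G) (M.ageValue N y (j + 1)) +
      (1 - goodProb N y j) *
        M.badPromise (M.ageValue N y (j + 1)) (M.ageValue N y (j + 1)) := by
  have hx := M.goodValue_eq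
  rcases lt_trichotomy j N with h | rfl | h
  · have e : N - j = (N - (j + 1)) + 1 := by omega
    simp only [ageValue, goodProb, if_pos h, if_pos h.le, if_pos (show j + 1 ≤ N from h), e,
      threshold, badPromise]
    ring
  · simp only [ageValue, goodProb, lt_irrefl, if_false, le_refl, if_true, goodPromise, badPromise,
      if_neg (show ¬ j + 1 ≤ j by omega), Nat.sub_self, threshold, gap]
    linear_combination (1 - y) * hx
  · simp only [ageValue, goodProb, if_neg (show ¬ j < N by omega), if_neg (show ¬ j = N by omega),
      if_neg (show ¬ j ≤ N by omega), if_neg (show ¬ j + 1 ≤ N by omega), goodPromise]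
    linear_combination hx

/-- The count stops at the next good game, so the branch in which one arrives contributes nothing.
-/
theorem agePotential_eq (N : ℕ) (y : ℝ) (j : ℕ) : agePotential N y j =
    goodProb N y j * (1 - M.a Kind.G) * agePotential N y (j + 1) +
      (1 - goodProb N y j) * (1 + agePotential N y (j + 1)) := by
  rcases lt_trichotomy j N with h | rfl | h
  · simp only [agePotential, goodProb, if_pos h, if_pos h.le, if_pos (show j + 1 ≤ N from h)]
    push_cast
    ring
  · simp [agePotential, goodProb]
  · simp [agePotential, goodProb, show ¬ j < N by omega, show ¬ j = N by omega,
      show ¬ j ≤ N by omega, show ¬ j + 1 ≤ N by omega]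

/-- Truncating the age at `K` is invisible to functions that are constant beyond `N`, provided the
memory exceeds `N`. -/
theorem comp_age_push {K N : ℕ} {f : ℕ → ℝ} {z : ℝ} (hf : ∀ j, N < j → f j = z) (hK : N < K)
    (s : State K) (e : Task × Option Game) :
    f (s.push e).age = if e.2 = some Kind.G then f 0 else f (s.age + 1) := by
  rw [State.age_push (by omega)]
  split_ifs
  · rfl
  · rcases le_total (s.age + 1) K with h | h
    · rw [min_eq_left h]
    · rw [min_eq_right h, hf K hK, hf _ (by omega)]

/-- Under the assumptions on payoffs, there are fully cooperative teams, of arbitrarily long memory,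
for which the bound on the time on the good task is attained. -/
theorem exists_efficient (hD : 0 < M.gap) (hdB : M.d Kind.B ≤ M.goodValue) {N : ℕ}
    (hN : M.threshold N ≤ M.d Kind.G) (hN' : M.d Kind.G < M.threshold (N + 1)) {K : ℕ}
    (hK : N < K) : ∃ m : Assignment, m.K = K ∧ ∃ μ, M.IsSteady m μ ∧
      share m μ Kind.B = M.potential N (M.d Kind.G) * M.a Kind.G * share m μ Kind.G ∧
      M.FullyCooperative m 0 μ := by
  have hpow : 0 < M.gap * M.δ ^ N := mul_pos hD (pow_pos M.δ_pos N)
  -- The probability of the extra bad period interpolates between the two thresholds around `d_G`,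
  -- so that the promise after a good game is exactly `d_G`.
  set y := (M.d Kind.G - M.threshold N) / (M.gap * M.δ ^ N) with hy
  have hy0 : 0 ≤ y := div_nonneg (by linarith) hpow.le
  have hy1 : y ≤ 1 := by
    rw [hy, div_le_one hpow, ← M.threshold_succ_sub]; linarith
  have hyd : M.threshold N + M.gap * M.δ ^ N * y = M.d Kind.G := by
    rw [hy, mul_div_cancel₀ _ hpow.ne']; ring
  have hκ : M.potential N (M.d Kind.G) = N + y := M.potential_d hD hN
  have hv0 : M.ageValue N y 0 = M.d Kind.G := by simp [ageValue, hyd]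
  have hvge : ∀ j, M.goodValue ≤ M.ageValue N y j := by
    intro j
    unfold ageValue
    split_ifs
    · have h1 : M.goodValue ≤ M.threshold (N - j) :=
        (M.threshold_strictMono hD).monotone (Nat.zero_le (N - j))
      have h2 := mul_nonneg (mul_pos hD (pow_pos M.δ_pos (N - j))).le hy0
      linarith
    · exact le_rfl
  have hvc : ∀ j, N < j → M.ageValue N y j = M.goodValue := fun j hj => if_neg (by omega)
  have hpc : ∀ j, N < j → agePotential N y j = 0 := fun j hj => if_neg (by omega)
  set m := cyclic N y ⟨hy0, hy1⟩ K (by omega) with hm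
  have hrG : ∀ s : State m.K, m.rule s Kind.G = goodProb N y s.age := fun s => rfl
  have hrB : ∀ s : State m.K, m.rule s Kind.B = 1 - goodProb N y s.age := fun s => rfl
  have hvp : ∀ (s : State m.K) (e : Task × Option Game), M.ageValue N y (s.push e).age =
      if e.2 = some Kind.G then M.ageValue N y 0 else M.ageValue N y (s.age + 1) :=
    fun s e => comp_age_push hvc hK s e
  have hpp : ∀ (s : State m.K) (e : Task × Option Game), agePotential N y (s.push e).age =
      if e.2 = some Kind.G then agePotential N y 0 else agePotential N y (s.age + 1) :=
    fun s e => comp_age_push hpc hK s e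
  refine ⟨m, rfl, ?_⟩
  obtain ⟨μ, hμ⟩ := M.exists_isSteady m
  refine ⟨μ, hμ, ?_, ?_⟩
  · have h1 := hμ.sum_mul M (fun s => agePotential N y s.age)
    simp only [hpp, M.sum_nextProb_mul] at h1
    have h2 : ∀ s : State m.K, μ s * agePotential N y s.age = μ s *
        (goodProb N y s.age * (1 - M.a Kind.G) * agePotential N y (s.age + 1) +
        (1 - goodProb N y s.age) * (1 + agePotential N y (s.age + 1))) := fun s => by
      rw [M.agePotential_eq N y s.age]
    rw [Finset.sum_congr rfl fun s _ => h2 s] at h1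
    have h3 : (0 : ℝ) = ∑ s, (μ s * m.rule s Kind.B -
        M.potential N (M.d Kind.G) * M.a Kind.G * (μ s * m.rule s Kind.G)) := by
      rw [← sub_eq_zero.2 h1, ← Finset.sum_sub_distrib]
      refine Finset.sum_congr rfl fun s _ => ?_
      have h0 : agePotential N y 0 = N + y := by simp [agePotential]
      simp only [if_true, reduceCtorEq, if_false, Option.some.injEq, h0, hκ, hrG, hrB]
      ring
    rw [Finset.sum_sub_distrib, ← Finset.mul_sum, ← M.share_eq_sum_rule hμ,
      ← M.share_eq_sum_rule hμ] at h3
    linarith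
  · have hr : (0 : ℝ) ∈ Set.Icc (0 : ℝ) 1 := ⟨le_rfl, zero_le_one⟩
    obtain ⟨A, hA⟩ := M.exists_discounted m (M.discount_nonneg hr) (M.discount_lt_one hr)
      (fun s => M.autarky (m.game s))
    have hcont : ∀ s : State m.K, M.continuation m ((1 - 0) * M.δ)
        (fun s => M.gain (m.game s) + M.ageValue N y s.age) s = M.ageValue N y s.age := by
      intro s
      rw [M.ageValue_eq N y s.age, continuation]
      simp only [m.game_push, hvp, M.sum_nextProb_mul, hrG, hrB, hv0]
      simp only [if_true, reduceCtorEq, if_false, Option.some.injEq, gain_some, gain_none,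
        goodPromise, badPromise]
      ring
    refine M.fullyCooperative_of_willing hr hA (J := fun s => M.gain (m.game s) +
      M.ageValue N y s.age) (fun s => ?_) (fun s g hg => ?_) zero_lt_one hμ.1
    · exact congrArg _ (hcont s).symm
    · rw [hcont s]
      cases g with
      | G => rw [Assignment.age_eq_zero hg, hv0]
      | B => exact hdB.trans (hvge _)

end Model

/-! ### Social values and perturbations of optimal team structures. -/

namespace Model

variable (M : Model) {m : Assignment}

theorem onPath_nil {μ : State m.K → ℝ} (σ : M.Profile m) {s : State m.K} (hs : 0 < μ s) :
    M.OnPath μ σ (s, []) := hs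

theorem OnPath.state_pos {μ : State m.K → ℝ} (hμ : M.IsSteady m μ) {σ : M.Profile m}
    {h : M.Hist m} (hh : M.OnPath μ σ h) : 0 < μ h.state := by
  obtain ⟨s, l⟩ := h
  induction l with
  | nil => exact hh
  | cons x l ih => exact hμ.pos_of_trans_pos M (ih hh.1) (M.trans_push_pos hh.2.2)

/-- Minimum principle: at a minimizing state the discounted expectation is at least `β` times the
minimum. -/
theorem IsDiscounted.nonneg {β : ℝ} (hβ : 0 ≤ β) (hβ1 : β < 1) {u W : State m.K → ℝ}
    (hW : M.IsDiscounted m β u W) (hu : ∀ s, 0 ≤ u s) (s : State m.K) : 0 ≤ W s := by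
  have : Nonempty (State m.K) := ⟨s⟩
  obtain ⟨s₀, hs₀⟩ := Finite.exists_min W
  refine le_trans ?_ (hs₀ s)
  have h1 : W s₀ ≤ ∑ e, M.nextProb m s₀ e * W (s₀.push e) := by
    rw [← one_mul (W s₀), ← M.sum_nextProb s₀, Finset.sum_mul]
    exact Finset.sum_le_sum fun e _ => mul_le_mul_of_nonneg_left (hs₀ _) (M.nextProb_nonneg _ _)
  have h2 := hW s₀
  have h3 := hu s₀
  nlinarith [mul_le_mul_of_nonneg_left h1 hβ]

theorem gain_nonneg (o : Option Game) : 0 ≤ M.gain o := by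
  cases o with
  | none => exact le_rfl
  | some g => exact (M.c_pos g).le

/-- Continuation values of fully cooperative teams are promises. -/
theorem FullyCooperative.isPromise {r : ℝ} (hr : r ∈ Set.Icc (0 : ℝ) 1) {μ : State m.K → ℝ}
    (hμ : M.IsSteady m μ) (hm : M.FullyCooperative m r μ) {A J : State m.K → ℝ}
    (hA : M.IsDiscounted m ((1 - r) * M.δ) (fun s => M.autarky (m.game s)) A)
    (hJ : M.IsDiscounted m ((1 - r) * M.δ) (fun s => M.gain (m.game s)) J) :
    M.IsPromise m ((1 - r) * M.δ) μ (M.continuation m ((1 - r) * M.δ) J) where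
  steady := hμ
  discount_nonneg := M.discount_nonneg hr
  discount_le := M.discount_le hr
  eq s := by
    have h : ∀ e, M.gain e.2 + M.continuation m ((1 - r) * M.δ) J (s.push e) =
        J (s.push e) := fun e => by
      have h1 : J (s.push e) = M.gain (m.game (s.push e)) + _ := hJ (s.push e)
      rw [h1, m.game_push]; rfl
    simp only [h]; rfl
  nonneg s := mul_nonneg (M.discount_nonneg hr) (Finset.sum_nonneg fun e _ =>
    mul_nonneg (M.nextProb_nonneg _ _) (hJ.nonneg M (M.discount_nonneg hr)
      (M.discount_lt_one hr) (fun _ => M.gain_nonneg _) _))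
  willing s hs hg := by
    obtain ⟨σ, hσ⟩ := hm.1
    exact IsSPE.temptation_le M hr hA hJ hσ.1 (hm.2 σ hσ) (M.onPath_nil σ hs) hg

theorem socialValue_of_fullyCooperative {r : ℝ} {μ : State m.K → ℝ} (hμ : M.IsSteady m μ)
    (hm : M.FullyCooperative m r μ) : M.socialValue m r μ =
      M.V Kind.G * (M.a Kind.G * share m μ Kind.G) +
        M.V Kind.B * (M.a Kind.B * share m μ Kind.B) := by
  rw [← M.sum_game_eq hμ, ← M.sum_game_eq hμ, Finset.mul_sum, Finset.mul_sum,
    ← Finset.sum_add_distrib]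
  refine Finset.sum_congr rfl fun s _ => ?_
  cases hg : m.game s with
  | none => simp
  | some g =>
    have hc : M.CooperationIn m r μ s := ⟨hm.1, fun σ hσ h hh hs i => by
      refine hm.2 σ hσ h hh ?_ i
      rw [Hist.game, hs, hg]; simp⟩
    simp only [if_pos hc]
    cases g <;> simp [mul_comm]

theorem socialValue_of_fullyNonCooperative {r : ℝ} {μ : State m.K → ℝ}
    (hμ : M.IsSteady m μ) (hm : M.FullyNonCooperative m r μ) : M.socialValue m r μ = 0 := by
  refine Finset.sum_eq_zero fun s _ => ?_
  cases hg : m.game s with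
  | none => rfl
  | some g =>
    dsimp only
    split_ifs with hc
    · rcases (hμ.1.1 s).eq_or_lt with hs | hs
      · rw [← hs, zero_mul]
      · obtain ⟨σ, hσ⟩ := hc.1
        have h1 := hc.2 σ hσ (s, []) (M.onPath_nil σ hs) rfl M.player
        have h2 := hm.2 σ hσ (s, []) (M.onPath_nil σ hs)
          (by change m.game s ≠ none; simp [hg]) M.player
        rw [h1] at h2
        exact absurd h2 one_ne_zero
    · rfl

/-- The reactive assignment, with memory `K + 1`, that always assigns the task `t`. -/
def constant (t : Task) (K : ℕ) : Assignment where
  K := K + 1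
  K_pos := Nat.succ_pos K
  rule _ t' := if t' = t then 1 else 0
  rule_mem s := by
    refine ⟨fun t' => ?_, ?_⟩
    · dsimp only; split_ifs <;> norm_num
    · simp

theorem share_constant {t : Task} {K : ℕ} {μ : State (constant t K).K → ℝ}
    (hμ : M.IsSteady (constant t K) μ) (t' : Task) :
    share (constant t K) μ t' = if t' = t then 1 else 0 := by
  rw [M.share_eq_sum_rule hμ]
  change ∑ s, μ s * (if t' = t then 1 else 0) = _
  rw [← Finset.sum_mul, hμ.1.2, one_mul]

/-- Fully non-cooperative teams exist on each task. -/
theorem exists_idle (t : Task) (K : ℕ) : ∃ m : Assignment, m.K = K + 1 ∧ ∃ μ, M.IsSteady m μ ∧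
    (∀ t', share m μ t' = if t' = t then 1 else 0) ∧ M.FullyNonCooperative m 1 μ := by
  obtain ⟨μ, hμ⟩ := M.exists_isSteady (constant t K)
  exact ⟨constant t K, rfl, μ, hμ, M.share_constant hμ, M.fullyNonCooperative_one _ _⟩

namespace TeamStructure

variable {M}

open Classical in
/-- A team structure given by weights that may vanish. -/
theorem exists_of_weights (S : Finset Assignment) (p : Assignment → ℝ) (hp : ∀ m ∈ S, 0 ≤ p m)
    (hsum : ∑ m ∈ S, p m = 1) (rate : Assignment → ℝ)
    (hr : ∀ m ∈ S, rate m ∈ Set.Icc (0 : ℝ) 1) (μ : (m : Assignment) → State m.K → ℝ)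
    (hμ : ∀ m ∈ S, M.IsSteady m (μ m))
    (hq : ∑ m ∈ S, p m * share m (μ m) Kind.G = M.q Kind.G) :
    ∃ L : M.TeamStructure, L.IsFeasible ∧ L.rate = rate ∧
      L.socialValue = ∑ m ∈ S, p m * M.socialValue m (rate m) (μ m) := by
  -- A team structure needs positive weights; dropping the assignments of weight zero changes no
  -- weighted sum.
  have hfilter : ∀ f : Assignment → ℝ,
      ∑ m ∈ S.filter (fun m => 0 < p m), p m * f m = ∑ m ∈ S, p m * f m := fun f => by
    refine Finset.sum_subset (Finset.filter_subset _ _) fun m hm hn => ?_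
    have h1 : ¬ 0 < p m := fun h => hn (Finset.mem_filter.2 ⟨hm, h⟩)
    rw [le_antisymm (not_lt.1 h1) (hp m hm), zero_mul]
  have h1 : ∑ m ∈ S, p m * 1 = 1 := by simpa using hsum
  let L : M.TeamStructure :=
    { support := S.filter fun m => 0 < p m
      weight := p
      weight_pos := fun m hm => (Finset.mem_filter.1 hm).2
      weight_sum := by simpa using (hfilter fun _ => 1).trans h1
      rate := rate
      rate_mem := fun m hm => hr m (Finset.mem_filter.1 hm).1
      steady := μ
      steady_isSteady := fun m hm => hμ m (Finset.mem_filter.1 hm).1 }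
  refine ⟨L, fun t => ?_, rfl, hfilter _⟩
  change ∑ m ∈ S.filter (fun m => 0 < p m), p m * share m (μ m) t = M.q t
  rw [hfilter]
  cases t with
  | G => exact hq
  | B =>
    have h2 : ∑ m ∈ S, p m * share m (μ m) Kind.B =
        ∑ m ∈ S, p m - ∑ m ∈ S, p m * share m (μ m) Kind.G := by
      rw [← Finset.sum_sub_distrib]
      refine Finset.sum_congr rfl fun m hm => ?_
      linear_combination p m * share_sum (hμ m hm).1
    have h3 := M.q_sum
    rw [Kind.sum_univ] at h3
    rw [h2, hsum, hq]
    linarith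

/-- Reweighting an optimal team structure, with two new assignments, does not raise its value. -/
theorem IsOptimal.perturb {L : M.TeamStructure} (hL : L.IsOptimal) {m₁ m₂ : Assignment}
    (h₁ : m₁ ∉ L.support) (h₂ : m₂ ∉ L.support) (h₁₂ : m₁ ≠ m₂) {r₁ r₂ : ℝ}
    (hr₁ : r₁ ∈ Set.Icc (0 : ℝ) 1) (hr₂ : r₂ ∈ Set.Icc (0 : ℝ) 1) {μ₁ : State m₁.K → ℝ}
    {μ₂ : State m₂.K → ℝ} (hμ₁ : M.IsSteady m₁ μ₁) (hμ₂ : M.IsSteady m₂ μ₂) {ε : Assignment → ℝ}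
    {x₁ x₂ : ℝ} (hx₁ : 0 ≤ x₁) (hx₂ : 0 ≤ x₂) (hε : ∀ m ∈ L.support, 0 ≤ L.weight m + ε m)
    (hsum : ∑ m ∈ L.support, ε m + x₁ + x₂ = 0)
    (hshare : ∑ m ∈ L.support, ε m * share m (L.steady m) Kind.G + x₁ * share m₁ μ₁ Kind.G +
      x₂ * share m₂ μ₂ Kind.G = 0) :
    ∑ m ∈ L.support, ε m * M.socialValue m (L.rate m) (L.steady m) +
      x₁ * M.socialValue m₁ r₁ μ₁ + x₂ * M.socialValue m₂ r₂ μ₂ ≤ 0 := by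
  classical
  set p : Assignment → ℝ :=
    Function.update (Function.update (fun m => L.weight m + ε m) m₂ x₂) m₁ x₁ with hp
  set rate : Assignment → ℝ := Function.update (Function.update L.rate m₂ r₂) m₁ r₁ with hrate
  set μ : (m : Assignment) → State m.K → ℝ :=
    Function.update (Function.update L.steady m₂ μ₂) m₁ μ₁ with hμ
  have p₁ : p m₁ = x₁ := Function.update_self ..
  have p₂ : p m₂ = x₂ := by rw [hp, Function.update_of_ne h₁₂.symm, Function.update_self]
  have rate₁ : rate m₁ = r₁ := Function.update_self ..
  have rate₂ : rate m₂ = r₂ := by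
    rw [hrate, Function.update_of_ne h₁₂.symm, Function.update_self]
  have mu₁ : μ m₁ = μ₁ := Function.update_self ..
  have mu₂ : μ m₂ = μ₂ := by rw [hμ, Function.update_of_ne h₁₂.symm, Function.update_self]
  have hold : ∀ m ∈ L.support, p m = L.weight m + ε m ∧ rate m = L.rate m ∧
      μ m = L.steady m := fun m hm => by
    have n₁ : m ≠ m₁ := fun h => h₁ (h ▸ hm)
    have n₂ : m ≠ m₂ := fun h => h₂ (h ▸ hm)
    refine ⟨?_, ?_, ?_⟩
    · rw [hp, Function.update_of_ne n₁, Function.update_of_ne n₂]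
    · rw [hrate, Function.update_of_ne n₁, Function.update_of_ne n₂]
    · rw [hμ, Function.update_of_ne n₁, Function.update_of_ne n₂]
  have hn : m₁ ∉ insert m₂ L.support := by simp [h₁₂, h₁]
  have hS : ∀ f : Assignment → ℝ, ∑ m ∈ insert m₁ (insert m₂ L.support), p m * f m =
      ∑ m ∈ L.support, L.weight m * f m + (∑ m ∈ L.support, ε m * f m +
        x₁ * f m₁ + x₂ * f m₂) := fun f => by
    rw [Finset.sum_insert hn, Finset.sum_insert h₂, p₁, p₂]
    have : ∑ m ∈ L.support, p m * f m = ∑ m ∈ L.support, (L.weight m * f m + ε m * f m) :=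
      Finset.sum_congr rfl fun m hm => by rw [(hold m hm).1]; ring
    rw [this, Finset.sum_add_distrib]
    ring
  have hcongr : ∀ (q : Assignment → ℝ) (f : (m : Assignment) → ℝ → (State m.K → ℝ) → ℝ),
      ∑ m ∈ L.support, q m * f m (rate m) (μ m) =
        ∑ m ∈ L.support, q m * f m (L.rate m) (L.steady m) := fun q f =>
    Finset.sum_congr rfl fun m hm => by rw [(hold m hm).2.1, (hold m hm).2.2]
  have hpS : ∀ m ∈ insert m₁ (insert m₂ L.support), 0 ≤ p m := by
    intro m hm
    rcases Finset.mem_insert.1 hm with rfl | hm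
    · rwa [p₁]
    rcases Finset.mem_insert.1 hm with rfl | hm
    · rwa [p₂]
    · rw [(hold m hm).1]; exact hε m hm
  have hsumS : ∑ m ∈ insert m₁ (insert m₂ L.support), p m = 1 := by
    have := hS fun _ => 1
    simp only [mul_one] at this
    rw [this, L.weight_sum]; linarith
  have hrS : ∀ m ∈ insert m₁ (insert m₂ L.support), rate m ∈ Set.Icc (0 : ℝ) 1 := by
    intro m hm
    rcases Finset.mem_insert.1 hm with rfl | hm
    · rwa [rate₁]
    rcases Finset.mem_insert.1 hm with rfl | hm
    · rwa [rate₂]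
    · rw [(hold m hm).2.1]; exact L.rate_mem m hm
  have hμS : ∀ m ∈ insert m₁ (insert m₂ L.support), M.IsSteady m (μ m) := by
    intro m hm
    rcases Finset.mem_insert.1 hm with rfl | hm
    · rwa [mu₁]
    rcases Finset.mem_insert.1 hm with rfl | hm
    · rwa [mu₂]
    · rw [(hold m hm).2.2]; exact L.steady_isSteady m hm
  have hqS : ∑ m ∈ insert m₁ (insert m₂ L.support), p m * share m (μ m) Kind.G = M.q Kind.G := by
    rw [hS fun m => share m (μ m) Kind.G, hcongr _ fun m _ μ => share m μ Kind.G,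
      hcongr _ fun m _ μ => share m μ Kind.G, mu₁, mu₂, hshare, add_zero]
    exact hL.1 Kind.G
  obtain ⟨L', hfeas, -, hval⟩ := exists_of_weights _ p hpS hsumS rate hrS μ hμS hqS
  have h := hL.2 L' hfeas
  rw [hval, hS fun m => M.socialValue m (rate m) (μ m),
    hcongr _ fun m r μ => M.socialValue m r μ, hcongr _ fun m r μ => M.socialValue m r μ,
    rate₁, rate₂, mu₁, mu₂] at h
  have h' : L.socialValue =
    ∑ m ∈ L.support, L.weight m * M.socialValue m (L.rate m) (L.steady m) := rfl
  linarith

/-- Memory length serves as a label of freshness: a memory longer than all those in the support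
yields a new assignment, to which rate and steady state can be attached freely. -/
theorem notMem_support_of_lt (L : M.TeamStructure) {m : Assignment}
    (h : L.support.sup Assignment.K < m.K) : m ∉ L.support := fun hm =>
  (Finset.le_sup (f := Assignment.K) hm).not_gt h

/-- In optimal team structures, fully cooperative teams attain the bound on the time on the good
task. -/
theorem IsOptimal.share_bad_le {L : M.TeamStructure} (hL : L.IsOptimal) (hD : 0 < M.gap)
    (hdB : M.d Kind.B ≤ M.goodValue) {N : ℕ}
    (hN : M.threshold N ≤ M.d Kind.G) (hN' : M.d Kind.G < M.threshold (N + 1)) {m : Assignment}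
    (hm : m ∈ L.support) (hc : M.FullyCooperative m (L.rate m) (L.steady m))
    (hle : M.potential N (M.d Kind.G) * M.a Kind.G * share m (L.steady m) Kind.G ≤
      share m (L.steady m) Kind.B) :
    share m (L.steady m) Kind.B ≤
      M.potential N (M.d Kind.G) * M.a Kind.G * share m (L.steady m) Kind.G := by
  classical
  set K₀ := L.support.sup Assignment.K with hK₀
  obtain ⟨m₁, hm₁, μ₁, hμ₁, hs₁, hc₁⟩ := M.exists_efficient hD hdB hN hN' (K := K₀ + N + 2)
    (by omega)
  obtain ⟨m₂, hm₂, μ₂, hμ₂, hs₂, hc₂⟩ := M.exists_idle Kind.B K₀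
  have n₁ : m₁ ∉ L.support := L.notMem_support_of_lt (by omega)
  have n₂ : m₂ ∉ L.support := L.notMem_support_of_lt (by omega)
  have n₁₂ : m₁ ≠ m₂ := fun h => by have := congrArg Assignment.K h; omega
  have hμ := L.steady_isSteady m hm
  have e := share_sum hμ.1
  have e₁ := share_sum hμ₁.1
  set κ := M.potential N (M.d Kind.G) * M.a Kind.G with hκ
  have hκ0 : 0 ≤ κ := mul_nonneg (M.potential_nonneg _ _) (M.a_pos _).le
  have hz0 := share_nonneg hμ.1 Kind.G
  set z := share m (L.steady m) Kind.G with hz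
  set z₁ := share m₁ μ₁ Kind.G with hz₁
  have hz₁pos : 0 < z₁ := by
    have := share_nonneg hμ₁.1 Kind.G
    rcases this.eq_or_lt with h | h
    · rw [← hz₁] at h
      rw [← h] at hs₁ e₁
      linarith
    · exact h
  have hzz : z ≤ z₁ := by nlinarith
  have hθ : z / z₁ * z₁ = z := div_mul_cancel₀ _ hz₁pos.ne'
  -- The efficient assignment receives the fraction `θ` of the weight of `m`, chosen to reproduce
  -- its good time; the idle team on the bad task takes the rest.
  set θ := z / z₁ with hθd
  have hθ1 : θ ≤ 1 := (div_le_one hz₁pos).2 hzz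
  have hθ0 : 0 ≤ θ := div_nonneg hz0 hz₁pos.le
  have hw := L.weight_pos m hm
  have hsingle : ∀ f : Assignment → ℝ,
      ∑ m' ∈ L.support, (if m' = m then -L.weight m else 0) * f m' = -L.weight m * f m :=
    fun f => by simp [ite_mul, hm]
  have h := hL.perturb n₁ n₂ n₁₂ (r₁ := 0) (r₂ := 1) ⟨le_rfl, zero_le_one⟩ ⟨zero_le_one, le_rfl⟩
    hμ₁ hμ₂ (ε := fun m' => if m' = m then -L.weight m else 0) (x₁ := L.weight m * θ)
    (x₂ := L.weight m * (1 - θ)) (mul_nonneg hw.le hθ0) (mul_nonneg hw.le (by linarith))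
    (fun m' hm' => by
      split_ifs with heq
      · rw [heq]; simp
      · have := L.weight_pos m' hm'; linarith)
    (by
      have := hsingle fun _ => 1
      simp only [mul_one] at this
      rw [this]; ring)
    (by
      rw [hsingle fun m => share m (L.steady m) Kind.G, hs₂]
      simp only [reduceCtorEq, if_false]
      linear_combination L.weight m * hθ)
  rw [hsingle fun m => M.socialValue m (L.rate m) (L.steady m),
    M.socialValue_of_fullyCooperative hμ hc, M.socialValue_of_fullyCooperative hμ₁ hc₁,
    M.socialValue_of_fullyNonCooperative hμ₂ hc₂] at h
  -- The values from good games cancel. As `V_B` is negative, optimality says that `m` spends no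
  -- more time on the bad task than its efficient replacement.
  have h1 : M.V Kind.B * M.a Kind.B * (θ * share m₁ μ₁ Kind.B) ≤
      M.V Kind.B * M.a Kind.B * share m (L.steady m) Kind.B := by
    refine le_of_mul_le_mul_left ?_ hw
    have h2 : L.weight m * (M.V Kind.G * (M.a Kind.G * (θ * z₁))) =
      L.weight m * (M.V Kind.G * (M.a Kind.G * z)) := by rw [hθ]
    linarith
  have h2 : M.V Kind.B * M.a Kind.B < 0 := mul_neg_of_neg_of_pos M.V_B_neg (M.a_pos _)
  have h3 := (mul_le_mul_left_of_neg h2).1 h1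
  rw [hs₁] at h3
  have h4 : θ * (κ * z₁) = κ * z := by rw [← hθ]; ring
  linarith

/-- Optimal team structures do not spread fully non-cooperative teams over both tasks, unless full
non-cooperation is optimal. -/
theorem IsOptimal.idle_task {L : M.TeamStructure} (hL : L.IsOptimal) :
    (∃ L₀ : M.TeamStructure, L₀.IsOptimal ∧
          ∀ m ∈ L₀.support, M.FullyNonCooperative m (L₀.rate m) (L₀.steady m)) ∨
      ∃ t : Task, ∀ m ∈ L.support, M.FullyNonCooperative m (L.rate m) (L.steady m) →
          ∀ s, 0 < L.steady m s → m.task s = t := by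
  classical
  set K₀ := L.support.sup Assignment.K with hK₀
  obtain ⟨mG, hmG, μG, hμG, hsG, hcG⟩ := M.exists_idle Kind.G (K₀ + 1)
  obtain ⟨mB, hmB, μB, hμB, hsB, hcB⟩ := M.exists_idle Kind.B K₀
  have nG : mG ∉ L.support := L.notMem_support_of_lt (by omega)
  have nB : mB ∉ L.support := L.notMem_support_of_lt (by omega)
  have nGB : mG ≠ mB := fun h => by have := congrArg Assignment.K h; omega
  have vG := M.socialValue_of_fullyNonCooperative hμG hcG
  have vB := M.socialValue_of_fullyNonCooperative hμB hcB
  rcases le_or_gt L.socialValue 0 with hv | hv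
  -- With an optimal value of at most zero, splitting idle teams between the tasks in the required
  -- proportions is optimal too.
  · left
    have hq := M.q_sum
    rw [Kind.sum_univ] at hq
    set μ : (m : Assignment) → State m.K → ℝ :=
      Function.update (Function.update L.steady mB μB) mG μG with hμ
    have muG : μ mG = μG := Function.update_self ..
    have muB : μ mB = μB := by rw [hμ, Function.update_of_ne nGB.symm, Function.update_self]
    have hmem : ∀ m ∈ ({mG, mB} : Finset Assignment), m = mG ∨ m = mB := fun m hm => by
      simpa using hm
    obtain ⟨L₀, hfeas, hrate, hval⟩ := exists_of_weights (M := M) {mG, mB}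
      (fun m => if m = mG then M.q Kind.G else M.q Kind.B)
      (fun m _ => by split_ifs <;> exact M.q_nonneg _)
      (by rw [Finset.sum_pair nGB, if_pos rfl, if_neg nGB.symm, hq]) (fun _ => 1)
      (fun _ _ => ⟨zero_le_one, le_rfl⟩) μ
      (fun m hm => by
        rcases hmem m hm with rfl | rfl
        · rwa [muG]
        · rwa [muB])
      (by
        rw [Finset.sum_pair nGB, if_pos rfl, if_neg nGB.symm, muG, muB, hsG, hsB]
        simp)
    rw [Finset.sum_pair nGB, muG, muB, vG, vB, mul_zero, mul_zero, add_zero] at hval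
    refine ⟨L₀, ⟨hfeas, fun L' hL' => ?_⟩, fun m hm => ?_⟩
    · rw [hval]; exact (hL.2 L' hL').trans hv
    · rw [hrate]
      exact M.fullyNonCooperative_one _ _
  · right
    by_contra! hcon
    obtain ⟨m₁, hm₁, hv₁⟩ : ∃ m₁ ∈ L.support,
        0 < M.socialValue m₁ (L.rate m₁) (L.steady m₁) := by
      obtain ⟨m₁, hm₁, h⟩ := Finset.exists_lt_of_sum_lt (s := L.support) (f := fun _ => (0 : ℝ))
        (g := fun m => L.weight m * M.socialValue m (L.rate m) (L.steady m)) 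
        (lt_of_eq_of_lt Finset.sum_const_zero hv)
      exact ⟨m₁, hm₁, pos_of_mul_pos_right h (L.weight_pos m₁ hm₁).le⟩
    obtain ⟨m₂, hm₂, hc₂, s₂, hs₂, ht₂⟩ := hcon Kind.B
    obtain ⟨m₃, hm₃, hc₃, s₃, hs₃, ht₃⟩ := hcon Kind.G
    have sp : ∀ m ∈ L.support, ∀ s, 0 < L.steady m s → 0 < share m (L.steady m) (m.task s) :=
      fun m hm s hs => Finset.sum_pos' (fun s _ => (L.steady_isSteady m hm).1.1 s)
        ⟨s, by simp, hs⟩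
    have z₂ : 0 < share m₂ (L.steady m₂) Kind.G := by
      have := sp m₂ hm₂ s₂ hs₂
      cases h : m₂.task s₂ with
      | G => rwa [h] at this
      | B => exact absurd h ht₂
    have z₃ : 0 < share m₃ (L.steady m₃) Kind.B := by
      have := sp m₃ hm₃ s₃ hs₃
      cases h : m₃.task s₃ with
      | B => rwa [h] at this
      | G => exact absurd h ht₃
    have e₁ := share_sum (L.steady_isSteady m₁ hm₁).1
    have e₂ := share_sum (L.steady_isSteady m₂ hm₂).1
    have e₃ := share_sum (L.steady_isSteady m₃ hm₃).1
    have g₁ := share_nonneg (L.steady_isSteady m₁ hm₁).1 Kind.G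
    have b₁ := share_nonneg (L.steady_isSteady m₁ hm₁).1 Kind.B
    have b₂ := share_nonneg (L.steady_isSteady m₂ hm₂).1 Kind.B
    have g₃ := share_nonneg (L.steady_isSteady m₃ hm₃).1 Kind.G
    have w₂ := L.weight_pos m₂ hm₂
    have w₃ := L.weight_pos m₃ hm₃
    set zG := share m₂ (L.steady m₂) Kind.G + share m₃ (L.steady m₃) Kind.G with hzG
    set zB := share m₂ (L.steady m₂) Kind.B + share m₃ (L.steady m₃) Kind.B with hzB
    -- Weight `w` is taken from each of `m₂` and `m₃`. Their joint time on both tasks leaves room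
    -- for weight `w * η` on the valuable `m₁`, and pure idle teams absorb the remaining time.
    set η := min zG zB with hη
    have hη0 : 0 < η := lt_min (by linarith) (by linarith)
    have hηG : η ≤ zG := min_le_left _ _
    have hηB : η ≤ zB := min_le_right _ _
    -- The half allows for `m₂ = m₃`, where `w` is taken twice from the same assignment.
    set w := min (L.weight m₂) (L.weight m₃) / 2 with hw
    have hw0 : 0 < w := half_pos (lt_min w₂ w₃)
    have hw₂ : 2 * w ≤ L.weight m₂ := by
      have := min_le_left (L.weight m₂) (L.weight m₃); rw [hw]; linarith
    have hw₃ : 2 * w ≤ L.weight m₃ := by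
      have := min_le_right (L.weight m₂) (L.weight m₃); rw [hw]; linarith
    have hsingle : ∀ f : Assignment → ℝ, ∑ m ∈ L.support, ((if m = m₁ then w * η else 0) -
        (if m = m₂ then w else 0) - (if m = m₃ then w else 0)) * f m =
        w * η * f m₁ - w * f m₂ - w * f m₃ := fun f => by
      simp [sub_mul, ite_mul, Finset.sum_sub_distrib, hm₁, hm₂, hm₃]
    have h := hL.perturb nG nB nGB (r₁ := 1) (r₂ := 1) ⟨zero_le_one, le_rfl⟩
      ⟨zero_le_one, le_rfl⟩ hμG hμB (ε := fun m => (if m = m₁ then w * η else 0) -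
        (if m = m₂ then w else 0) - (if m = m₃ then w else 0))
      (x₁ := w * (zG - η * share m₁ (L.steady m₁) Kind.G))
      (x₂ := w * (zB - η * share m₁ (L.steady m₁) Kind.B))
      (mul_nonneg hw0.le (by nlinarith)) (mul_nonneg hw0.le (by nlinarith))
      (fun m hm => by
        have hwm := L.weight_pos m hm
        have hwη := mul_pos hw0 hη0
        by_cases c₂ : m = m₂
        · rw [if_pos c₂, c₂]
          split_ifs <;> linarith
        · rw [if_neg c₂]
          by_cases c₃ : m = m₃
          · rw [if_pos c₃, c₃]
            split_ifs <;> linarith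
          · rw [if_neg c₃]
            split_ifs <;> linarith)
      (by
        have := hsingle fun _ => 1
        simp only [mul_one] at this
        rw [this, hzG, hzB]
        linear_combination w * e₂ + w * e₃ - w * η * e₁)
      (by
        rw [hsingle fun m => share m (L.steady m) Kind.G, hsG, hsB]
        simp only [reduceCtorEq, if_false, if_true, hzG]
        ring)
    rw [hsingle fun m => M.socialValue m (L.rate m) (L.steady m), vG, vB,
      M.socialValue_of_fullyNonCooperative (L.steady_isSteady m₂ hm₂) hc₂,
      M.socialValue_of_fullyNonCooperative (L.steady_isSteady m₃ hm₃) hc₃] at h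
    have := mul_pos (mul_pos hw0 hη0) hv₁
    linarith

end TeamStructure

end Model

end ReactiveTeams

/-! ### Assembly. -/

theorem proposition4 (M : Model)
    (hG : M.d Kind.G > M.δ / (1 - M.δ) * M.a Kind.G * M.c Kind.G)
    (hmax : max (M.d Kind.G) (M.d Kind.B) < M.δ / (1 - M.δ) * M.a Kind.B * M.c Kind.B)
    (hB : M.d Kind.B < M.δ / (1 - M.δ) * M.a Kind.G * M.c Kind.G) :
    ∃ N_B : ℕ, ∀ L : M.TeamStructure, L.IsOptimal →
      (∀ m ∈ L.support, M.FullyCooperative m (L.rate m) (L.steady m) →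
        -- players are indifferent in good games
        M.IndifferentInGood m (L.rate m) (L.steady m) ∧
        -- after a good game: `N_B` bad tasks, then the good task with positive probability,
        -- and for sure one period later if it was not assigned then
        (∀ s, 0 < L.steady m s → m.game s = some Kind.G →
          (∀ k < N_B, M.taskProb m s k Kind.B = 1) ∧
          0 < M.taskProb m s N_B Kind.G ∧
          (∀ s', 0 < (M.trans m ^ (N_B + 1)) s s' → m.task s' = Kind.B →
            m.rule s' Kind.G = 1)) ∧
        -- on the good task, teams stay there until a good game is played
        (∀ s, 0 < L.steady m s → m.task s = Kind.G → m.game s ≠ some Kind.G →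
          m.rule s Kind.G = 1)) ∧
      ((∃ L₀ : M.TeamStructure, L₀.IsOptimal ∧
          ∀ m ∈ L₀.support, M.FullyNonCooperative m (L₀.rate m) (L₀.steady m)) ∨
        ∃ t : Task, ∀ m ∈ L.support, M.FullyNonCooperative m (L.rate m) (L.steady m) →
          ∀ s, 0 < L.steady m s → m.task s = t) := by
  have hx : M.goodValue < M.d Kind.G := M.goodValue_lt hG
  have hdB : M.d Kind.B ≤ M.goodValue := (M.lt_goodValue hG hB).le
  have hGB := (le_max_left _ _).trans_lt hmax
  have hD : 0 < M.gap := M.gap_pos (hx.trans hGB)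
  -- `N_B` is determined by the primitives alone, as the index of the last threshold not above
  -- `d_G`; hence it serves all optimal structures.
  obtain ⟨N, hN, hN'⟩ := M.exists_threshold hx hGB
  refine ⟨N, fun L hL => ⟨fun m hm hc => ?_, hL.idle_task⟩⟩
  have hr := L.rate_mem m hm
  have hμ := L.steady_isSteady m hm
  obtain ⟨A, hA⟩ := M.exists_discounted m (M.discount_nonneg hr) (M.discount_lt_one hr)
    (fun s => M.autarky (m.game s))
  obtain ⟨J, hJ⟩ := M.exists_discounted m (M.discount_nonneg hr) (M.discount_lt_one hr)
    (fun s => M.gain (m.game s))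
  have hw := Model.FullyCooperative.isPromise M hr hμ hc hA hJ
  have ht := hL.share_bad_le hD hdB hN hN' hm hc (hw.share_le hD hx N)
  refine ⟨M.indifferentInGood_of_binding hr hA hJ hc fun σ h hh hg => ?_,
    fun s hs hg => ⟨?_, ?_, ?_⟩, fun s hs hk hg => hw.stay hD hx ht hs hk hg⟩
  · exact hw.binding hD hx ht (Model.OnPath.state_pos M hμ hh) hg
  · exact fun k hk => hw.taskProb_bad hD hx ht hN hs hg hk
  · exact hw.taskProb_good_pos hD hx ht hN hN' hs hg
  · exact fun s' h hB => hw.rule_good_of_bad hD hx ht hN hs hg h hB
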